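/- Let $n\ge 1$ and $\alpha,\beta>0$. For a tempered distribution $f\in\mathcal S'(\mathbb R^n)$ (complex valued) put $$\|f\|_{\dot B^{-\beta}_{\infty,\infty}}=\sup_{t>0}t^{\beta/2}\|e^{t\Delta}f\|_{L^\infty},$$ and write $f\in\dot B^{-\beta}_{\infty,\infty}$ if this is finite. For tempered distributions $f,g$ we write $(\sqrt{-\Delta})^\alpha f=g$ if $\widehat g=|\xi|^\alpha\widehat f$ on $\mathbb R^n\setminus\{0\}$, i.e. $\langle g,\varphi\rangle=\langle f,(\sqrt{-\Delta})^\alpha\varphi\rangle$ for all Schwartz functions $\varphi$ whose Fourier transform vanishes near $0$ (this determines $g$ up to a polynomial; the statements below hold for every such $g$ in $L^p$). For $g$ locally integrable let $\mathcal M_g(x)=\sup_{r>0}\frac1{|B(x,r)|}\int_{B(x,r)}|g(y)|\,dy$. Then: 1. (Reproducing formula.) If $f\in\dot B^{-\beta}_{\infty,\infty}$ and $N\in\mathbb N$, $N>\alpha/2$, then $$f=\frac{(-1)^N}{\Gamma(N)}\int_0^{+\infty}(t\Delta)^Ne^{t\Delta}f\,\frac{dt}{t}$$ in $\mathcal S'(\mathbb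 R^n)$, the integral converging absolutely when tested against any Schwartz function. 2. (Hedberg-type inequality.) There is a constant $C$ depending only on $n,\alpha,\beta$ such that, for all $1<p\le\infty$ and all $f\in\dot B^{-\beta}_{\infty,\infty}$ with $(\sqrt{-\Delta})^\alpha f=g\in L^p$, the distribution $f$ is a locally integrable function and, for almost every $x$, $$|f(x)|\le C\,\bigl(\mathcal M_g(x)\bigr)^{\frac{\beta}{\alpha+\beta}}\,\|f\|_{\dot B^{-\beta}_{\infty,\infty}}^{\frac{\alpha}{\alpha+\beta}}.$$ 3. (Refined Gagliardo–Nirenberg inequality.) Let $1<p\le\infty$ and $\frac1q=\frac{\beta}{\alpha+\beta}\frac1p$. There is a constant $C$ depending only on $n,p,\alpha,\beta$ such that every $f\in\dot B^{-\beta}_{\infty,\infty}$ with $(\sqrt{-\Delta})^\alpha f=g\in L^p$ belongs to $L^q$ and $$\|f\|_q\le C\,\|g\|_p^{\frac{\beta}{\alpha+\beta}}\,\|f\|_{\dot B^{-\beta}_{\infty,\infty}}^{\frac{\alpha}{\alpha+\beta}}.$$ -/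

import Mathlib

open MeasureTheory Filter Topology
open scoped SchwartzMap FourierTransform ENNReal NNReal

noncomputable section

/-- The tempered distribution `u` on `ℝⁿ` is (integration against) the function `F`. -/
def RepresentedBy {n : ℕ} (u : 𝓢'(EuclideanSpace ℝ (Fin n), ℂ))
    (F : EuclideanSpace ℝ (Fin n) → ℂ) : Prop :=
  ∀ φ : 𝓢(EuclideanSpace ℝ (Fin n), ℂ),
    Integrable (fun x => φ x * F x) ∧ u φ = ∫ x, φ x * F x

/-- The `L^p` norm of a tempered distribution, with value `∞` if the distribution is not
(represented by) a function in `L^p`. -/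
def distLpNorm {n : ℕ} (p : ℝ≥0∞) (u : 𝓢'(EuclideanSpace ℝ (Fin n), ℂ)) : ℝ≥0∞ :=
  ⨅ (F : EuclideanSpace ℝ (Fin n) → ℂ) (_ : RepresentedBy u F), eLpNorm F p volume

/-- The heat semigroup `e^{tΔ}` (for `t ≥ 0`) on tempered distributions. In the normalization
`𝓕 φ ξ = ∫ e^{-2π i x·ξ} φ x dx`, the operator `-Δ` has the symbol `(2π|ξ|)²`. -/
def heat {n : ℕ} (t : ℝ) (f : 𝓢'(EuclideanSpace ℝ (Fin n), ℂ)) :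
    𝓢'(EuclideanSpace ℝ (Fin n), ℂ) :=
  TemperedDistribution.fourierMultiplierCLM ℂ
    (fun ξ => ((Real.exp (-t * (2 * Real.pi * ‖ξ‖) ^ 2) : ℝ) : ℂ)) f

/-- The norm of the homogeneous Besov space `Ḃ^{-β}_{∞,∞}`, `β > 0`, in its thermic form
`sup_{t > 0} t^{β/2} ‖e^{tΔ} f‖_∞`, with value `∞` if `f` is not in the space. -/
def besovNorm {n : ℕ} (β : ℝ) (f : 𝓢'(EuclideanSpace ℝ (Fin n), ℂ)) : ℝ≥0∞ :=
  ⨆ (t : ℝ) (_ : 0 < t), ENNReal.ofReal (t ^ (β / 2)) * distLpNorm ∞ (heat t f)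

/-- `(√-Δ)^α f = g`, i.e. the Fourier transform of `g` equals `(2π|ξ|)^α` times the one of `f`
on `ℝⁿ ∖ {0}`. The symbol is not smooth at the origin, so this is tested on those Schwartz
functions `φ` whose Fourier transform vanishes near `0`: then `ψ = (√-Δ)^α φ` is again a Schwartz
function, and the requirement is `⟨g, φ⟩ = ⟨f, (√-Δ)^α φ⟩`. As usual for homogeneous operators,
this determines `g` modulo polynomials. -/
def IsFracLaplacian {n : ℕ} (α : ℝ) (f g : 𝓢'(EuclideanSpace ℝ (Fin n), ℂ)) : Prop :=
  ∀ φ ψ : 𝓢(EuclideanSpace ℝ (Fin n), ℂ),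
    (∀ᶠ ξ in 𝓝 0, (𝓕 φ) ξ = 0) →
    (∀ ξ, (𝓕 ψ) ξ = (((2 * Real.pi * ‖ξ‖) ^ α : ℝ) : ℂ) * (𝓕 φ) ξ) →
    g φ = f ψ

/-- The Hardy-Littlewood maximal function `sup_{r > 0} |B(x,r)|⁻¹ ∫_{B(x,r)} |g(y)| dy`. -/
def maximalFunction {n : ℕ} (g : EuclideanSpace ℝ (Fin n) → ℂ)
    (x : EuclideanSpace ℝ (Fin n)) : ℝ≥0∞ :=
  ⨆ (r : ℝ) (_ : 0 < r),
    (volume (Metric.ball x r))⁻¹ * ∫⁻ y in Metric.ball x r, ‖g y‖ₑ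

end

/-! Write `q(ξ) = (2π|ξ|)²` for the symbol of `-Δ`. The pointwise inequality rests on a split of `f`
at a time scale `T`. With an integer `M > α/2`, `f = (1 - e^{TΔ})^M f - ∑_{j=1}^{M} (-1)^j (M choose
j) e^{jTΔ} f`. By the definition of the Besov norm the sum is bounded by `2^M T^{-β/2} ‖f‖_Ḃ`. The
symbol of the remaining term is `(1 - e^{-Tq})^M = T^{α/2} · (1 - e^{-Tq})^M (Tq)^{-α/2} · q^{α/2}`,
so formally it equals `T^{α/2} A_T * g`. The function `u ↦ (1 - e^{-u})^M u^{-α/2}` is the Laplace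
transform of an integrable `k` (`exists_laplace_eq`: finite differences of a truncated power), hence
`A_T = ∫ k(σ) h_{Tσ} dσ` is a mixture of heat kernels, and `|A_T * g| ≤ ‖k‖₁ M_g` because a heat
kernel is an average of normalised balls. Optimising over `T` gives the Hedberg inequality with a
constant independent of `p`; the `L^q` bound follows from it by the maximal theorem.

The relation between `f` and `g` holds only away from frequency zero, so `(1 - e^{TΔ})^M f = T^{α/2}
A_T * g` is first proved for test functions with no low frequencies. A low-frequency cutoff at scale
`1/r` is then removed by letting `r → ∞`: on the `f` side the error is `O(r^{-β})` by the Besov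
norm, and on the `g` side it vanishes because `∫ k = 0` forces `‖e^{r²Δ} A_T‖₁ → 0`. This is
`apply_heatDiffSymbol_eq`.

The reproducing formula is Taylor's formula in `t`: the derivative of `∑_{k<N} (t^k/k!) ⟨(-Δ)^k
e^{tΔ} f, φ⟩` telescopes to one term, and this sum is `f φ` at `t = 0` and tends to `0` as `t → ∞`.
-/

/-! ### Uniform derivative bounds for `e^{-tq}` and its Taylor remainders in `t`. -/

section SymbolEstimates

open scoped ContDiff

variable {ι E F : Type*} [NormedAddCommGroup E] [NormedSpace ℝ E]
  [NormedAddCommGroup F] [NormedSpace ℝ F]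

/-- The derivatives of order at most `J` of the functions `a i` are bounded by the weight `W i`
times a polynomial, uniformly in `i`. -/
def SymbolBound (J : ℕ) (W : ι → E → ℝ) (a : ι → E → F) : Prop :=
  ∀ j ≤ J, ∃ (C : ℝ) (m : ℕ), 0 ≤ C ∧
    ∀ i x, ‖iteratedFDeriv ℝ j (a i) x‖ ≤ C * (1 + ‖x‖) ^ m * W i x

theorem SymbolBound.const_smul {J : ℕ} {W W' : ι → E → ℝ} {a : ι → E → F}
    (ha : ∀ i, ContDiff ℝ ∞ (a i)) (h : SymbolBound J W a) (c : ι → ℝ) {K : ℝ} (hK : 0 ≤ K)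
    (hW : ∀ i x, |c i| * W i x ≤ K * W' i x) :
    SymbolBound J W' (fun i x => c i • a i x) := by
  intro j hj
  obtain ⟨C, m, hC, h⟩ := h j hj
  refine ⟨C * K, m, by positivity, fun i x => ?_⟩
  have : iteratedFDeriv ℝ j (fun x => c i • a i x) x = c i • iteratedFDeriv ℝ j (a i) x :=
    iteratedFDeriv_const_smul_apply (((ha i).of_le (mod_cast le_top)).contDiffAt)
  rw [this, norm_smul, Real.norm_eq_abs]
  calc |c i| * ‖iteratedFDeriv ℝ j (a i) x‖ ≤ |c i| * (C * (1 + ‖x‖) ^ m * W i x) := by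
        gcongr; exact h i x
    _ = C * (1 + ‖x‖) ^ m * (|c i| * W i x) := by ring
    _ ≤ C * (1 + ‖x‖) ^ m * (K * W' i x) :=
        mul_le_mul_of_nonneg_left (hW i x) (by positivity)
    _ = _ := by ring

theorem SymbolBound.add {J : ℕ} {W : ι → E → ℝ} (hW : ∀ i x, 0 ≤ W i x) {a b : ι → E → F}
    (ha : ∀ i, ContDiff ℝ ∞ (a i)) (hb : ∀ i, ContDiff ℝ ∞ (b i))
    (h : SymbolBound J W a) (h' : SymbolBound J W b) :
    SymbolBound J W (fun i x => a i x + b i x) := by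
  intro j hj
  obtain ⟨C, m, hC, h⟩ := h j hj
  obtain ⟨C', m', hC', h'⟩ := h' j hj
  refine ⟨C + C', m + m', by positivity, fun i x => ?_⟩
  have : iteratedFDeriv ℝ j (fun x => a i x + b i x) x
      = iteratedFDeriv ℝ j (a i) x + iteratedFDeriv ℝ j (b i) x :=
    iteratedFDeriv_add_apply (((ha i).of_le (mod_cast le_top)).contDiffAt)
      (((hb i).of_le (mod_cast le_top)).contDiffAt)
  rw [this]
  have h1 : (1 : ℝ) ≤ 1 + ‖x‖ := by linarith [norm_nonneg x]
  calc _ ≤ ‖iteratedFDeriv ℝ j (a i) x‖ + ‖iteratedFDeriv ℝ j (b i) x‖ := norm_add_le _ _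
    _ ≤ C * (1 + ‖x‖) ^ m * W i x + C' * (1 + ‖x‖) ^ m' * W i x := add_le_add (h i x) (h' i x)
    _ ≤ C * (1 + ‖x‖) ^ (m + m') * W i x + C' * (1 + ‖x‖) ^ (m + m') * W i x := by
        have := hW i x
        gcongr <;> first | exact h1 | omega
    _ = _ := by ring

theorem SymbolBound.smul {J : ℕ} {W V : ι → E → ℝ} (hW : ∀ i x, 0 ≤ W i x)
    (hV : ∀ i x, 0 ≤ V i x) {a : ι → E → ℝ} {b : ι → E → F}
    (ha : ∀ i, ContDiff ℝ ∞ (a i)) (hb : ∀ i, ContDiff ℝ ∞ (b i))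
    (h : SymbolBound J W a) (h' : SymbolBound J V b) :
    SymbolBound J (fun i x => W i x * V i x) (fun i x => a i x • b i x) := by
  intro j hj
  choose! C m hC h using h
  choose! C' m' hC' h' using h'
  refine ⟨∑ l ∈ Finset.range (j + 1), (j.choose l : ℝ) * C l * C' (j - l),
    ∑ l ∈ Finset.range (j + 1), (m l + m' (j - l)), ?_, fun i x => ?_⟩
  · refine Finset.sum_nonneg fun l hl => ?_
    have := Finset.mem_range.1 hl
    have h1 := hC l (by omega)
    have h2 := hC' (j - l) (by omega)
    positivity
  · have h1 : (1 : ℝ) ≤ 1 + ‖x‖ := by linarith [norm_nonneg x]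
    refine (norm_iteratedFDeriv_smul_le (ha i) (hb i) x (mod_cast le_top)).trans ?_
    rw [Finset.sum_mul, Finset.sum_mul]
    refine Finset.sum_le_sum fun l hl => ?_
    have hl' := Finset.mem_range.1 hl
    have e1 := hC l (by omega)
    have e2 := hC' (j - l) (by omega)
    have e3 : m l + m' (j - l) ≤ ∑ l ∈ Finset.range (j + 1), (m l + m' (j - l)) :=
      Finset.single_le_sum (f := fun l => m l + m' (j - l)) (fun _ _ => Nat.zero_le _) hl
    calc _ ≤ (j.choose l : ℝ) * (C l * (1 + ‖x‖) ^ m l * W i x)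
          * (C' (j - l) * (1 + ‖x‖) ^ m' (j - l) * V i x) := by
          have e4 := hW i x
          gcongr
          · exact h l (by omega) i x
          · exact h' (j - l) (by omega) i x
      _ = (j.choose l : ℝ) * C l * C' (j - l) * (1 + ‖x‖) ^ (m l + m' (j - l))
          * (W i x * V i x) := by rw [pow_add]; ring
      _ ≤ _ := by
          have := mul_nonneg (hW i x) (hV i x)
          gcongr

theorem SymbolBound.of_hasTemperateGrowth {J : ℕ} {b : E → F} (hb : b.HasTemperateGrowth) :
    SymbolBound J (fun _ _ => 1) (fun _ : ι => b) := by
  intro j _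
  obtain ⟨k, C, hC, h⟩ := hb.norm_iteratedFDeriv_le_uniform j
  exact ⟨C, k, hC, fun i x => by simpa using h j le_rfl x⟩

theorem SymbolBound.zero {W : ι → E → ℝ} {a : ι → E → F} {C : ℝ} (hC : 0 ≤ C) {m : ℕ}
    (h : ∀ i x, ‖a i x‖ ≤ C * (1 + ‖x‖) ^ m * W i x) : SymbolBound 0 W a := by
  intro j hj
  obtain rfl : j = 0 := by omega
  exact ⟨C, m, hC, fun i x => by simpa using h i x⟩

/-- This drives the inductions on the order: when the gradient `a'` is an explicit combination of
`a` and families already estimated, bounds of order `J` on `a` give bounds of order `J + 1`. -/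
theorem SymbolBound.succ {J : ℕ} {W : ι → E → ℝ} {a : ι → E → F} (h0 : SymbolBound 0 W a)
    {a' : ι → E → E →L[ℝ] F} (haa' : ∀ i x, HasFDerivAt (a i) (a' i x) x)
    (h : SymbolBound J W a') : SymbolBound (J + 1) W a := by
  intro j hj
  rcases j with _ | j
  · exact h0 0 le_rfl
  · obtain ⟨C, m, hC, h⟩ := h j (by omega)
    refine ⟨C, m, hC, fun i x => ?_⟩
    have : fderiv ℝ (a i) = a' i := funext fun x => (haa' i x).fderiv
    rw [← norm_iteratedFDeriv_fderiv, this]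
    exact h i x

theorem SymbolBound.hasTemperateGrowth {W : ι → E → ℝ} {a : ι → E → F} (i : ι)
    {K : ℝ} {r : ℕ} (hW : ∀ x, W i x ≤ K * (1 + ‖x‖) ^ r)
    (ha : ContDiff ℝ ∞ (a i)) (h : ∀ J, SymbolBound J W a) : (a i).HasTemperateGrowth := by
  refine ⟨ha, fun j => ?_⟩
  obtain ⟨C, m, hC, h⟩ := h j j le_rfl
  refine ⟨m + r, C * K, fun x => (h i x).trans ?_⟩
  calc C * (1 + ‖x‖) ^ m * W i x ≤ C * (1 + ‖x‖) ^ m * (K * (1 + ‖x‖) ^ r) := by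
        gcongr; exact hW x
    _ = _ := by ring

theorem abs_exp_neg_sub_exp_neg_le {x y : ℝ} (hx : 0 ≤ x) (hy : 0 ≤ y) :
    |Real.exp (-x) - Real.exp (-y)| ≤ |x - y| := by
  wlog h : x ≤ y generalizing x y
  · rw [abs_sub_comm, abs_sub_comm x]; exact this hy hx (le_of_not_ge h)
  rw [abs_of_nonneg (by simpa using h), abs_of_nonpos (by linarith)]
  have h1 : Real.exp (-y) = Real.exp (-x) * Real.exp (-(y - x)) := by
    rw [← Real.exp_add]; ring_nf
  have h2 := Real.one_sub_le_exp_neg (y - x)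
  have h3 : Real.exp (-x) ≤ 1 := Real.exp_le_one_iff.2 (by linarith)
  have h4 := Real.exp_pos (-x)
  rw [h1]
  nlinarith

theorem abs_exp_neg_taylor_two_le {x y : ℝ} (hx : 0 ≤ x) (hy : 0 ≤ y) :
    |Real.exp (-x) - Real.exp (-y) + (x - y) * Real.exp (-y)| ≤ |x - y| ^ 2 := by
  rcases le_total y x with h | h
  · obtain ⟨w, rfl⟩ : ∃ w, x = y + w := ⟨x - y, by ring⟩
    have hw : 0 ≤ w := by linarith
    have h1 : Real.exp (-(y + w)) = Real.exp (-y) * Real.exp (-w) := by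
      rw [← Real.exp_add]; ring_nf
    have h2 := Real.one_sub_le_exp_neg w
    have h3 : Real.exp (-y) ≤ 1 := Real.exp_le_one_iff.2 (by linarith)
    have h4 := Real.exp_pos (-y)
    -- Reciprocal of `1 + w + w²/2 ≤ e^w`, since `(1 - w + w²)(1 + w + w²/2) = 1 + (w² + w³ + w⁴)/2
    -- ≥ 1`.
    have h5 : Real.exp (-w) ≤ 1 - w + w ^ 2 := by
      rw [Real.exp_neg]
      apply inv_le_of_inv_le₀ (by nlinarith)
      have := Real.quadratic_le_exp_of_nonneg hw
      refine le_trans ?_ this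
      rw [inv_le_comm₀ (by nlinarith) (by positivity), inv_eq_one_div, div_le_iff₀ (by positivity)]
      nlinarith [pow_nonneg hw 3, pow_nonneg hw 4]
    rw [h1, add_sub_cancel_left, sq_abs, abs_le]
    constructor <;> nlinarith
  · obtain ⟨w, rfl⟩ : ∃ w, y = x + w := ⟨y - x, by ring⟩
    have hw : 0 ≤ w := by linarith
    have h1 : Real.exp (-(x + w)) = Real.exp (-x) * Real.exp (-w) := by
      rw [← Real.exp_add]; ring_nf
    have h2 := Real.one_sub_le_exp_neg w
    have h3 : Real.exp (-x) ≤ 1 := Real.exp_le_one_iff.2 (by linarith)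
    have h4 := Real.exp_pos (-x)
    have h5 := Real.add_one_le_exp w
    have h6 : Real.exp w * Real.exp (-w) = 1 := by rw [← Real.exp_add]; simp
    have h7 := Real.exp_pos (-w)
    have h8 : (1 + w) * Real.exp (-w) ≤ 1 := by nlinarith
    rw [h1, sq_abs, abs_le]
    have e : Real.exp (-x) - Real.exp (-x) * Real.exp (-w)
        + (x - (x + w)) * (Real.exp (-x) * Real.exp (-w))
        = Real.exp (-x) * (1 - (1 + w) * Real.exp (-w)) := by ring
    rw [e]
    constructor
    · nlinarith [sq_nonneg (x - (x + w)), mul_nonneg h4.le (sub_nonneg.2 h8)]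
    · have : 1 - (1 + w) * Real.exp (-w) ≤ w ^ 2 := by nlinarith
      nlinarith [sub_nonneg.2 h8]

/-- Pairs of times in `[0, T]`. -/
abbrev TimePair (T : ℝ) : Type := {p : ℝ × ℝ // p.1 ∈ Set.Icc 0 T ∧ p.2 ∈ Set.Icc 0 T}

variable {q : E → ℝ}

theorem hasFDerivAt_exp_neg_mul (hq : q.HasTemperateGrowth) (t : ℝ) (x : E) :
    HasFDerivAt (fun x => Real.exp (-t * q x)) ((-t) • (Real.exp (-t * q x) • fderiv ℝ q x)) x := by
  have := (((hq.1.differentiable (by simp)) x).hasFDerivAt.const_mul (-t)).exp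
  convert this using 1
  rw [smul_comm]

theorem contDiff_exp_neg_mul (hq : q.HasTemperateGrowth) (t : ℝ) :
    ContDiff ℝ ∞ (fun x => Real.exp (-t * q x)) := (contDiff_const.mul hq.1).exp

theorem HasTemperateGrowth.fderiv_right (hq : q.HasTemperateGrowth) :
    (fderiv ℝ q).HasTemperateGrowth := by
  refine ⟨(contDiff_infty_iff_fderiv.1 hq.1).2, fun j => ?_⟩
  obtain ⟨k, C, h⟩ := hq.2 (j + 1)
  exact ⟨k, C, fun x => by rw [norm_iteratedFDeriv_fderiv]; exact h x⟩

/-- The gradient is `-t e^{-tq} ∇q` with `0 ≤ t ≤ T`, so the weight `e^{-tq}` survives every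
differentiation. Keeping it, instead of bounding it by `1`, yields Gaussian decay later. -/
theorem symbolBound_exp_neg_mul (hq : q.HasTemperateGrowth) (J : ℕ) (T : ℝ) :
    SymbolBound J (fun (t : Set.Icc 0 T) x => Real.exp (-t * q x))
      (fun (t : Set.Icc 0 T) x => Real.exp (-t * q x)) := by
  have h0 : SymbolBound 0 (fun (t : Set.Icc 0 T) x => Real.exp (-t * q x))
      (fun (t : Set.Icc 0 T) x => Real.exp (-t * q x)) :=
    SymbolBound.zero (C := 1) (m := 0) zero_le_one fun i x => by simp [abs_of_pos (Real.exp_pos _)]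
  induction J with
  | zero => exact h0
  | succ J ih =>
    have hT (t : Set.Icc 0 T) : |-(t : ℝ)| ≤ |T| := by
      rw [abs_neg]; exact abs_le_abs_of_nonneg t.2.1 t.2.2
    refine SymbolBound.succ h0 (fun t x => hasFDerivAt_exp_neg_mul hq t x) ?_
    refine SymbolBound.const_smul (fun i => (contDiff_exp_neg_mul hq _).smul
      (contDiff_infty_iff_fderiv.1 hq.1).2)
      (SymbolBound.smul (fun _ _ => (Real.exp_pos _).le) (fun _ _ => zero_le_one)
      (fun i => contDiff_exp_neg_mul hq _) (fun i => (contDiff_infty_iff_fderiv.1 hq.1).2) ih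
      (SymbolBound.of_hasTemperateGrowth (HasTemperateGrowth.fderiv_right hq))) _
      (K := |T|) (abs_nonneg _) fun t x => ?_
    rw [mul_one]
    exact mul_le_mul_of_nonneg_right (hT t) (Real.exp_pos _).le

theorem exp_neg_mul_hasTemperateGrowth (hq : q.HasTemperateGrowth) (hq0 : ∀ x, 0 ≤ q x) {t : ℝ}
    (ht : 0 ≤ t) : (fun x => Real.exp (-t * q x)).HasTemperateGrowth :=
  SymbolBound.hasTemperateGrowth (ι := Set.Icc 0 t) ⟨t, ht, le_rfl⟩ (K := 1) (r := 0)
    (fun x => by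
      simp only [pow_zero, mul_one]
      exact Real.exp_le_one_iff.2 (by nlinarith [hq0 x, mul_nonneg ht (hq0 x)]))
    (contDiff_exp_neg_mul hq t) (fun J => symbolBound_exp_neg_mul hq J t)

theorem SymbolBound.comp_index {κ : Type*} {J : ℕ} {W : ι → E → ℝ} {a : ι → E → F}
    (h : SymbolBound J W a) (e : κ → ι) : SymbolBound J (fun k => W (e k)) (fun k => a (e k)) := by
  intro j hj
  obtain ⟨C, m, hC, h⟩ := h j hj
  exact ⟨C, m, hC, fun i x => h _ x⟩

/-- With `e_i = e^{-t_i q}`, the gradient of `e₁ - e₂` is `-t₂ (e₁ - e₂) ∇q - (t₁ - t₂) e₁ ∇q`: each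
term still carries the factor `|t₁ - t₂|`. -/
theorem symbolBound_exp_sub_exp (hq : q.HasTemperateGrowth) (hq0 : ∀ x, 0 ≤ q x) (J : ℕ) (T : ℝ) :
    SymbolBound J (fun (p : TimePair T) _ => |p.1.1 - p.1.2|)
      (fun p x => Real.exp (-p.1.1 * q x) - Real.exp (-p.1.2 * q x)) := by
  obtain ⟨k, C, hC, hqb⟩ := hq.norm_iteratedFDeriv_le_uniform 0
  have h0 : SymbolBound 0 (fun (p : TimePair T) _ => |p.1.1 - p.1.2|)
      (fun p x => Real.exp (-p.1.1 * q x) - Real.exp (-p.1.2 * q x)) := by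
    refine SymbolBound.zero (C := C) (m := k) hC fun p x => ?_
    have h1 := hqb 0 le_rfl x
    rw [norm_iteratedFDeriv_zero, Real.norm_eq_abs, abs_of_nonneg (hq0 x)] at h1
    have := abs_exp_neg_sub_exp_neg_le (mul_nonneg p.2.1.1 (hq0 x)) (mul_nonneg p.2.2.1 (hq0 x))
    rw [Real.norm_eq_abs, neg_mul, neg_mul]
    refine this.trans ?_
    rw [← sub_mul, abs_mul, abs_of_nonneg (hq0 x), mul_comm]
    gcongr
  have hcd (t : ℝ) := contDiff_exp_neg_mul hq t
  have hdq := (contDiff_infty_iff_fderiv.1 hq.1).2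
  have hdqb := HasTemperateGrowth.fderiv_right hq
  induction J with
  | zero => exact h0
  | succ J ih =>
    refine SymbolBound.succ h0 (a' := fun p x =>
      (-p.1.2) • ((Real.exp (-p.1.1 * q x) - Real.exp (-p.1.2 * q x)) • fderiv ℝ q x)
      + (-(p.1.1 - p.1.2)) • (Real.exp (-p.1.1 * q x) • fderiv ℝ q x)) (fun p x => ?_) ?_
    · refine ((hasFDerivAt_exp_neg_mul hq p.1.1 x).sub
        (hasFDerivAt_exp_neg_mul hq p.1.2 x)).congr_fderiv ?_
      generalize Real.exp (-p.1.1 * q x) = e₁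
      generalize Real.exp (-p.1.2 * q x) = e₂
      module
    · refine SymbolBound.add (fun _ _ => abs_nonneg _)
        (fun p => (((hcd _).sub (hcd _)).smul hdq).const_smul _)
        (fun p => ((hcd _).smul hdq).const_smul _) ?_ ?_
      · refine SymbolBound.const_smul (fun p => ((hcd _).sub (hcd _)).smul hdq)
          (SymbolBound.smul (fun _ _ => abs_nonneg _) (fun _ _ => zero_le_one)
          (fun p => (hcd _).sub (hcd _)) (fun _ => hdq) ih
          (SymbolBound.of_hasTemperateGrowth hdqb)) _ (K := |T|) (abs_nonneg _) fun p x => ?_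
        rw [mul_one, abs_neg]
        exact mul_le_mul_of_nonneg_right (abs_le_abs_of_nonneg p.2.2.1 p.2.2.2) (by positivity)
      · refine SymbolBound.const_smul (fun p => (hcd _).smul hdq)
          (SymbolBound.smul (fun p x => (Real.exp_pos _).le) (fun _ _ => zero_le_one)
          (fun p => hcd _) (fun _ => hdq)
          ((symbolBound_exp_neg_mul hq J T).comp_index
            (fun p : TimePair T => (⟨p.1.1, p.2.1⟩ : Set.Icc 0 T)))
          (SymbolBound.of_hasTemperateGrowth hdqb)) _ (K := 1) zero_le_one fun p x => ?_
        rw [mul_one, abs_neg, one_mul]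
        refine mul_le_of_le_one_right (abs_nonneg _) (Real.exp_le_one_iff.2 ?_)
        have := mul_nonneg p.2.1.1 (hq0 x)
        simp only [neg_mul]; linarith

/-- The remainder `R = e₁ - e₂ + (t₁ - t₂) q e₂` has gradient `-t₂ R ∇q - (t₁ - t₂)(e₁ - e₂) ∇q`;
the second term is quadratic in `t₁ - t₂` by `symbolBound_exp_sub_exp`. -/
theorem symbolBound_exp_taylor_two (hq : q.HasTemperateGrowth) (hq0 : ∀ x, 0 ≤ q x)
    (J : ℕ) (T : ℝ) :
    SymbolBound J (fun (p : TimePair T) _ => |p.1.1 - p.1.2| ^ 2)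
      (fun p x => Real.exp (-p.1.1 * q x) - Real.exp (-p.1.2 * q x)
        + (p.1.1 - p.1.2) * (q x * Real.exp (-p.1.2 * q x))) := by
  obtain ⟨k, C, hC, hqb⟩ := hq.norm_iteratedFDeriv_le_uniform 0
  have h0 : SymbolBound 0 (fun (p : TimePair T) _ => |p.1.1 - p.1.2| ^ 2)
      (fun p x => Real.exp (-p.1.1 * q x) - Real.exp (-p.1.2 * q x)
        + (p.1.1 - p.1.2) * (q x * Real.exp (-p.1.2 * q x))) := by
    refine SymbolBound.zero (C := C ^ 2) (m := k * 2) (by positivity) fun p x => ?_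
    have h1 := hqb 0 le_rfl x
    rw [norm_iteratedFDeriv_zero, Real.norm_eq_abs, abs_of_nonneg (hq0 x)] at h1
    have := abs_exp_neg_taylor_two_le (mul_nonneg p.2.1.1 (hq0 x)) (mul_nonneg p.2.2.1 (hq0 x))
    rw [Real.norm_eq_abs, neg_mul, neg_mul, ← mul_assoc, sub_mul]
    refine this.trans ?_
    rw [← sub_mul, abs_mul, abs_of_nonneg (hq0 x)]
    calc (|p.1.1 - p.1.2| * q x) ^ 2 ≤ (|p.1.1 - p.1.2| * (C * (1 + ‖x‖) ^ k)) ^ 2 := by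
          gcongr
          exact mul_nonneg (abs_nonneg _) (hq0 x)
      _ = _ := by rw [pow_mul]; ring
  have hcd (t : ℝ) := contDiff_exp_neg_mul hq t
  have hdq := (contDiff_infty_iff_fderiv.1 hq.1).2
  have hdqb := HasTemperateGrowth.fderiv_right hq
  have hcB (p : TimePair T) : ContDiff ℝ ∞ fun x =>
      Real.exp (-p.1.1 * q x) - Real.exp (-p.1.2 * q x)
        + (p.1.1 - p.1.2) * (q x * Real.exp (-p.1.2 * q x)) :=
    ((hcd _).sub (hcd _)).add (contDiff_const.mul (hq.1.mul (hcd _)))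
  induction J with
  | zero => exact h0
  | succ J ih =>
    refine SymbolBound.succ h0 (a' := fun p x =>
      (-p.1.2) • ((Real.exp (-p.1.1 * q x) - Real.exp (-p.1.2 * q x)
        + (p.1.1 - p.1.2) * (q x * Real.exp (-p.1.2 * q x))) • fderiv ℝ q x)
      + (-(p.1.1 - p.1.2)) • ((Real.exp (-p.1.1 * q x) - Real.exp (-p.1.2 * q x))
        • fderiv ℝ q x)) (fun p x => ?_) ?_
    · have hq' := ((hq.1.differentiable (by simp)) x).hasFDerivAt
      refine (((hasFDerivAt_exp_neg_mul hq p.1.1 x).sub (hasFDerivAt_exp_neg_mul hq p.1.2 x)).add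
        ((hq'.mul (hasFDerivAt_exp_neg_mul hq p.1.2 x)).const_mul
        (p.1.1 - p.1.2))).congr_fderiv ?_
      generalize Real.exp (-p.1.1 * q x) = e₁
      generalize Real.exp (-p.1.2 * q x) = e₂
      module
    · refine SymbolBound.add (fun _ _ => by positivity)
        (fun p => ((hcB p).smul hdq).const_smul _)
        (fun p => (((hcd _).sub (hcd _)).smul hdq).const_smul _) ?_ ?_
      · refine SymbolBound.const_smul (fun p => (hcB p).smul hdq)
          (SymbolBound.smul (fun _ _ => by positivity) (fun _ _ => zero_le_one)
          hcB (fun _ => hdq) ih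
          (SymbolBound.of_hasTemperateGrowth hdqb)) _ (K := |T|) (abs_nonneg _) fun p x => ?_
        rw [mul_one, abs_neg]
        exact mul_le_mul_of_nonneg_right (abs_le_abs_of_nonneg p.2.2.1 p.2.2.2) (by positivity)
      · refine SymbolBound.const_smul (fun p => ((hcd _).sub (hcd _)).smul hdq)
          (SymbolBound.smul (fun p x => abs_nonneg _) (fun _ _ => zero_le_one)
          (fun p => (hcd _).sub (hcd _)) (fun _ => hdq)
          (symbolBound_exp_sub_exp hq hq0 J T)
          (SymbolBound.of_hasTemperateGrowth hdqb)) _ (K := 1) zero_le_one fun p x => ?_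
        rw [mul_one, abs_neg, one_mul, sq]

end SymbolEstimates

/-! ### Differentiating `t ↦ L(e^{-tq} η)` for a continuous functional `L` on Schwartz space. -/

section SchwartzMultipliers

open scoped ContDiff

variable {ι E : Type*} [NormedAddCommGroup E] [NormedSpace ℝ E]

/-- `L` is dominated by finitely many Schwartz seminorms, and the Leibniz rule bounds each of them
on `a i • η` by `w i` times a higher seminorm of `η`. Smallness of symbols thus becomes smallness of
the pairing. -/
theorem norm_apply_smulLeftCLM_le {a : ι → E → ℝ} {w : ι → ℝ} (hw : ∀ i, 0 ≤ w i)
    (ha : ∀ i, ContDiff ℝ ∞ (a i)) (h : ∀ J, SymbolBound J (fun i _ => w i) a)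
    (L : 𝓢(E, ℂ) →L[ℂ] ℂ) (η : 𝓢(E, ℂ)) :
    ∃ C : ℝ, 0 ≤ C ∧
      ∀ i, ‖L (SchwartzMap.smulLeftCLM ℂ (fun x => ((a i x : ℝ) : ℂ)) η)‖ ≤ C * w i := by
  have key (k l : ℕ) : ∃ C : ℝ, 0 ≤ C ∧ ∀ i, SchwartzMap.seminorm ℂ k l
      (SchwartzMap.smulLeftCLM ℂ (fun x => ((a i x : ℝ) : ℂ)) η) ≤ C * w i := by
    choose! C m hC hb using h l
    refine ⟨∑ j ∈ Finset.range (l + 1), (l.choose j : ℝ) * C j *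
      (2 ^ (k + m j) * (Finset.Iic (k + m j, l)).sup
        (fun m => SchwartzMap.seminorm ℝ m.1 m.2) η), ?_, fun i => ?_⟩
    · refine Finset.sum_nonneg fun j hj => ?_
      have := hC j (by have := Finset.mem_range.1 hj; omega)
      positivity
    have htg : (fun x => ((a i x : ℝ) : ℂ)).HasTemperateGrowth := by
      have := SymbolBound.hasTemperateGrowth i (K := w i) (r := 0) (by simp) (ha i) h
      fun_prop
    refine SchwartzMap.seminorm_le_bound ℂ k l _ ?_ fun x => ?_
    · refine mul_nonneg (Finset.sum_nonneg fun j hj => ?_) (hw i)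
      have := hC j (by have := Finset.mem_range.1 hj; omega)
      positivity
    have e : (SchwartzMap.smulLeftCLM ℂ (fun x => ((a i x : ℝ) : ℂ)) η : E → ℂ)
        = fun x => a i x • η x := by
      ext x; rw [SchwartzMap.smulLeftCLM_apply_apply htg]; simp
    rw [e]
    have h2 := norm_iteratedFDeriv_smul_le (ha i) (η.smooth ⊤) x (n := l) (mod_cast le_top)
    calc ‖x‖ ^ k * ‖iteratedFDeriv ℝ l (fun x => a i x • η x) x‖
        ≤ ‖x‖ ^ k * ∑ j ∈ Finset.range (l + 1), (l.choose j : ℝ) * ‖iteratedFDeriv ℝ j (a i) x‖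
          * ‖iteratedFDeriv ℝ (l - j) η x‖ := by gcongr
      _ ≤ _ := by
        rw [Finset.mul_sum, Finset.sum_mul]
        refine Finset.sum_le_sum fun j hj => ?_
        have hj' := Finset.mem_range.1 hj
        have hc := hC j (by omega)
        have h3 := SchwartzMap.one_add_le_sup_seminorm_apply (𝕜 := ℝ) (m := (k + m j, l))
          (k := k + m j) (n := l - j) le_rfl (Nat.sub_le _ _) η x
        have h4 := hb j (by omega) i x
        have hwi := hw i
        have h5 : ‖x‖ ≤ 1 + ‖x‖ := by linarith
        calc _ ≤ (1 + ‖x‖) ^ k * ((l.choose j : ℝ) * (C j * (1 + ‖x‖) ^ m j * w i)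
              * ‖iteratedFDeriv ℝ (l - j) η x‖) := by gcongr
          _ = (l.choose j : ℝ) * C j * w i * ((1 + ‖x‖) ^ (k + m j)
              * ‖iteratedFDeriv ℝ (l - j) η x‖) := by rw [pow_add]; ring
          _ ≤ (l.choose j : ℝ) * C j * w i * (2 ^ (k + m j) * (Finset.Iic (k + m j, l)).sup
              (fun m => SchwartzMap.seminorm ℝ m.1 m.2) η) :=
            mul_le_mul_of_nonneg_left h3 (by positivity)
          _ = _ := by ring
  obtain ⟨s, C, hC, hL⟩ := Seminorm.bound_of_continuous (schwartz_withSeminorms ℂ E ℂ)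
    ((normSeminorm ℂ ℂ).comp L.toLinearMap) (by
      show Continuous fun x => ‖L x‖
      fun_prop)
  choose K hK hb using key
  refine ⟨C * ∑ p ∈ s, K p.1 p.2, mul_nonneg C.2 (Finset.sum_nonneg fun p _ => hK _ _),
    fun i => ?_⟩
  have h1 := hL (SchwartzMap.smulLeftCLM ℂ (fun x => ((a i x : ℝ) : ℂ)) η)
  have h2 : (s.sup (schwartzSeminormFamily ℂ E ℂ))
      (SchwartzMap.smulLeftCLM ℂ (fun x => ((a i x : ℝ) : ℂ)) η) ≤ ∑ p ∈ s, K p.1 p.2 * w i := by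
    have h3 (p : ℕ × ℕ) : 0 ≤ K p.1 p.2 * w i := mul_nonneg (hK _ _) (hw i)
    refine Seminorm.finset_sup_apply_le (Finset.sum_nonneg fun p _ => h3 p) fun p hp => ?_
    exact (hb p.1 p.2 i).trans
      (Finset.single_le_sum (f := fun p => K p.1 p.2 * w i) (fun p _ => h3 p) hp)
  refine h1.trans ((mul_le_mul_of_nonneg_left h2 C.2).trans (le_of_eq ?_))
  rw [← Finset.sum_mul, mul_assoc]
  rfl

variable {q : E → ℝ}

/-- The difference quotient error is `L` applied to the second-order Taylor remainder, hence `O((s -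
t)²)`. -/
theorem hasDerivAt_apply_exp_neg_mul (hq : q.HasTemperateGrowth) (hq0 : ∀ x, 0 ≤ q x)
    (L : 𝓢(E, ℂ) →L[ℂ] ℂ) (η : 𝓢(E, ℂ)) {t : ℝ} (ht : 0 < t) :
    HasDerivAt (fun t : ℝ => L (SchwartzMap.smulLeftCLM ℂ (fun x => ((Real.exp (-t * q x) : ℝ) : ℂ)) η))
      (-L (SchwartzMap.smulLeftCLM ℂ (fun x => ((Real.exp (-t * q x) : ℝ) : ℂ))
        (SchwartzMap.smulLeftCLM ℂ (fun x => ((q x : ℝ) : ℂ)) η))) t := by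
  have hcd (t : ℝ) := contDiff_exp_neg_mul hq t
  have htg {t : ℝ} (ht : 0 ≤ t) := exp_neg_mul_hasTemperateGrowth hq hq0 ht
  obtain ⟨C, hC, h⟩ := norm_apply_smulLeftCLM_le
    (ι := TimePair (t + 1)) (a := (fun p x => Real.exp (-p.1.1 * q x) - Real.exp (-p.1.2 * q x)
        + (p.1.1 - p.1.2) * (q x * Real.exp (-p.1.2 * q x)))) (fun p => by positivity)
    (fun p => ((hcd _).sub (hcd _)).add (contDiff_const.mul (hq.1.mul (hcd _))))
    (fun J => symbolBound_exp_taylor_two hq hq0 J (t + 1)) L η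
  rw [hasDerivAt_iff_isLittleO]
  refine Asymptotics.IsBigO.trans_isLittleO (g := fun s => (s - t) ^ 2) ?_ ?_
  · refine Asymptotics.IsBigO.of_bound C ?_
    filter_upwards [Ioo_mem_nhds ht (show t < t + 1 by linarith)] with s hs
    have := h ⟨(s, t), ⟨hs.1.le, hs.2.le⟩, ⟨ht.le, by linarith⟩⟩
    simp only at this
    rw [norm_pow, Real.norm_eq_abs]
    refine le_trans (le_of_eq ?_) this
    congr 1
    have hs' := htg hs.1.le
    have ht' := htg ht.le
    rw [← map_sub, ← map_neg, ← LinearMapClass.map_smul_of_tower L, ← map_sub]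
    congr 1
    ext x
    have e0 : (fun x => (((Real.exp (-s * q x) - Real.exp (-t * q x)
        + (s - t) * (q x * Real.exp (-t * q x))) : ℝ) : ℂ)).HasTemperateGrowth := by
      fun_prop
    simp only [_root_.sub_apply, _root_.smul_apply, _root_.neg_apply]
    rw [SchwartzMap.smulLeftCLM_apply_apply e0,
      SchwartzMap.smulLeftCLM_apply_apply (by fun_prop),
      SchwartzMap.smulLeftCLM_apply_apply (by fun_prop),
      SchwartzMap.smulLeftCLM_apply_apply (by fun_prop),
      SchwartzMap.smulLeftCLM_apply_apply (by fun_prop)]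
    simp only [smul_eq_mul, Complex.real_smul]
    push_cast
    ring
  · have := (Asymptotics.isLittleO_pow_sub_sub t one_lt_two).norm_left
    refine Asymptotics.IsLittleO.of_norm_left (this.congr_left fun s => ?_)
    simp

/-- The first-order analogue. It includes the endpoint `t = 0`, where the pairing takes the value `L
η`. -/
theorem continuousOn_apply_exp_neg_mul (hq : q.HasTemperateGrowth) (hq0 : ∀ x, 0 ≤ q x)
    (L : 𝓢(E, ℂ) →L[ℂ] ℂ) (η : 𝓢(E, ℂ)) :
    ContinuousOn (fun t : ℝ => L (SchwartzMap.smulLeftCLM ℂ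
      (fun x => ((Real.exp (-t * q x) : ℝ) : ℂ)) η)) (Set.Ici 0) := by
  intro t (ht : 0 ≤ t)
  have hcd (t : ℝ) := contDiff_exp_neg_mul hq t
  have htg {t : ℝ} (ht : 0 ≤ t) := exp_neg_mul_hasTemperateGrowth hq hq0 ht
  obtain ⟨C, hC, h⟩ := norm_apply_smulLeftCLM_le
    (ι := TimePair (t + 1)) (a := (fun p x => Real.exp (-p.1.1 * q x) - Real.exp (-p.1.2 * q x)))
    (fun p => abs_nonneg _)
    (fun p => ((hcd _).sub (hcd _)))
    (fun J => symbolBound_exp_sub_exp hq hq0 J (t + 1)) L η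
  rw [ContinuousWithinAt, tendsto_iff_norm_sub_tendsto_zero]
  refine squeeze_zero' (g := fun s => C * |s - t|) (Eventually.of_forall fun s => norm_nonneg _)
    ?_ ?_
  · filter_upwards [self_mem_nhdsWithin,
      mem_nhdsWithin_of_mem_nhds (Iio_mem_nhds (show t < t + 1 by linarith))] with s hs hs1
    have hs : 0 ≤ s := hs
    have := h ⟨(s, t), ⟨hs, (Set.mem_Iio.1 hs1).le⟩, ⟨ht, by linarith⟩⟩
    simp only at this
    refine le_trans (le_of_eq ?_) this
    congr 1
    have hs' := htg hs
    have ht' := htg ht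
    rw [← map_sub]
    congr 1
    ext x
    have e0 : (fun x => (((Real.exp (-s * q x) - Real.exp (-t * q x)) : ℝ) : ℂ)).HasTemperateGrowth := by
      fun_prop
    simp only [_root_.sub_apply]
    rw [SchwartzMap.smulLeftCLM_apply_apply e0,
      SchwartzMap.smulLeftCLM_apply_apply (by fun_prop),
      SchwartzMap.smulLeftCLM_apply_apply (by fun_prop)]
    simp only [smul_eq_mul]
    push_cast
    ring
  · have : ContinuousWithinAt (fun s => C * |s - t|) (Set.Ici 0) t := by fun_prop
    simpa [ContinuousWithinAt] using this

end SchwartzMultipliers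

/-! ### Powers of symbols, the symbol of `-Δ` and Gaussian symbols. -/

noncomputable section GaussianSymbols

open scoped ContDiff

set_option linter.unusedSectionVars false

variable {E : Type*} [NormedAddCommGroup E] [InnerProductSpace ℝ E]

/-- A power of a function of temperate growth that is bounded below by `1` is of temperate
growth. -/
theorem Function.HasTemperateGrowth.rpow_const_of_one_le {f : E → ℝ} (hf : f.HasTemperateGrowth)
    (h1 : ∀ x, 1 ≤ f x) (r : ℝ) : (fun x => f x ^ r).HasTemperateGrowth := by
  -- An open set containing the range of `f` and staying away from `0`. For `1/2 < x ≤ 1` negative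
  -- powers cost at most `2^(k + N)`; for `x ≥ 1` they are controlled by `x ^ k`.
  set t := {y : ℝ | 1 / 2 < y}
  have ht : Set.range f ⊆ t := by
    rintro - ⟨y, rfl⟩
    exact lt_of_lt_of_le (by norm_num) (h1 y)
  have hpos {x : ℝ} (hx : x ∈ t) : 0 < x := lt_trans (by norm_num) hx
  have hdiff : ContDiffOn ℝ ∞ (fun x => x ^ r) t :=
    contDiffOn_fun_id.rpow_const_of_ne fun x hx => (hpos hx).ne'
  have hunique : UniqueDiffOn ℝ t := (isOpen_lt' (1 / 2)).uniqueDiffOn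
  refine HasTemperateGrowth.comp' (g := fun x : ℝ => x ^ r) ht hunique hdiff (fun N => ?_) hf
  obtain ⟨k, hk⟩ := exists_nat_ge |r|
  have hkr := (abs_le.1 hk)
  refine ⟨k, ∑ j ∈ Finset.range (N + 1), ‖Polynomial.eval r (descPochhammer ℝ j)‖
    * 2 ^ (k + N), by positivity, fun j hj x hx => ?_⟩
  have hx0 := hpos hx
  have hx2 : 1 / 2 < x := hx
  have hcd : ContDiffAt ℝ j (fun x => x ^ r) x := Real.contDiffAt_rpow_const <| Or.inl hx0.ne'
  rw [norm_iteratedFDerivWithin_eq_norm_iteratedDerivWithin,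
    iteratedDerivWithin_eq_iteratedDeriv hunique hcd hx, iteratedDeriv_eq_iterate,
    Real.iter_deriv_rpow_const, norm_mul, ← Finset.sum_mul]
  have h2 : ‖Polynomial.eval r (descPochhammer ℝ j)‖
      ≤ ∑ j ∈ Finset.range (N + 1), ‖Polynomial.eval r (descPochhammer ℝ j)‖ :=
    Finset.single_le_sum (f := fun j => ‖Polynomial.eval r (descPochhammer ℝ j)‖)
      (fun _ _ => by positivity) (by simp; omega)
  have h3 : ‖x ^ (r - j)‖ ≤ 2 ^ (k + N) * (1 + ‖x‖) ^ k := by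
    rw [Real.norm_of_nonneg (Real.rpow_nonneg hx0.le _), Real.norm_of_nonneg hx0.le]
    have hjN : (j : ℝ) ≤ N := mod_cast hj
    rcases le_total x 1 with hx1 | hx1
    · calc x ^ (r - j) ≤ (1 / 2 : ℝ) ^ (-((k + N : ℕ) : ℝ)) := by
            refine (Real.rpow_le_rpow_of_exponent_ge hx0 hx1
              (show -((k + N : ℕ) : ℝ) ≤ r - j by push_cast; linarith)).trans ?_
            exact Real.rpow_le_rpow_of_nonpos (by norm_num) hx2.le (by simp only [Left.neg_nonpos_iff]; positivity)
        _ = 2 ^ (k + N) := by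
            rw [Real.rpow_neg (by norm_num), Real.rpow_natCast]; simp
        _ ≤ _ := le_mul_of_one_le_right (by positivity) (one_le_pow₀ (by linarith))
    · calc x ^ (r - j) ≤ x ^ (k : ℝ) :=
            Real.rpow_le_rpow_of_exponent_le hx1 (by have : (0:ℝ) ≤ j := by positivity
                                                     linarith)
        _ = x ^ k := Real.rpow_natCast _ _
        _ ≤ (1 + x) ^ k := by gcongr; linarith
        _ ≤ _ := le_mul_of_one_le_left (by positivity) (one_le_pow₀ (by norm_num))
  rw [mul_assoc]
  gcongr

/-- The symbol of `-Δ`. -/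
def laplaceSymbol (ξ : E) : ℝ := (2 * Real.pi * ‖ξ‖) ^ 2

theorem laplaceSymbol_nonneg (ξ : E) : 0 ≤ laplaceSymbol ξ := sq_nonneg _

theorem laplaceSymbol_eq : (laplaceSymbol : E → ℝ) = fun ξ => (2 * Real.pi) ^ 2 * ‖ξ‖ ^ 2 :=
  funext fun _ => mul_pow _ _ _

@[fun_prop]
theorem laplaceSymbol_hasTemperateGrowth : (laplaceSymbol : E → ℝ).HasTemperateGrowth := by
  have h : (fun ξ : E => ‖ξ‖ ^ 2).HasTemperateGrowth := Function.hasTemperateGrowth_norm_sq E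
  rw [laplaceSymbol_eq]
  exact (Function.HasTemperateGrowth.const _).mul h

/-- The symbol of the heat semigroup. -/
def heatSymbol (t : ℝ) (ξ : E) : ℂ := ((Real.exp (-t * laplaceSymbol ξ) : ℝ) : ℂ)

theorem heatSymbol_hasTemperateGrowth {t : ℝ} (ht : 0 ≤ t) :
    (heatSymbol t : E → ℂ).HasTemperateGrowth := by
  have := exp_neg_mul_hasTemperateGrowth (laplaceSymbol_hasTemperateGrowth (E := E))
    laplaceSymbol_nonneg ht
  show (fun ξ : E => ((Real.exp (-t * laplaceSymbol ξ) : ℝ) : ℂ)).HasTemperateGrowth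
  fun_prop

theorem heatSymbol_zero_time : (heatSymbol 0 : E → ℂ) = fun _ => 1 := by
  ext ξ; simp [heatSymbol]

theorem heatSymbol_add (s t : ℝ) (ξ : E) :
    heatSymbol (s + t) ξ = heatSymbol s ξ * heatSymbol t ξ := by
  simp only [heatSymbol]
  rw [← Complex.ofReal_mul, ← Real.exp_add]
  ring_nf

theorem exists_one_add_pow_mul_exp_le {c : ℝ} (hc : 0 < c) (m : ℕ) :
    ∃ C : ℝ, 0 ≤ C ∧ ∀ x : E, (1 + ‖x‖) ^ m * Real.exp (-c * laplaceSymbol x) ≤ C := by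
  -- From `(1 + r)^m ≤ m! e^{1 + r}` and `r - c r² ≤ 1/(4c)`.
  refine ⟨m.factorial * Real.exp (1 + 1 / (4 * c)), by positivity, fun x => ?_⟩
  have h1 := Real.pow_div_factorial_le_exp (1 + ‖x‖) (by positivity) m
  rw [div_le_iff₀ (by positivity)] at h1
  calc (1 + ‖x‖) ^ m * Real.exp (-c * laplaceSymbol x)
      ≤ Real.exp (1 + ‖x‖) * m.factorial * Real.exp (-c * laplaceSymbol x) := by gcongr
    _ = m.factorial * Real.exp (1 + ‖x‖ + -c * laplaceSymbol x) := by
        rw [Real.exp_add (1 + ‖x‖)]; ring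
    _ ≤ _ := by
        gcongr ?_ * Real.exp ?_
        have h2 : ‖x‖ ^ 2 ≤ laplaceSymbol x := by
          rw [laplaceSymbol]
          refine pow_le_pow_left₀ (norm_nonneg _) (le_mul_of_one_le_left (norm_nonneg _) ?_) 2
          linarith [Real.pi_gt_three]
        have h3 : 0 ≤ c * (‖x‖ - 1 / (2 * c)) ^ 2 := by positivity
        have h4 : c * (‖x‖ - 1 / (2 * c)) ^ 2 = c * ‖x‖ ^ 2 - ‖x‖ + 1 / (4 * c) := by
          field_simp; ring
        nlinarith

/-- The Schwartz function `(2π|ξ|)^{2N} e^{-c(2π|ξ|)²}`. -/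
def gaussianSchwartz (N : ℕ) {c : ℝ} (hc : 0 < c) : 𝓢(E, ℂ) where
  toFun ξ := Real.exp (-c * laplaceSymbol ξ) • ((laplaceSymbol ξ : ℝ) : ℂ) ^ N
  smooth' := by
    have h1 := contDiff_exp_neg_mul (laplaceSymbol_hasTemperateGrowth (E := E)) c
    have h2 : (fun ξ : E => ((laplaceSymbol ξ : ℝ) : ℂ) ^ N).HasTemperateGrowth := by fun_prop
    exact h1.smul h2.1
  decay' k l := by
    have hq := laplaceSymbol_hasTemperateGrowth (E := E)
    have h2 : (fun ξ : E => ((laplaceSymbol ξ : ℝ) : ℂ) ^ N).HasTemperateGrowth := by fun_prop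
    obtain ⟨C, m, hC, h⟩ := SymbolBound.smul (fun _ _ => (Real.exp_pos _).le)
      (fun _ _ => zero_le_one) (fun i : Set.Icc 0 c => contDiff_exp_neg_mul hq i) (fun _ => h2.1)
      (symbolBound_exp_neg_mul hq l c) (SymbolBound.of_hasTemperateGrowth h2) l le_rfl
    obtain ⟨C', hC', h'⟩ := exists_one_add_pow_mul_exp_le (E := E) hc (k + m)
    refine ⟨C * C', fun x => ?_⟩
    have h3 := h ⟨c, hc.le, le_rfl⟩ x
    have h4 : ‖x‖ ≤ 1 + ‖x‖ := by linarith
    calc _ ≤ (1 + ‖x‖) ^ k * (C * (1 + ‖x‖) ^ m * (Real.exp (-c * laplaceSymbol x) * 1)) := by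
          gcongr
      _ = C * ((1 + ‖x‖) ^ (k + m) * Real.exp (-c * laplaceSymbol x)) := by rw [pow_add]; ring
      _ ≤ C * C' := by gcongr; exact h' x

theorem gaussianSchwartz_apply (N : ℕ) {c : ℝ} (hc : 0 < c) (ξ : E) :
    gaussianSchwartz N hc ξ = heatSymbol c ξ * ((laplaceSymbol ξ : ℝ) : ℂ) ^ N := by
  show Real.exp (-c * laplaceSymbol ξ) • ((laplaceSymbol ξ : ℝ) : ℂ) ^ N = _
  rw [Complex.real_smul]
  rfl

end GaussianSymbols

/-! ### Multipliers as convolutions, and the heat kernel. -/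

noncomputable section FourierKernels

open scoped RealInnerProductSpace

variable {n : ℕ}

local notation "𝔼" => EuclideanSpace ℝ (Fin n)

/-- Fubini. It converts a multiplier with integrable kernel, applied on the Fourier side of a test
function, into a convolution. -/
theorem fourier_fourierInv_mul {K h : 𝔼 → ℂ} (hK : Integrable K) (hh : Integrable h) (x : 𝔼) :
    𝓕 (fun ξ => 𝓕⁻ K ξ * h ξ) x = ∫ y, K y * 𝓕 h (x - y) := by
  have hint : Integrable (fun p : 𝔼 × 𝔼 =>
      Real.fourierChar (-⟪p.1, x⟫) • (Real.fourierChar ⟪p.2, p.1⟫ • K p.2 * h p.1))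
      (volume.prod volume) := by
    refine (hh.mul_prod hK).norm.mono' ?_ (Eventually.of_forall fun p => ?_)
    · have h1 : AEStronglyMeasurable (fun p : 𝔼 × 𝔼 => h p.1) (volume.prod volume) :=
        hh.1.comp_fst
      have h2 : AEStronglyMeasurable (fun p : 𝔼 × 𝔼 => K p.2) (volume.prod volume) :=
        hK.1.comp_snd
      have c1 : Continuous fun p : 𝔼 × 𝔼 => (Real.fourierChar (-⟪p.1, x⟫) : ℂ) :=
        continuous_subtype_val.comp (Real.continuous_fourierChar.comp (by fun_prop))
      have c2 : Continuous fun p : 𝔼 × 𝔼 => (Real.fourierChar ⟪p.2, p.1⟫ : ℂ) :=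
        continuous_subtype_val.comp (Real.continuous_fourierChar.comp (by fun_prop))
      simp only [Circle.smul_def]
      exact c1.aestronglyMeasurable.smul ((c2.aestronglyMeasurable.smul h2).mul h1)
    · simp [Circle.norm_smul, mul_comm]
  calc 𝓕 (fun ξ => 𝓕⁻ K ξ * h ξ) x
      = ∫ ξ, ∫ y, Real.fourierChar (-⟪ξ, x⟫) • (Real.fourierChar ⟪y, ξ⟫ • K y * h ξ) := by
        rw [Real.fourier_eq]
        refine integral_congr_ae (Eventually.of_forall fun ξ => ?_)
        simp only [Real.fourierInv_eq, Circle.smul_def]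
        rw [integral_smul, integral_mul_const]
    _ = ∫ y, ∫ ξ, Real.fourierChar (-⟪ξ, x⟫) • (Real.fourierChar ⟪y, ξ⟫ • K y * h ξ) :=
        integral_integral_swap hint
    _ = _ := by
        refine integral_congr_ae (Eventually.of_forall fun y => ?_)
        simp only [Real.fourier_eq]
        rw [← integral_const_mul]
        refine integral_congr_ae (Eventually.of_forall fun ξ => ?_)
        simp only [Circle.smul_def, smul_eq_mul]
        have : (Real.fourierChar (-⟪ξ, x - y⟫) : ℂ)
            = Real.fourierChar (-⟪ξ, x⟫) * Real.fourierChar ⟪y, ξ⟫ := by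
          rw [← Circle.coe_mul, ← AddChar.map_add_eq_mul, inner_sub_right, real_inner_comm ξ y]
          ring_nf
        rw [this]
        ring

/-- The kernel `r^{-n} K(·/r)`. Invariance of the `L¹` norm makes multiplier bounds uniform in the
scale. -/
theorem exists_dilation {K : 𝔼 → ℂ} (hK : Integrable K) {r : ℝ} (hr : 0 < r) :
    ∃ K' : 𝔼 → ℂ, Integrable K' ∧ (∀ ξ, 𝓕⁻ K' ξ = 𝓕⁻ K (r • ξ)) ∧
      ∫⁻ y, ‖K' y‖ₑ = ∫⁻ y, ‖K y‖ₑ := by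
  have h1 : Integrable (fun y => K (r⁻¹ • y)) := hK.comp_smul (inv_ne_zero hr.ne')
  refine ⟨fun y => ((r ^ n)⁻¹ : ℝ) • K (r⁻¹ • y), h1.fun_smul _, fun ξ => ?_, ?_⟩
  · rw [Real.fourierInv_eq, Real.fourierInv_eq]
    have := Measure.integral_comp_inv_smul (volume : Measure 𝔼)
      (fun v => Real.fourierChar ⟪v, r • ξ⟫ • K v) r
    rw [finrank_euclideanSpace_fin, abs_of_pos (by positivity)] at this
    rw [← inv_smul_smul₀ (pow_pos hr n).ne' (∫ v, Real.fourierChar ⟪v, r • ξ⟫ • K v), ← this,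
      ← integral_smul]
    refine integral_congr_ae (Eventually.of_forall fun v => ?_)
    simp only [inner_smul_left, inner_smul_right, Circle.smul_def]
    rw [smul_comm]
    congr 4
    simp only [conj_trivial]
    field_simp
  · have h2 := integral_norm_eq_lintegral_enorm hK.1
    have h3 := integral_norm_eq_lintegral_enorm (h1.smul (r ^ n)⁻¹).1
    have h4 := Measure.integral_comp_inv_smul (volume : Measure 𝔼) (fun v => ‖K v‖) r
    rw [finrank_euclideanSpace_fin, abs_of_pos (by positivity)] at h4
    refine (ENNReal.toReal_eq_toReal_iff' (h1.smul (r ^ n)⁻¹).2.ne hK.2.ne).1 ?_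
    have h5 : ∫ y, ‖((r ^ n)⁻¹ • fun y => K (r⁻¹ • y)) y‖ = ∫ y, ‖K y‖ := by
      simp only [Pi.smul_apply, norm_smul]
      rw [integral_const_mul, h4, Real.norm_of_nonneg (by positivity), smul_eq_mul,
        inv_mul_cancel_left₀ (pow_pos hr n).ne']
    exact h3.symm.trans (h5.trans h2)

/-- The Gauss–Weierstrass kernel. -/
def heatKernel (t : ℝ) (x : 𝔼) : ℝ :=
  (4 * Real.pi * t) ^ (-(n : ℝ) / 2) * Real.exp (-(4 * t)⁻¹ * ‖x‖ ^ 2)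

theorem heatKernel_nonneg {t : ℝ} (ht : 0 ≤ t) (x : 𝔼) : 0 ≤ heatKernel t x := by
  unfold heatKernel; positivity

theorem measurable_heatKernel : Measurable (fun p : ℝ × 𝔼 => heatKernel p.1 p.2) := by
  unfold heatKernel
  fun_prop

theorem continuous_heatKernel (t : ℝ) : Continuous (heatKernel t : 𝔼 → ℝ) := by
  unfold heatKernel
  fun_prop

theorem fourier_heatKernel {t : ℝ} (ht : 0 < t) (ξ : 𝔼) :
    𝓕 (fun x => ((heatKernel t x : ℝ) : ℂ)) ξ = heatSymbol t ξ := by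
  have hb : 0 < (((4 * t)⁻¹ : ℝ) : ℂ).re := by rw [Complex.ofReal_re]; positivity
  have := fourier_gaussian_innerProductSpace hb ξ
  have e : (fun x : 𝔼 => ((heatKernel t x : ℝ) : ℂ)) = fun x =>
      (((4 * Real.pi * t) ^ (-(n : ℝ) / 2) : ℝ) : ℂ) •
        Complex.exp (-(((4 * t)⁻¹ : ℝ) : ℂ) * ‖x‖ ^ 2) := by
    ext x
    simp only [heatKernel]
    push_cast
    rfl
  rw [e, Real.fourier_eq]
  simp_rw [smul_comm (Real.fourierChar _)]
  rw [integral_smul, ← Real.fourier_eq, this, finrank_euclideanSpace_fin, smul_eq_mul]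
  have h1 : ((Real.pi : ℂ) / (((4 * t)⁻¹ : ℝ) : ℂ)) ^ ((n : ℂ) / 2)
      = (((4 * Real.pi * t) ^ ((n : ℝ) / 2) : ℝ) : ℂ) := by
    rw [Complex.ofReal_cpow (by positivity)]
    congr 1
    · push_cast
      field_simp
    · push_cast; rfl
  rw [h1, ← mul_assoc, ← Complex.ofReal_mul, ← Real.rpow_add (by positivity)]
  rw [neg_div, neg_add_cancel, Real.rpow_zero, Complex.ofReal_one, one_mul, heatSymbol]
  push_cast
  congr 1
  rw [laplaceSymbol]
  push_cast
  field_simp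
  ring

theorem integral_heatKernel {t : ℝ} (ht : 0 < t) : ∫ x : 𝔼, heatKernel t x = 1 := by
  have := fourier_heatKernel ht (0 : 𝔼)
  rw [Real.fourier_eq] at this
  simp only [inner_zero_right, neg_zero, AddChar.map_zero_eq_one, one_smul] at this
  rw [integral_complex_ofReal] at this
  have h2 : heatSymbol t (0 : 𝔼) = 1 := by simp [heatSymbol, laplaceSymbol]
  rw [h2] at this
  exact_mod_cast this

/-- The Bochner integral of a nonintegrable function is `0`, so the value `1` forces integrability.
-/
theorem integrable_heatKernel {t : ℝ} (ht : 0 < t) : Integrable (heatKernel t : 𝔼 → ℝ) :=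
  Integrable.of_integral_ne_zero (by rw [integral_heatKernel ht]; exact one_ne_zero)

theorem lintegral_heatKernel {t : ℝ} (ht : 0 < t) :
    ∫⁻ x : 𝔼, ENNReal.ofReal (heatKernel t x) = 1 := by
  rw [← ofReal_integral_eq_lintegral_ofReal (integrable_heatKernel ht)
    (Eventually.of_forall (heatKernel_nonneg ht.le)), integral_heatKernel ht, ENNReal.ofReal_one]

theorem heatKernel_neg (t : ℝ) (x : 𝔼) : heatKernel t (-x) = heatKernel t x := by
  simp [heatKernel]

theorem fourierInv_heatKernel {t : ℝ} (ht : 0 < t) (ξ : 𝔼) :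
    𝓕⁻ (fun x => ((heatKernel t x : ℝ) : ℂ)) ξ = heatSymbol t ξ := by
  rw [Real.fourierInv_eq_fourier_comp_neg]
  simp only [heatKernel_neg]
  exact fourier_heatKernel ht ξ

/-- For `s ≤ t` one has `h_t ≥ l h_s` with `l = (s/t)^{n/2}`. Both kernels have mass one, so `h_t -
l h_s ≥ 0` and `(1 - l) h_s` each have mass `1 - l`. -/
theorem integral_abs_heatKernel_sub_le {s t : ℝ} (hs : 0 < s) (hst : s ≤ t) :
    ∫ x : 𝔼, |heatKernel t x - heatKernel s x| ≤ 2 * (1 - (s / t) ^ ((n : ℝ) / 2)) := by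
  have ht : 0 < t := hs.trans_le hst
  set l : ℝ := (s / t) ^ ((n : ℝ) / 2) with hl
  have hl1 : l ≤ 1 := Real.rpow_le_one (by positivity) ((div_le_one ht).2 hst) (by positivity)
  have hl0 : 0 ≤ l := by positivity
  have key (x : 𝔼) : l * heatKernel s x ≤ heatKernel t x := by
    unfold heatKernel
    have e : l * (4 * Real.pi * s) ^ (-(n : ℝ) / 2) = (4 * Real.pi * t) ^ (-(n : ℝ) / 2) := by
      have : 4 * Real.pi * t = (s / t)⁻¹ * (4 * Real.pi * s) := by field_simp
      rw [this, Real.mul_rpow (x := (s / t)⁻¹) (by positivity) (by positivity), hl,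
        Real.inv_rpow (by positivity), neg_div, Real.rpow_neg (by positivity : 0 ≤ s / t), inv_inv]
    rw [← mul_assoc, e]
    gcongr
  have h1 (x : 𝔼) : |heatKernel t x - heatKernel s x|
      ≤ (heatKernel t x - l * heatKernel s x) + (1 - l) * heatKernel s x := by
    have := key x
    have h0 := heatKernel_nonneg hs.le x
    rw [abs_le]
    constructor <;> nlinarith
  have is := integrable_heatKernel (n := n) hs
  have it := integrable_heatKernel (n := n) ht
  have hi : Integrable (fun x : 𝔼 => heatKernel t x - l * heatKernel s x) :=
    it.sub (is.const_mul l)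
  calc _ ≤ ∫ x : 𝔼, ((heatKernel t x - l * heatKernel s x) + (1 - l) * heatKernel s x) :=
        integral_mono (it.sub is).abs (hi.add (is.const_mul _)) h1
    _ = _ := by
        rw [integral_add hi (is.const_mul _),
          integral_sub it (is.const_mul l), integral_const_mul, integral_const_mul,
          integral_heatKernel hs, integral_heatKernel ht]
        ring

/-- The supremum over all translates of `φ` of the integral of `|g φ|`. -/
def transSup (g φ : 𝔼 → ℂ) : ℝ≥0∞ := ⨆ z : 𝔼, ∫⁻ x, ‖g x‖ₑ * ‖φ (x - z)‖ₑ

/-- Tonelli. Since `transSup` already takes the supremum over translates, convolving with `K` costs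
exactly a factor `‖K‖₁`. -/
theorem lintegral_mul_convolution_le {g K φ : 𝔼 → ℂ} (hg : AEStronglyMeasurable g)
    (hK : AEStronglyMeasurable K) (hφ : Continuous φ) (z : 𝔼) :
    ∫⁻ x, ‖g x‖ₑ * ∫⁻ y, ‖K y‖ₑ * ‖φ (x - z - y)‖ₑ ≤ (∫⁻ y, ‖K y‖ₑ) * transSup g φ := by
  have hm : AEMeasurable (fun p : 𝔼 × 𝔼 => ‖g p.1‖ₑ * (‖K p.2‖ₑ * ‖φ (p.1 - z - p.2)‖ₑ))
      (volume.prod volume) := by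
    have hc : Continuous (fun p : 𝔼 × 𝔼 => φ (p.1 - z - p.2)) := by fun_prop
    exact hg.comp_fst.enorm.mul (hK.comp_snd.enorm.mul hc.enorm.measurable.aemeasurable)
  calc _ = ∫⁻ x, ∫⁻ y, ‖g x‖ₑ * (‖K y‖ₑ * ‖φ (x - z - y)‖ₑ) := by
        refine lintegral_congr fun x => ?_
        exact (lintegral_const_mul'' _ (AEMeasurable.mul hK.enorm (by
          have hc : Continuous (fun y : 𝔼 => φ (x - z - y)) := by fun_prop
          exact hc.enorm.measurable.aemeasurable))).symm
    _ = ∫⁻ y, ∫⁻ x, ‖g x‖ₑ * (‖K y‖ₑ * ‖φ (x - z - y)‖ₑ) := lintegral_lintegral_swap hm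
    _ ≤ ∫⁻ y, ‖K y‖ₑ * transSup g φ := by
        refine lintegral_mono fun y => ?_
        have : ∀ x, ‖g x‖ₑ * (‖K y‖ₑ * ‖φ (x - z - y)‖ₑ)
            = ‖K y‖ₑ * (‖g x‖ₑ * ‖φ (x - (z + y))‖ₑ) := fun x => by rw [sub_sub]; ring
        simp_rw [this]
        refine (lintegral_const_mul'' _ (AEMeasurable.mul hg.enorm (by
          have hc : Continuous (fun x : 𝔼 => φ (x - (z + y))) := by fun_prop
          exact hc.enorm.measurable.aemeasurable))).trans_le ?_
        gcongr
        exact le_iSup (fun z => ∫⁻ x, ‖g x‖ₑ * ‖φ (x - z)‖ₑ) (z + y)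
    _ = _ := lintegral_mul_const'' _ hK.enorm

theorem transSup_le_of_enorm_le_convolution {g K φ ψ : 𝔼 → ℂ} (hg : AEStronglyMeasurable g)
    (hK : AEStronglyMeasurable K) (hφ : Continuous φ)
    (h : ∀ x, ‖ψ x‖ₑ ≤ ∫⁻ y, ‖K y‖ₑ * ‖φ (x - y)‖ₑ) :
    transSup g ψ ≤ (∫⁻ y, ‖K y‖ₑ) * transSup g φ := by
  refine iSup_le fun z => le_trans (lintegral_mono fun x => ?_)
    (lintegral_mul_convolution_le hg hK hφ z)
  gcongr
  exact h _

/-- Hölder with the conjugate exponent, the `L^{p'}` norm of `φ` being translation invariant. -/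
theorem transSup_lt_top {g : 𝔼 → ℂ} {p : ℝ≥0∞} (hp : 1 ≤ p) (hg : MemLp g p)
    (φ : 𝓢(𝔼, ℂ)) : transSup g φ < ∞ := by
  have := ENNReal.HolderConjugate.inv_one_sub_inv' hp
  set p' := (1 - p⁻¹)⁻¹ with hp'
  have : p.HolderConjugate p' := this
  refine lt_of_le_of_lt (iSup_le fun z => ?_)
    (ENNReal.mul_lt_top hg.2 (φ.eLpNorm_lt_top p'))
  have h1 : AEStronglyMeasurable (fun x => φ (x - z)) :=
    (φ.continuous.comp (continuous_id.sub continuous_const)).aestronglyMeasurable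
  have h2 := eLpNorm_smul_le_mul_eLpNorm (p := p) (q := p') (r := 1) h1 hg.1
  have h3 : eLpNorm (fun x => φ (x - z)) p' = eLpNorm φ p' :=
    eLpNorm_comp_measurePreserving φ.continuous.aestronglyMeasurable
      (measurePreserving_sub_right volume z)
  rw [h3] at h2
  refine le_trans (le_of_eq ?_) h2
  rw [eLpNorm_one_eq_lintegral_enorm]
  refine lintegral_congr fun x => ?_
  simp [enorm_mul]

end FourierKernels

/-! ### A kernel with Laplace transform `(1 - e^{-u})^M u^{-a}`. -/

noncomputable section TruncatedPowers

/-- The `M`-th backward difference, with step `1`, of the truncated power `s ↦ s₊ ^ b`. -/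
def truncPowDiff (b : ℝ) : ℕ → ℝ → ℝ
  | 0, s => if 0 < s then s ^ b else 0
  | M + 1, s => truncPowDiff b M s - truncPowDiff b M (s - 1)

theorem measurable_truncPowDiff (b : ℝ) (M : ℕ) : Measurable (truncPowDiff b M) := by
  induction M with
  | zero => exact Measurable.ite measurableSet_Ioi (by fun_prop) measurable_const
  | succ M ih => exact ih.sub (ih.comp (measurable_id.sub_const 1))

theorem truncPowDiff_of_nonpos (b : ℝ) (M : ℕ) {s : ℝ} (hs : s ≤ 0) : truncPowDiff b M s = 0 := by
  induction M generalizing s with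
  | zero => simp [truncPowDiff, hs]
  | succ M ih => simp [truncPowDiff, ih hs, ih (show s - 1 ≤ 0 by linarith)]

theorem hasDerivAt_truncPowDiff (b : ℝ) (M : ℕ) {s : ℝ} (hs : M < s) :
    HasDerivAt (truncPowDiff b M) (b * truncPowDiff (b - 1) M s) s := by
  induction M generalizing s with
  | zero =>
    have h0 : 0 < s := by simpa using hs
    have := Real.hasDerivAt_rpow_const (p := b) (Or.inl h0.ne')
    simp only [truncPowDiff, h0, if_true]
    refine this.congr_of_eventuallyEq ?_
    filter_upwards [Ioi_mem_nhds h0] with x hx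
    exact if_pos hx
  | succ M ih =>
    push_cast at hs
    have h1 := ih (s := s) (by linarith)
    have h2 := (ih (s := s - 1) (by linarith)).comp s ((hasDerivAt_id s).sub_const 1)
    have := h1.sub h2
    simp only [truncPowDiff, mul_sub]
    simpa using! this

/-- Each difference is a derivative by the mean value inequality on `[s - 1, s]`, and so lowers the
exponent by one. For `s > M` all shifted arguments are positive and the truncation plays no role; `b
≤ M` makes the bounding power largest at the left end. -/
theorem exists_abs_truncPowDiff_le (M : ℕ) (b : ℝ) (hb : b ≤ M) :
    ∃ C : ℝ, 0 ≤ C ∧ ∀ s : ℝ, M < s → |truncPowDiff b M s| ≤ C * (s - M) ^ (b - M) := by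
  induction M generalizing b with
  | zero =>
    refine ⟨1, zero_le_one, fun s hs => ?_⟩
    have h0 : 0 < s := by simpa using hs
    simp [truncPowDiff, h0, abs_of_nonneg (Real.rpow_nonneg h0.le b)]
  | succ M ih =>
    push_cast at hb
    obtain ⟨C, hC, h⟩ := ih (b - 1) (by linarith)
    refine ⟨|b| * C, by positivity, fun s hs => ?_⟩
    push_cast at hs ⊢
    have key := (convex_Icc (s - 1) s).norm_image_sub_le_of_norm_hasDerivWithin_le
      (f := truncPowDiff b M) (f' := fun x => b * truncPowDiff (b - 1) M x)
      (C := |b| * C * (s - (M + 1)) ^ (b - (M + 1))) (x := s - 1) (y := s)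
      (fun x hx => (hasDerivAt_truncPowDiff b M (by linarith [hx.1])).hasDerivWithinAt)
      (fun x hx => by
        rw [Real.norm_eq_abs, abs_mul, mul_assoc]
        gcongr
        refine (h x (by linarith [hx.1])).trans ?_
        have e : b - 1 - (M : ℝ) = b - (M + 1) := by ring
        rw [e]
        gcongr ?_ * ?_
        exact Real.rpow_le_rpow_of_nonpos (by linarith) (by linarith [hx.1]) (by linarith))
      (Set.left_mem_Icc.2 (by linarith)) (Set.right_mem_Icc.2 (by linarith))
    simpa [truncPowDiff] using key

theorem integrableOn_Iic_truncPowDiff {b : ℝ} (hb : -1 < b) (M : ℕ) (R : ℝ) :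
    IntegrableOn (truncPowDiff b M) (Set.Iic R) := by
  induction M generalizing R with
  | zero =>
    have h1 : IntegrableOn (fun s : ℝ => s ^ b) (Set.Ioc 0 (max R 0)) :=
      (intervalIntegrable_iff_integrableOn_Ioc_of_le (le_max_right _ _)).1
        (intervalIntegral.intervalIntegrable_rpow' hb)
    have h2 : IntegrableOn (truncPowDiff b 0) (Set.Ioc 0 (max R 0)) :=
      h1.congr_fun (fun s hs => by simp [truncPowDiff, hs.1]) measurableSet_Ioc
    have h3 : IntegrableOn (truncPowDiff b 0) (Set.Iic 0) :=
      IntegrableOn.congr_fun (f := fun _ => (0 : ℝ)) integrableOn_zero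
        (fun s hs => (truncPowDiff_of_nonpos b 0 hs).symm) measurableSet_Iic
    refine (h3.union h2).mono_set fun s hs => ?_
    rcases le_or_gt s 0 with h | h
    · exact Or.inl h
    · exact Or.inr ⟨h, le_max_of_le_left hs⟩
  | succ M ih =>
    refine (ih R).sub ?_
    have h1 := (ih (R - 1)).integrable_indicator measurableSet_Iic
    have h2 := h1.comp_sub_right 1
    refine IntegrableOn.congr_fun (h2.integrableOn (s := Set.Iic R)) (fun s hs => ?_)
      measurableSet_Iic
    have hs : s ≤ R := hs
    exact Set.indicator_of_mem (show s - 1 ∈ Set.Iic (R - 1) by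
      rw [Set.mem_Iic]; linarith) (truncPowDiff b M)

/-- The singularities are integrable as `b > -1`; the tail is `O((s - M)^{b - M})` with `b - M <
-1`. -/
theorem integrable_truncPowDiff {b : ℝ} (hb : -1 < b) {M : ℕ} (hM : b + 1 < M) :
    Integrable (truncPowDiff b M) := by
  rw [← integrableOn_univ, ← Set.Iic_union_Ioi (a := (M : ℝ) + 1)]
  refine (integrableOn_Iic_truncPowDiff hb M _).union ?_
  obtain ⟨C, hC, h⟩ := exists_abs_truncPowDiff_le M b (by linarith)
  have h1 : IntegrableOn (fun s : ℝ => s ^ (b - M)) (Set.Ioi 1) :=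
    integrableOn_Ioi_rpow_of_lt (by linarith) one_pos
  have h2 := ((h1.integrable_indicator measurableSet_Ioi).comp_sub_right (M : ℝ)).const_mul C
  refine Integrable.mono' (h2.integrableOn (s := Set.Ioi ((M : ℝ) + 1)))
    (measurable_truncPowDiff b M).aestronglyMeasurable ?_
  filter_upwards [ae_restrict_mem measurableSet_Ioi] with s hs
  have hs : (M : ℝ) + 1 < s := hs
  rw [Real.norm_eq_abs, Set.indicator_of_mem (show s - M ∈ Set.Ioi (1 : ℝ) by
    rw [Set.mem_Ioi]; linarith)]
  exact h s (by linarith)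

/-- The undifferenced case is the Gamma integral. Translation by `1` multiplies a Laplace transform
by `e^{-u}`, so each difference contributes a factor `1 - e^{-u}`. -/
theorem laplace_truncPowDiff {b : ℝ} (hb : -1 < b) (M : ℕ) {u : ℝ} (hu : 0 < u) :
    Integrable (fun s => truncPowDiff b M s * Real.exp (-(u * s))) ∧
      ∫ s, truncPowDiff b M s * Real.exp (-(u * s))
        = (1 - Real.exp (-u)) ^ M * ((1 / u) ^ (b + 1) * Real.Gamma (b + 1)) := by
  induction M with
  | zero =>
    have h1 := Real.integral_rpow_mul_exp_neg_mul_Ioi (a := b + 1) (by linarith) hu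
    have h2 : (0 : ℝ) < (1 / u) ^ (b + 1) * Real.Gamma (b + 1) :=
      mul_pos (by positivity) (Real.Gamma_pos_of_pos (by linarith))
    have h3 : IntegrableOn (fun t : ℝ => t ^ (b + 1 - 1) * Real.exp (-(u * t))) (Set.Ioi 0) :=
      Integrable.of_integral_ne_zero (by rw [h1]; exact h2.ne')
    have e : (fun s => truncPowDiff b 0 s * Real.exp (-(u * s)))
        = (Set.Ioi 0).indicator fun t : ℝ => t ^ (b + 1 - 1) * Real.exp (-(u * t)) := by
      ext s
      by_cases hs : 0 < s <;> simp [truncPowDiff, hs]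
    rw [e, integrable_indicator_iff measurableSet_Ioi, integral_indicator measurableSet_Ioi, h1,
      pow_zero, one_mul]
    exact ⟨h3, rfl⟩
  | succ M ih =>
    have h1 := (ih.1.comp_sub_right 1).const_mul (Real.exp (-u))
    have e : (fun s => truncPowDiff b (M + 1) s * Real.exp (-(u * s))) = fun s =>
        truncPowDiff b M s * Real.exp (-(u * s))
        - Real.exp (-u) * (truncPowDiff b M (s - 1) * Real.exp (-(u * (s - 1)))) := by
      ext s
      have : Real.exp (-(u * s)) = Real.exp (-u) * Real.exp (-(u * (s - 1))) := by
        rw [← Real.exp_add]; ring_nf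
      rw [truncPowDiff, sub_mul, this]
      ring
    rw [e]
    refine ⟨ih.1.sub h1, ?_⟩
    rw [integral_sub ih.1 h1, integral_const_mul,
      integral_sub_right_eq_self (fun s => truncPowDiff b M s * Real.exp (-(u * s))) 1, ih.2]
    ring

/-- For large `M` the function `u ↦ (1 - e⁻ᵘ) ^ M u⁻ᵃ` is the Laplace transform of an integrable
function with vanishing integral. -/
theorem exists_laplace_eq {a : ℝ} (ha : 0 < a) {M : ℕ} (hM : a < M) :
    ∃ k : ℝ → ℝ, IntegrableOn k (Set.Ioi 0) ∧
      (∀ u, 0 < u → ∫ s in Set.Ioi 0, k s * Real.exp (-(u * s))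
        = (1 - Real.exp (-u)) ^ M * u ^ (-a)) ∧ ∫ s in Set.Ioi 0, k s = 0 := by
  have hb : -1 < a - 1 := by linarith
  have hi := integrable_truncPowDiff hb (M := M) (by linarith)
  have hG := Real.Gamma_pos_of_pos ha
  set k : ℝ → ℝ := fun s => (Real.Gamma a)⁻¹ * truncPowDiff (a - 1) M s with hk
  have hki : IntegrableOn k (Set.Ioi 0) := (hi.const_mul _).integrableOn
  have hlap (u : ℝ) (hu : 0 < u) : ∫ s in Set.Ioi 0, k s * Real.exp (-(u * s))
        = (1 - Real.exp (-u)) ^ M * u ^ (-a) := by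
    rw [setIntegral_eq_integral_of_forall_compl_eq_zero (fun s hs => by
      simp [hk, truncPowDiff_of_nonpos (a - 1) M (not_lt.1 hs)])]
    simp only [hk, mul_assoc]
    rw [integral_const_mul, (laplace_truncPowDiff hb M hu).2, sub_add_cancel, one_div,
      Real.inv_rpow hu.le, Real.rpow_neg hu.le]
    field_simp
  refine ⟨k, hki, hlap, ?_⟩
  -- Let `u = 1/(j+1) → 0` in the Laplace identity: by dominated convergence the left side tends to
  -- `∫ k`, while the right side is at most `u^{M - a} → 0`.
  have hu (j : ℕ) : (0 : ℝ) < 1 / ((j : ℝ) + 1) := by positivity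
  have t1 : Tendsto (fun j : ℕ => ∫ s in Set.Ioi 0, k s * Real.exp (-(1 / ((j : ℝ) + 1) * s)))
      atTop (𝓝 (∫ s in Set.Ioi 0, k s)) := by
    refine tendsto_integral_of_dominated_convergence (fun s => ‖k s‖) (fun j => ?_) hki.norm
      (fun j => ?_) (Eventually.of_forall fun s => ?_)
    · exact hki.1.mul (Continuous.aestronglyMeasurable (by fun_prop))
    · filter_upwards [ae_restrict_mem measurableSet_Ioi] with s hs
      rw [norm_mul, Real.norm_of_nonneg (Real.exp_pos _).le]
      refine mul_le_of_le_one_right (norm_nonneg _) (Real.exp_le_one_iff.2 ?_)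
      have := mul_pos (hu j) (Set.mem_Ioi.1 hs)
      linarith
    · have := ((tendsto_one_div_add_atTop_nhds_zero_nat (𝕜 := ℝ)).mul_const s).neg.rexp.const_mul
        (k s)
      simpa using this
  have t2 : Tendsto (fun j : ℕ => ∫ s in Set.Ioi 0, k s * Real.exp (-(1 / ((j : ℝ) + 1) * s)))
      atTop (𝓝 0) := by
    have t3 : Tendsto (fun j : ℕ => (1 / ((j : ℝ) + 1)) ^ ((M : ℝ) - a)) atTop (𝓝 0) := by
      have := (tendsto_one_div_add_atTop_nhds_zero_nat (𝕜 := ℝ)).rpow_const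
        (p := (M : ℝ) - a) (Or.inr (by linarith))
      rwa [Real.zero_rpow (by linarith)] at this
    refine squeeze_zero (fun j => ?_) (fun j => ?_) t3
    · rw [hlap _ (hu j)]
      have : Real.exp (-(1 / ((j : ℝ) + 1))) ≤ 1 := Real.exp_le_one_iff.2 (by linarith [hu j])
      have h1 : 0 ≤ 1 - Real.exp (-(1 / ((j : ℝ) + 1))) := by linarith
      have := hu j
      positivity
    · rw [hlap _ (hu j), sub_eq_add_neg (M : ℝ), Real.rpow_add (hu j), Real.rpow_natCast]
      have : Real.exp (-(1 / ((j : ℝ) + 1))) ≤ 1 := Real.exp_le_one_iff.2 (by linarith [hu j])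
      have h2 := Real.one_sub_le_exp_neg (1 / ((j : ℝ) + 1))
      have := hu j
      gcongr
      linarith
  exact tendsto_nhds_unique t1 t2

end TruncatedPowers

/-! ### The Hardy–Littlewood maximal function. -/

noncomputable section HardyLittlewood

variable {n : ℕ}

local notation "𝔼" => EuclideanSpace ℝ (Fin n)

theorem setLIntegral_ball_le (g : 𝔼 → ℂ) (x : 𝔼) {r : ℝ} (hr : 0 < r) :
    ∫⁻ y in Metric.ball x r, ‖g y‖ₑ ≤ maximalFunction g x * volume (Metric.ball x r) := by
  have h0 : volume (Metric.ball x r) ≠ 0 := (Metric.measure_ball_pos _ _ hr).ne'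
  have h1 : volume (Metric.ball x r) ≠ ∞ := measure_ball_lt_top.ne
  calc ∫⁻ y in Metric.ball x r, ‖g y‖ₑ
      = ((volume (Metric.ball x r))⁻¹ * ∫⁻ y in Metric.ball x r, ‖g y‖ₑ)
        * volume (Metric.ball x r) := by
        rw [mul_comm _ (∫⁻ y in Metric.ball x r, ‖g y‖ₑ), mul_assoc,
          ENNReal.inv_mul_cancel h0 h1, mul_one]
    _ ≤ _ := by
        gcongr
        exact le_iSup₂ (f := fun (r : ℝ) (_ : 0 < r) =>
          (volume (Metric.ball x r))⁻¹ * ∫⁻ y in Metric.ball x r, ‖g y‖ₑ) r hr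

/-- The kernel is radially decreasing, so the layer-cake formula only meets balls centred at `x`. -/
theorem superlevel_heatKernel {t : ℝ} (ht : 0 < t) (x : 𝔼) {c : ℝ} (hc : 0 < c) :
    {y : 𝔼 | c < heatKernel t (x - y)} = ∅ ∨
      ∃ r : ℝ, 0 < r ∧ {y : 𝔼 | c < heatKernel t (x - y)} = Metric.ball x r := by
  set A : ℝ := (4 * Real.pi * t) ^ (-(n : ℝ) / 2) with hA
  have hA0 : 0 < A := by positivity
  have key (y : 𝔼) : c < heatKernel t (x - y) ↔ ‖x - y‖ ^ 2 < -Real.log (c / A) * (4 * t) := by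
    unfold heatKernel
    rw [← hA, ← div_lt_iff₀' hA0, ← Real.log_lt_iff_lt_exp (by positivity), neg_mul, lt_neg,
      inv_mul_eq_div, div_lt_iff₀ (by positivity)]
  rcases le_or_gt (-Real.log (c / A) * (4 * t)) 0 with h | h
  · left
    ext y
    simp only [Set.mem_ofPred_eq, Set.mem_empty_iff_false, iff_false, key, not_lt]
    exact h.trans (sq_nonneg _)
  · right
    refine ⟨Real.sqrt (-Real.log (c / A) * (4 * t)), Real.sqrt_pos.2 h, ?_⟩
    ext y
    rw [Set.mem_ofPred_eq, key, Metric.mem_ball, dist_comm, dist_eq_norm,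
      Real.lt_sqrt (norm_nonneg _)]

/-- Layer cake for the measure `|g| dy`: each superlevel set is a ball, on which `∫ |g|` is at most
`M_g(x)` times its volume. Reassembling the volumes gives the total mass of the heat kernel, which
is `1`. -/
theorem lintegral_heatKernel_mul_le {g : 𝔼 → ℂ} (hg : AEStronglyMeasurable g) {t : ℝ}
    (ht : 0 < t) (x : 𝔼) :
    ∫⁻ y, ‖heatKernel t (x - y)‖ₑ * ‖g y‖ₑ ≤ maximalFunction g x := by
  set ν : Measure 𝔼 := volume.withDensity fun y => ‖g y‖ₑ with hν
  have hc : Continuous fun y : 𝔼 => heatKernel t (x - y) :=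
    (continuous_heatKernel t).comp (by fun_prop)
  have hnn : ∀ y : 𝔼, 0 ≤ heatKernel t (x - y) := fun y => heatKernel_nonneg ht.le _
  have h1 : ∫⁻ y, ‖heatKernel t (x - y)‖ₑ * ‖g y‖ₑ
      = ∫⁻ y, ENNReal.ofReal (heatKernel t (x - y)) ∂ν := by
    rw [hν, lintegral_withDensity_eq_lintegral_mul₀ hg.enorm
      hc.measurable.ennreal_ofReal.aemeasurable]
    refine lintegral_congr fun y => ?_
    rw [Pi.mul_apply, mul_comm, Real.enorm_of_nonneg (hnn y)]
  have h2 : ∫⁻ y, ENNReal.ofReal (heatKernel t (x - y)) = 1 := by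
    rw [lintegral_sub_left_eq_self (fun y => ENNReal.ofReal (heatKernel t y)) x,
      lintegral_heatKernel ht]
  rw [h1, lintegral_eq_lintegral_meas_lt ν (Eventually.of_forall hnn) hc.measurable.aemeasurable]
  calc _ ≤ ∫⁻ c in Set.Ioi 0, maximalFunction g x * volume {y : 𝔼 | c < heatKernel t (x - y)} := by
        refine setLIntegral_mono' measurableSet_Ioi fun c hc => ?_
        rcases superlevel_heatKernel ht x hc with h | ⟨r, hr, h⟩
        · simp [h]
        · rw [h, hν, withDensity_apply _ measurableSet_ball]
          exact setLIntegral_ball_le g x hr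
    _ = maximalFunction g x * ∫⁻ c in Set.Ioi 0, volume {y : 𝔼 | c < heatKernel t (x - y)} := by
        refine lintegral_const_mul _ ?_
        refine Antitone.measurable fun c d hcd => measure_mono fun y hy => ?_
        exact lt_of_le_of_lt hcd hy
    _ = _ := by
        rw [← lintegral_eq_lintegral_meas_lt volume (Eventually.of_forall hnn)
          hc.measurable.aemeasurable, h2, mul_one]

/-- Used for measurability. The ball `B(x, r)` is exhausted by the balls of radius `r - 1/(k+1)`,
and each of these lies in `B(y, r)` for `y` close to `x`. -/
theorem lowerSemicontinuous_maximalFunction (g : 𝔼 → ℂ) :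
    LowerSemicontinuous (maximalFunction g) := by
  refine lowerSemicontinuous_iSup fun r => lowerSemicontinuous_iSup fun hr => ?_
  simp_rw [fun x : 𝔼 => Measure.addHaar_ball_center (volume : Measure 𝔼) x r]
  intro x c hc
  obtain ⟨u, hu⟩ : ∃ u : ℕ → ℝ, u = fun k : ℕ => r - 1 / ((k : ℝ) + 1) := ⟨_, rfl⟩
  have hmono : Monotone fun k => Metric.ball x (u k) := fun i j hij => by
    refine Metric.ball_subset_ball ?_
    have : (i : ℝ) ≤ j := mod_cast hij
    rw [hu]
    simp only
    gcongr
  have hU : ⋃ k, Metric.ball x (u k) = Metric.ball x r := by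
    refine Set.Subset.antisymm (Set.iUnion_subset fun k => Metric.ball_subset_ball ?_) fun y hy => ?_
    · rw [hu]; simp only; have : (0 : ℝ) ≤ 1 / ((k : ℝ) + 1) := by positivity
      linarith
    · obtain ⟨k, hk⟩ := exists_nat_one_div_lt (sub_pos.2 (Metric.mem_ball.1 hy))
      refine Set.mem_iUnion.2 ⟨k, Metric.mem_ball.2 ?_⟩
      rw [hu]; simp only; linarith
  have h1 : ∫⁻ y in Metric.ball x r, ‖g y‖ₑ = ⨆ k, ∫⁻ y in Metric.ball x (u k), ‖g y‖ₑ := by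
    rw [← hU]
    exact setLIntegral_iUnion_of_directed _ (hmono.directed_le)
  have hc : c < (volume (Metric.ball (0 : 𝔼) r))⁻¹ * ∫⁻ y in Metric.ball x r, ‖g y‖ₑ := hc
  rw [h1, ENNReal.mul_iSup] at hc
  obtain ⟨k, hk⟩ := lt_iSup_iff.1 hc
  filter_upwards [Metric.ball_mem_nhds x (show (0 : ℝ) < 1 / ((k : ℝ) + 1) by positivity)] with y hy
  refine hk.trans_le ?_
  gcongr
  refine Metric.ball_subset_ball' ?_
  rw [Metric.mem_ball, dist_comm] at hy
  rw [hu]; simp only; linarith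

/-- The weak type `(1, 1)` inequality for the Hardy–Littlewood maximal function. -/
theorem mul_measure_exists_ball_le (φ : 𝔼 → ℝ≥0∞) (c : ℝ≥0∞) :
    c * volume {x : 𝔼 | ∃ r : ℝ, 0 < r ∧
      c * volume (Metric.ball x r) < ∫⁻ y in Metric.ball x r, φ y} ≤ 5 ^ n * ∫⁻ y, φ y := by
  -- The Vitali covering lemma needs bounded radii; the bound `k` is removed by continuity of the
  -- measure along increasing unions.
  set S : ℕ → Set 𝔼 := fun k => {x : 𝔼 | ∃ r : ℝ, 0 < r ∧ r ≤ k ∧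
      c * volume (Metric.ball x r) < ∫⁻ y in Metric.ball x r, φ y} with hS
  have hmono : Monotone S := fun i j hij x ⟨r, h0, h1, h2⟩ =>
    ⟨r, h0, h1.trans (mod_cast hij), h2⟩
  have hU : {x : 𝔼 | ∃ r : ℝ, 0 < r ∧
      c * volume (Metric.ball x r) < ∫⁻ y in Metric.ball x r, φ y} = ⋃ k, S k := by
    ext x
    simp only [hS, Set.mem_ofPred_eq, Set.mem_iUnion]
    constructor
    · rintro ⟨r, h0, h2⟩
      obtain ⟨k, hk⟩ := exists_nat_ge r
      exact ⟨k, r, h0, hk, h2⟩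
    · rintro ⟨k, r, h0, _, h2⟩
      exact ⟨r, h0, h2⟩
  rw [hU, hmono.measure_iUnion, ENNReal.mul_iSup]
  refine iSup_le fun k => ?_
  choose! ρ hρ0 hρk hρ using fun (x : 𝔼) (hx : x ∈ S k) => hx
  obtain ⟨u, huS, hdisj, hcov⟩ := Vitali.exists_disjoint_subfamily_covering_enlargement_closedBall
    (S k) (fun x => x) ρ k hρk 5 (by norm_num)
  have hcount : u.Countable := by
    refine hdisj.countable_of_nonempty_interior fun x hx => ?_
    exact ⟨x, Metric.ball_subset_interior_closedBall (Metric.mem_ball_self (hρ0 x (huS hx)))⟩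
  have hsub : S k ⊆ ⋃ b ∈ u, Metric.closedBall b (5 * ρ b) := fun x hx => by
    obtain ⟨b, hb, h⟩ := hcov x hx
    exact Set.mem_biUnion hb (h (Metric.mem_closedBall_self (hρ0 x hx).le))
  have := hcount.to_subtype
  calc c * volume (S k) ≤ c * ∑' b : u, volume (Metric.closedBall (b : 𝔼) (5 * ρ b)) := by
        gcongr
        exact (measure_mono hsub).trans (measure_biUnion_le _ hcount _)
    _ = ∑' b : u, 5 ^ n * (c * volume (Metric.ball (b : 𝔼) (ρ b))) := by
        rw [← ENNReal.tsum_mul_left]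
        refine tsum_congr fun b => ?_
        have hb := hρ0 b (huS b.2)
        rw [Measure.addHaar_closedBall _ _ (by positivity), Measure.addHaar_ball_of_pos _ _ hb,
          finrank_euclideanSpace_fin, mul_pow, ENNReal.ofReal_mul (by positivity),
          ENNReal.ofReal_pow (by norm_num : (0 : ℝ) ≤ 5)]
        simp only [ENNReal.ofReal_ofNat]
        ring
    _ ≤ ∑' b : u, 5 ^ n * ∫⁻ y in Metric.closedBall (b : 𝔼) (ρ b), φ y := by
        refine ENNReal.tsum_le_tsum fun b => ?_
        gcongr
        exact (hρ b (huS b.2)).le.trans (lintegral_mono_set Metric.ball_subset_closedBall)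
    _ = 5 ^ n * ∫⁻ y in ⋃ b : u, Metric.closedBall (b : 𝔼) (ρ b), φ y := by
        rw [ENNReal.tsum_mul_left, lintegral_iUnion (fun b => Metric.isClosed_closedBall.measurableSet)]
        intro i j hij
        exact hdisj i.2 j.2 (fun h => hij (Subtype.ext h))
    _ ≤ _ := by
        gcongr
        exact Measure.restrict_le_self

/-- Values of `|g|` up to `c` contribute at most `c` to any average. An average above `2c` therefore
forces the part of `g` above height `c` to have average above `c`, and the weak bound applies to
that part alone. -/
theorem mul_measure_lt_maximalFunction_le {g : 𝔼 → ℂ} (hg : AEStronglyMeasurable g) (c : ℝ) :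
    ENNReal.ofReal c * volume {x : 𝔼 | 2 * ENNReal.ofReal c < maximalFunction g x}
      ≤ 5 ^ n * (volume.withDensity fun y => ‖g y‖ₑ) {y | c < ‖g y‖} := by
  have hms : NullMeasurableSet {y | c < ‖g y‖} :=
    nullMeasurableSet_lt aemeasurable_const hg.norm.aemeasurable
  set φ : 𝔼 → ℝ≥0∞ := {y | c < ‖g y‖}.indicator fun y => ‖g y‖ₑ with hφ
  have h1 : (volume.withDensity fun y => ‖g y‖ₑ) {y | c < ‖g y‖} = ∫⁻ y, φ y := by
    rw [withDensity_apply₀ _ hms, hφ, lintegral_indicator₀ hms]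
  rw [h1]
  refine le_trans ?_ (mul_measure_exists_ball_le φ (ENNReal.ofReal c))
  refine mul_le_mul_right (measure_mono fun x hx => ?_) _
  obtain ⟨r, hr⟩ := lt_iSup_iff.1 (show 2 * ENNReal.ofReal c < maximalFunction g x from hx)
  obtain ⟨h0, hr⟩ := lt_iSup_iff.1 hr
  refine ⟨r, h0, ?_⟩
  have v0 : volume (Metric.ball x r) ≠ 0 := (Metric.measure_ball_pos _ _ h0).ne'
  have v1 : volume (Metric.ball x r) ≠ ∞ := measure_ball_lt_top.ne
  have h2 : ∫⁻ y in Metric.ball x r, ‖g y‖ₑ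
      ≤ (∫⁻ y in Metric.ball x r, φ y) + ENNReal.ofReal c * volume (Metric.ball x r) := by
    rw [← setLIntegral_const, ← lintegral_add_right _ measurable_const]
    refine lintegral_mono fun y => ?_
    by_cases hy : c < ‖g y‖
    · simp [hφ, hy]
    · have : ‖g y‖ₑ ≤ ENNReal.ofReal c := by
        rw [← ofReal_norm]
        exact ENNReal.ofReal_le_ofReal (not_lt.1 hy)
      exact this.trans le_add_self
  have h3 : 2 * ENNReal.ofReal c * volume (Metric.ball x r) < ∫⁻ y in Metric.ball x r, ‖g y‖ₑ := by
    rwa [← ENNReal.div_eq_inv_mul, ENNReal.lt_div_iff_mul_lt (Or.inl v0) (Or.inl v1)] at hr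
  have h4 := h3.trans_le h2
  rw [two_mul, add_mul] at h4
  exact lt_of_add_lt_add_right h4

theorem lintegral_enorm_rpow_eq {g : 𝔼 → ℂ} {p : ℝ} (hp : 1 < p)
    (hg : AEStronglyMeasurable g) :
    ∫⁻ y, ENNReal.ofReal (‖g y‖ ^ (p - 1)) ∂(volume.withDensity fun y => ‖g y‖ₑ)
      = ∫⁻ y, ‖g y‖ₑ ^ p := by
  rw [lintegral_withDensity_eq_lintegral_mul₀ hg.enorm
    ((hg.norm.aemeasurable.pow_const _).ennreal_ofReal)]
  refine lintegral_congr fun y => ?_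
  rw [Pi.mul_apply, ← ENNReal.ofReal_rpow_of_nonneg (norm_nonneg _) (by linarith),
    ofReal_norm]
  conv_lhs => rw [← ENNReal.rpow_one ‖g y‖ₑ, ← ENNReal.rpow_mul]
  rw [one_mul, ← ENNReal.rpow_add_of_nonneg _ _ zero_le_one (by linarith)]
  congr 1; ring

/-- The strong type `(p, p)` inequality for the Hardy–Littlewood maximal function. -/
theorem lintegral_maximalFunction_rpow_le {p : ℝ} (hp : 1 < p) :
    ∃ C : ℝ≥0, ∀ g : 𝔼 → ℂ, AEStronglyMeasurable g → ∫⁻ y, ‖g y‖ₑ ^ p < ∞ →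
      ∫⁻ x, maximalFunction g x ^ p ≤ C * ∫⁻ y, ‖g y‖ₑ ^ p := by
  refine ⟨2 ^ p * p.toNNReal * 5 ^ n * ((p - 1).toNNReal)⁻¹, fun g hg hgp => ?_⟩
  have hp0 : 0 < p := by linarith
  have hp1 : 0 < p - 1 := by linarith
  set ν := (volume : Measure 𝔼).withDensity fun y => ‖g y‖ₑ with hν
  have hgν : AEMeasurable (fun y => ‖g y‖) ν :=
    hg.norm.aemeasurable.mono_ac (withDensity_absolutelyContinuous _ _)
  have hlc := lintegral_rpow_eq_lintegral_meas_lt_mul ν (f := fun y => ‖g y‖)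
    (Eventually.of_forall fun y => norm_nonneg _)
    hgν hp1
  rw [lintegral_enorm_rpow_eq hp hg] at hlc
  have hM : Measurable (maximalFunction g) := (lowerSemicontinuous_maximalFunction g).measurable
  have hν1 : ν {y | 1 < ‖g y‖} < ∞ := by
    refine lt_of_le_of_lt ?_ hgp
    rw [← lintegral_enorm_rpow_eq hp hg]
    refine le_trans ?_ (setLIntegral_le_lintegral {y | 1 < ‖g y‖} _)
    refine le_trans (le_of_eq (setLIntegral_one _).symm) (lintegral_mono_ae ?_)
    refine (ae_restrict_iff'₀ (nullMeasurableSet_lt aemeasurable_const hgν)).2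
      (Eventually.of_forall fun y hy => ?_)
    rw [← ENNReal.ofReal_one]
    exact ENNReal.ofReal_le_ofReal (Real.one_le_rpow (le_of_lt hy) hp1.le)
  -- The layer-cake formula is used for real-valued functions. If `M_g = ∞` on a set of measure `V >
  -- 0`, the weak bound at height `j + 1` gives `j V ≤ 5^n ν{|g| > 1}` for every `j`.
  have hfin : ∀ᵐ x, maximalFunction g x < ∞ := by
    by_contra hV
    rw [ae_iff] at hV
    obtain ⟨j, hj⟩ := ENNReal.exists_nat_mul_gt hV
      (b := 5 ^ n * ν {y | 1 < ‖g y‖}) (ENNReal.mul_ne_top (by simp) hν1.ne)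
    have h1 := mul_measure_lt_maximalFunction_le hg ((j : ℝ) + 1)
    refine absurd (hj.trans_le ?_) (lt_irrefl _)
    calc (j : ℝ≥0∞) * volume {x | ¬maximalFunction g x < ∞} ≤ ENNReal.ofReal ((j : ℝ) + 1)
          * volume {x : 𝔼 | 2 * ENNReal.ofReal ((j : ℝ) + 1) < maximalFunction g x} := by
          refine mul_le_mul' ?_ (measure_mono fun x hx => ?_)
          · rw [← ENNReal.ofReal_natCast]
            exact ENNReal.ofReal_le_ofReal (by linarith)
          · rw [Set.mem_ofPred_eq, not_lt, top_le_iff] at hx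
            rw [Set.mem_ofPred_eq, hx]
            exact ENNReal.mul_lt_top (by simp) ENNReal.ofReal_lt_top
      _ ≤ 5 ^ n * ν {y | (j : ℝ) + 1 < ‖g y‖} := h1
      _ ≤ _ := by
          refine mul_le_mul_right (measure_mono fun y (hy : (j : ℝ) + 1 < ‖g y‖) => ?_) _
          have : (0 : ℝ) ≤ j := by positivity
          exact lt_of_le_of_lt (by linarith) hy
  have hlc2 := lintegral_rpow_eq_lintegral_meas_lt_mul (volume : Measure 𝔼)
    (f := fun x => (maximalFunction g x).toReal / 2)
    (Eventually.of_forall fun y => by positivity)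
    (hM.ennreal_toReal.div_const 2).aemeasurable hp0
  have hp1' : ENNReal.ofReal (p - 1) ≠ 0 := by simpa using hp
  calc ∫⁻ x, maximalFunction g x ^ p
      = ∫⁻ x, 2 ^ p * ENNReal.ofReal (((maximalFunction g x).toReal / 2) ^ p) := by
        refine lintegral_congr_ae ?_
        filter_upwards [hfin] with x hx
        rw [Real.div_rpow ENNReal.toReal_nonneg zero_le_two,
          ENNReal.ofReal_div_of_pos (by positivity),
          ← ENNReal.ofReal_rpow_of_nonneg zero_le_two hp0.le,
          ← ENNReal.ofReal_rpow_of_nonneg ENNReal.toReal_nonneg hp0.le, ENNReal.ofReal_toReal hx.ne,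
          ENNReal.ofReal_ofNat]
        exact (ENNReal.mul_div_cancel (by simp) (by simp)).symm
    _ = 2 ^ p * (ENNReal.ofReal p * ∫⁻ t in Set.Ioi (0 : ℝ),
          volume {x | t < (maximalFunction g x).toReal / 2} * ENNReal.ofReal (t ^ (p - 1))) := by
        rw [lintegral_const_mul' _ _ (by simp), hlc2]
    -- The weak bound trades a factor `t` and Lebesgue measure for `ν = |g| dy`. The result is the
    -- layer-cake integral of `|g|^{p-1}` with respect to `ν`, that is, of `|g|^p`.
    _ ≤ 2 ^ p * (ENNReal.ofReal p * ∫⁻ t in Set.Ioi (0 : ℝ),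
          5 ^ n * (ν {y | t < ‖g y‖} * ENNReal.ofReal (t ^ (p - 1 - 1)))) := by
        refine mul_le_mul_right (mul_le_mul_right ?_ _) _
        refine setLIntegral_mono' measurableSet_Ioi fun t (ht : 0 < t) => ?_
        have h1 : volume {x | t < (maximalFunction g x).toReal / 2}
            ≤ volume {x : 𝔼 | 2 * ENNReal.ofReal t < maximalFunction g x} := by
          refine measure_mono fun x hx => ?_
          have hx : t < (maximalFunction g x).toReal / 2 := hx
          have h2 : 2 * t < (maximalFunction g x).toReal := by linarith
          rw [Set.mem_ofPred_eq, ← ENNReal.ofReal_ofNat, ← ENNReal.ofReal_mul zero_le_two]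
          exact (ENNReal.ofReal_lt_iff_lt_toReal (by positivity) (fun h => by
            rw [h, ENNReal.toReal_top] at h2; linarith)).2 h2
        have h3 : ENNReal.ofReal (t ^ (p - 1))
            = ENNReal.ofReal t * ENNReal.ofReal (t ^ (p - 1 - 1)) := by
          rw [← ENNReal.ofReal_mul ht.le, Real.rpow_sub_one ht.ne' (p - 1)]
          congr 1
          field_simp
        calc _ ≤ volume {x : 𝔼 | 2 * ENNReal.ofReal t < maximalFunction g x}
              * (ENNReal.ofReal t * ENNReal.ofReal (t ^ (p - 1 - 1))) := by rw [h3]; gcongr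
          _ = (ENNReal.ofReal t * volume {x : 𝔼 | 2 * ENNReal.ofReal t < maximalFunction g x})
              * ENNReal.ofReal (t ^ (p - 1 - 1)) := by ring
          _ ≤ (5 ^ n * ν {y | t < ‖g y‖}) * ENNReal.ofReal (t ^ (p - 1 - 1)) := by
              exact mul_le_mul_left (mul_measure_lt_maximalFunction_le hg t) _
          _ = _ := by ring
    _ = 2 ^ p * (ENNReal.ofReal p * (5 ^ n * ((ENNReal.ofReal (p - 1))⁻¹
          * ∫⁻ y, ‖g y‖ₑ ^ p))) := by
        rw [lintegral_const_mul' _ _ (by simp), hlc, ← mul_assoc (ENNReal.ofReal (p - 1))⁻¹,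
          ENNReal.inv_mul_cancel hp1' ENNReal.ofReal_ne_top, one_mul]
    _ = _ := by
        have e : ((p - 1).toNNReal : ℝ≥0) ≠ 0 := by simpa using hp
        push_cast [ENNReal.coe_inv e]
        rw [ENNReal.coe_rpow_of_ne_zero two_ne_zero]
        simp only [ENNReal.ofReal]
        push_cast
        ring

end HardyLittlewood

/-! ### Tempered distributions given by functions, and multiplier bounds by duality. -/

noncomputable section Distributions

variable {n : ℕ}

local notation "𝔼" => EuclideanSpace ℝ (Fin n)

/-- Pair with a bump function equal to `1` on a ball containing the compact set. -/
theorem RepresentedBy.locallyIntegrable {u : 𝓢'(𝔼, ℂ)} {F : 𝔼 → ℂ} (h : RepresentedBy u F) :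
    LocallyIntegrable F := by
  rw [locallyIntegrable_iff]
  intro K hK
  obtain ⟨R, hR0, hR⟩ := hK.isBounded.subset_closedBall_lt 0 (0 : 𝔼)
  let b : ContDiffBump (0 : 𝔼) := ⟨R, R + 1, hR0, by linarith⟩
  have hc : HasCompactSupport (fun x => ((b x : ℝ) : ℂ)) :=
    b.hasCompactSupport.comp_left (g := fun r : ℝ => (r : ℂ)) (by simp)
  have hd : ContDiff ℝ (⊤ : ℕ∞) (fun x => ((b x : ℝ) : ℂ)) :=
    Complex.ofRealCLM.contDiff.comp b.contDiff
  have h1 := (h (hc.toSchwartzMap hd)).1.integrableOn (s := Metric.closedBall 0 R)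
  refine IntegrableOn.mono_set ?_ hR
  refine h1.congr_fun (fun x hx => ?_) measurableSet_closedBall
  show ((b x : ℝ) : ℂ) * F x = F x
  rw [b.one_of_mem_closedBall hx]
  simp

theorem RepresentedBy.ae_eq {u : 𝓢'(𝔼, ℂ)} {F F' : 𝔼 → ℂ} (h : RepresentedBy u F)
    (h' : RepresentedBy u F') : F =ᵐ[volume] F' := by
  refine ae_eq_of_integral_contDiff_smul_eq h.locallyIntegrable h'.locallyIntegrable
    fun b hb hbc => ?_
  have hc : HasCompactSupport (fun x => ((b x : ℝ) : ℂ)) :=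
    hbc.comp_left (g := fun r : ℝ => (r : ℂ)) (by simp)
  have hd : ContDiff ℝ (⊤ : ℕ∞) (fun x => ((b x : ℝ) : ℂ)) :=
    Complex.ofRealCLM.contDiff.comp hb
  have e := (h (hc.toSchwartzMap hd)).2.symm.trans (h' (hc.toSchwartzMap hd)).2
  simp only [Complex.real_smul]
  exact e

theorem RepresentedBy.distLpNorm_eq {u : 𝓢'(𝔼, ℂ)} {F : 𝔼 → ℂ} (h : RepresentedBy u F)
    (p : ℝ≥0∞) : distLpNorm p u = eLpNorm F p volume := by
  refine le_antisymm (iInf₂_le F h) (le_iInf₂ fun F' h' => ?_)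
  exact (eLpNorm_congr_ae (h.ae_eq h')).le

theorem exists_representedBy_heat {β : ℝ} {f : 𝓢'(𝔼, ℂ)} (hf : besovNorm β f < ∞) {t : ℝ}
    (ht : 0 < t) : ∃ F : 𝔼 → ℂ, RepresentedBy (heat t f) F ∧
      eLpNorm F ∞ volume ≤ ENNReal.ofReal (t ^ (-(β / 2))) * besovNorm β f := by
  have h1 : ENNReal.ofReal (t ^ (β / 2)) * distLpNorm ∞ (heat t f) ≤ besovNorm β f :=
    le_iSup₂ (f := fun (t : ℝ) (_ : 0 < t) =>
      ENNReal.ofReal (t ^ (β / 2)) * distLpNorm ∞ (heat t f)) t ht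
  have h2 : distLpNorm ∞ (heat t f) ≤ ENNReal.ofReal (t ^ (-(β / 2))) * besovNorm β f := by
    calc distLpNorm ∞ (heat t f)
        = ENNReal.ofReal (t ^ (-(β / 2))) *
          (ENNReal.ofReal (t ^ (β / 2)) * distLpNorm ∞ (heat t f)) := by
          rw [← mul_assoc, ← ENNReal.ofReal_mul (by positivity), ← Real.rpow_add ht]
          simp
      _ ≤ _ := by gcongr
  have h3 : distLpNorm ∞ (heat t f) < ∞ :=
    h2.trans_lt (ENNReal.mul_lt_top ENNReal.ofReal_lt_top hf)
  obtain ⟨F, hF⟩ := iInf_lt_iff.1 h3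
  obtain ⟨hF, -⟩ := iInf_lt_iff.1 hF
  exact ⟨F, hF, by rwa [← hF.distLpNorm_eq]⟩

/-- Multiplication of a Schwartz function by a function of temperate growth. -/
abbrev symbolMul (m : 𝔼 → ℂ) (η : 𝓢(𝔼, ℂ)) : 𝓢(𝔼, ℂ) := SchwartzMap.smulLeftCLM ℂ m η

theorem symbolMul_apply {m : 𝔼 → ℂ} (hm : m.HasTemperateGrowth) (η : 𝓢(𝔼, ℂ)) (ξ : 𝔼) :
    symbolMul m η ξ = m ξ * η ξ := by
  rw [symbolMul, SchwartzMap.smulLeftCLM_apply_apply hm, smul_eq_mul]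

/-- Writing every test function as `𝓕 η` lets Fourier multipliers on distributions act as plain
multiplication on `η`. -/
theorem heat_apply_fourier (t : ℝ) (f : 𝓢'(𝔼, ℂ)) (η : 𝓢(𝔼, ℂ)) :
    heat t f (𝓕 η) = f (𝓕 (symbolMul (heatSymbol t) η)) := by
  rw [heat, TemperedDistribution.fourierMultiplierCLM_apply_apply,
    FourierTransform.fourierInv_fourier_eq]
  rfl

/-- The Fourier transform of a tempered distribution, as a functional. -/
def fourierFunctional (f : 𝓢'(𝔼, ℂ)) : 𝓢(𝔼, ℂ) →L[ℂ] ℂ :=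
  (show 𝓢(𝔼, ℂ) →L[ℂ] ℂ from f) ∘L FourierTransform.fourierCLM ℂ 𝓢(𝔼, ℂ)

/-- Duality between `L^∞` and `L¹`, with the Besov bound on `e^{tΔ} f`. -/
theorem enorm_apply_heatSymbol_le {β : ℝ} {f : 𝓢'(𝔼, ℂ)} (hf : besovNorm β f < ∞) {t : ℝ}
    (ht : 0 < t) (η : 𝓢(𝔼, ℂ)) :
    ‖f (𝓕 (symbolMul (heatSymbol t) η))‖ₑ
      ≤ ENNReal.ofReal (t ^ (-(β / 2))) * besovNorm β f * ∫⁻ x, ‖𝓕 η x‖ₑ := by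
  obtain ⟨F, hF, hFb⟩ := exists_representedBy_heat hf ht
  rw [← heat_apply_fourier, (hF (𝓕 η)).2]
  calc _ ≤ ∫⁻ x, ‖𝓕 η x * F x‖ₑ := enorm_integral_le_lintegral_enorm _
    _ ≤ ∫⁻ x, (ENNReal.ofReal (t ^ (-(β / 2))) * besovNorm β f) * ‖𝓕 η x‖ₑ := by
        refine lintegral_mono_ae ?_
        filter_upwards [ae_le_eLpNormEssSup (f := F) (μ := volume)] with x hx
        rw [enorm_mul, mul_comm]
        gcongr
        exact hx.trans (by rwa [← eLpNorm_exponent_top])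
    _ = _ := lintegral_const_mul' _ _
        (ENNReal.mul_ne_top ENNReal.ofReal_ne_top hf.ne)

theorem laplacian_iterate_apply_fourier (N : ℕ) (u : 𝓢'(𝔼, ℂ)) (η : 𝓢(𝔼, ℂ)) :
    (Laplacian.laplacian^[N] u) (𝓕 η)
      = (-1) ^ N * u (𝓕 (symbolMul (fun ξ => (laplaceSymbol ξ : ℂ) ^ N) η)) := by
  induction N generalizing u with
  | zero =>
    have : symbolMul (fun ξ => (laplaceSymbol ξ : ℂ) ^ 0) η = η := by
      ext ξ; rw [symbolMul_apply (by fun_prop)]; simp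
    rw [this]; simp
  | succ N ih =>
    rw [Function.iterate_succ_apply, ih, TemperedDistribution.laplacian_eq_fourierMultiplierCLM]
    have e : symbolMul (fun ξ => (laplaceSymbol ξ : ℂ) ^ (N + 1)) η
        = ((2 * Real.pi) ^ 2 : ℂ) • symbolMul (fun ξ => Complex.ofReal (‖ξ‖ ^ 2))
          (symbolMul (fun ξ => (laplaceSymbol ξ : ℂ) ^ N) η) := by
      ext ξ
      rw [_root_.smul_apply, symbolMul_apply (by fun_prop), symbolMul_apply (by fun_prop),
        symbolMul_apply (by fun_prop), laplaceSymbol]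
      simp only [smul_eq_mul]
      push_cast
      ring
    rw [e, FourierTransform.fourier_smul, map_smul, _root_.smul_apply,
      TemperedDistribution.fourierMultiplierCLM_apply_apply,
      FourierTransform.fourierInv_fourier_eq, Complex.real_smul, smul_eq_mul]
    push_cast
    ring

theorem transSup_one (φ : 𝔼 → ℂ) : transSup (fun _ => 1) φ = ∫⁻ x, ‖φ x‖ₑ := by
  unfold transSup
  simp [lintegral_sub_right_eq_self (fun x => ‖φ x‖ₑ)]

theorem fourier_symbolMul_eq_convolution {K : 𝔼 → ℂ} (hK : Integrable K)
    (hm : (𝓕⁻ K : 𝔼 → ℂ).HasTemperateGrowth) (η : 𝓢(𝔼, ℂ)) (x : 𝔼) :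
    𝓕 (symbolMul (𝓕⁻ K) η) x = ∫ y, K y * 𝓕 η (x - y) := by
  rw [SchwartzMap.fourier_coe, SchwartzMap.fourier_coe, ← fourier_fourierInv_mul hK η.integrable]
  refine congrFun (congrArg (𝓕 : (𝔼 → ℂ) → 𝔼 → ℂ) (funext fun ξ => ?_)) x
  exact symbolMul_apply hm η ξ

theorem hasTemperateGrowth_dilation (w : 𝓢(𝔼, ℂ)) (r : ℝ) :
    (fun ξ : 𝔼 => w (r • ξ)).HasTemperateGrowth :=
  w.hasTemperateGrowth.comp (f := fun ξ : 𝔼 => r • ξ) (by fun_prop)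

/-- The symbol `w(rξ)` acts as convolution with a dilate of `𝓕 w`, whose `L¹` norm does not depend
on `r`. -/
theorem transSup_fourier_dilation_le {g : 𝔼 → ℂ} (hg : AEStronglyMeasurable g) (w η : 𝓢(𝔼, ℂ))
    {r : ℝ} (hr : 0 < r) :
    transSup g (𝓕 (symbolMul (fun ξ => w (r • ξ)) η) : 𝓢(𝔼, ℂ))
      ≤ (∫⁻ y, ‖𝓕 w y‖ₑ) * transSup g (𝓕 η : 𝓢(𝔼, ℂ)) := by
  obtain ⟨K, hK, hKF, hKn⟩ := exists_dilation (𝓕 w).integrable hr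
  have e : (𝓕⁻ K : 𝔼 → ℂ) = fun ξ => w (r • ξ) := by
    ext ξ
    rw [hKF, ← SchwartzMap.fourierInv_coe, FourierTransform.fourierInv_fourier_eq]
  have hm := hasTemperateGrowth_dilation w r
  rw [← e] at hm ⊢
  rw [← hKn]
  refine transSup_le_of_enorm_le_convolution hg hK.1 (𝓕 η).continuous fun x => ?_
  rw [fourier_symbolMul_eq_convolution hK hm]
  refine (enorm_integral_le_lintegral_enorm _).trans (le_of_eq ?_)
  simp only [enorm_mul]

theorem lintegral_fourier_dilation_le (w η : 𝓢(𝔼, ℂ)) {r : ℝ} (hr : 0 < r) :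
    ∫⁻ x, ‖𝓕 (symbolMul (fun ξ => w (r • ξ)) η) x‖ₑ
      ≤ (∫⁻ y, ‖𝓕 w y‖ₑ) * ∫⁻ x, ‖𝓕 η x‖ₑ := by
  have := transSup_fourier_dilation_le (g := fun _ => 1) aestronglyMeasurable_const w η hr
  rwa [transSup_one, transSup_one] at this

end Distributions

/-! ### The reproducing formula. -/

noncomputable section ReproducingFormula

variable {n : ℕ}

local notation "𝔼" => EuclideanSpace ℝ (Fin n)

/-- The pairing `⟨(-Δ)^k e^{tΔ} f, 𝓕 η⟩`. -/
def heatPairing (f : 𝓢'(𝔼, ℂ)) (η : 𝓢(𝔼, ℂ)) (k : ℕ) (t : ℝ) : ℂ :=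
  f (𝓕 (symbolMul (heatSymbol t) (symbolMul (fun ξ => (laplaceSymbol ξ : ℂ) ^ k) η)))

theorem hasDerivAt_heatPairing (f : 𝓢'(𝔼, ℂ)) (η : 𝓢(𝔼, ℂ)) (k : ℕ) {t : ℝ} (ht : 0 < t) :
    HasDerivAt (heatPairing f η k) (-heatPairing f η (k + 1) t) t := by
  have h : HasDerivAt (heatPairing f η k) (-fourierFunctional f (symbolMul (heatSymbol t)
      (symbolMul (fun ξ => (laplaceSymbol ξ : ℂ))
        (symbolMul (fun ξ => (laplaceSymbol ξ : ℂ) ^ k) η)))) t :=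
    hasDerivAt_apply_exp_neg_mul (laplaceSymbol_hasTemperateGrowth (E := 𝔼))
      laplaceSymbol_nonneg (fourierFunctional f)
      (symbolMul (fun ξ => (laplaceSymbol ξ : ℂ) ^ k) η) ht
  have e : symbolMul (fun ξ => (laplaceSymbol ξ : ℂ))
      (symbolMul (fun ξ => (laplaceSymbol ξ : ℂ) ^ k) η) =
      symbolMul (fun ξ => (laplaceSymbol ξ : ℂ) ^ (k + 1)) η := by
    ext ξ
    rw [symbolMul_apply (by fun_prop), symbolMul_apply (by fun_prop),
      symbolMul_apply (by fun_prop)]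
    ring
  rw [e] at h
  exact h

theorem continuousOn_heatPairing (f : 𝓢'(𝔼, ℂ)) (η : 𝓢(𝔼, ℂ)) (k : ℕ) :
    ContinuousOn (heatPairing f η k) (Set.Ici 0) :=
  continuousOn_apply_exp_neg_mul (laplaceSymbol_hasTemperateGrowth (E := 𝔼))
    laplaceSymbol_nonneg (fourierFunctional f) (symbolMul (fun ξ => (laplaceSymbol ξ : ℂ) ^ k) η)

theorem heatPairing_zero_zero (f : 𝓢'(𝔼, ℂ)) (η : 𝓢(𝔼, ℂ)) : heatPairing f η 0 0 = f (𝓕 η) := by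
  have e : symbolMul (heatSymbol 0) (symbolMul (fun ξ => (laplaceSymbol ξ : ℂ) ^ 0) η) = η := by
    ext ξ
    rw [symbolMul_apply (heatSymbol_hasTemperateGrowth le_rfl), symbolMul_apply (by fun_prop)]
    simp [heatSymbol_zero_time]
  rw [heatPairing, e]

/-- Split `(tq)^k e^{-tq}` as `e^{-tq/2}` times `w(√t ξ)` with `w = q^k e^{-q/2}`. The first factor
uses the Besov norm at time `t/2`; the second is bounded on `L¹` uniformly in `t`. -/
theorem exists_norm_heatPairing_le {β : ℝ} {f : 𝓢'(𝔼, ℂ)} (hf : besovNorm β f < ∞)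
    (η : 𝓢(𝔼, ℂ)) (k : ℕ) : ∃ C : ℝ, 0 ≤ C ∧ ∀ t : ℝ, 0 < t →
      ‖(t : ℂ) ^ k * heatPairing f η k t‖ ≤ C * t ^ (-(β / 2)) := by
  set w : 𝓢(𝔼, ℂ) := gaussianSchwartz k (c := 1 / 2) (by norm_num) with hw
  set I : ℝ≥0∞ := besovNorm β f * ((∫⁻ y, ‖𝓕 w y‖ₑ) * ∫⁻ x, ‖𝓕 η x‖ₑ) with hI
  have hIfin : I < ∞ :=
    ENNReal.mul_lt_top hf (ENNReal.mul_lt_top (𝓕 w).integrable.2 (𝓕 η).integrable.2)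
  refine ⟨(1 / 2) ^ (-(β / 2)) * I.toReal, by positivity, fun t ht => ?_⟩
  have ht2 : 0 < t / 2 := by positivity
  have e : (t : ℂ) ^ k * heatPairing f η k t
      = f (𝓕 (symbolMul (heatSymbol (t / 2)) (symbolMul (fun ξ => w (Real.sqrt t • ξ)) η))) := by
    rw [heatPairing, ← smul_eq_mul, ← map_smul, ← FourierTransform.fourier_smul]
    congr 2
    ext ξ
    rw [_root_.smul_apply, symbolMul_apply (heatSymbol_hasTemperateGrowth ht.le),
      symbolMul_apply (by fun_prop), symbolMul_apply (heatSymbol_hasTemperateGrowth ht2.le),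
      symbolMul_apply (hasTemperateGrowth_dilation w _), hw, gaussianSchwartz_apply]
    have h1 : laplaceSymbol (Real.sqrt t • ξ) = t * laplaceSymbol ξ := by
      rw [laplaceSymbol, laplaceSymbol, norm_smul, Real.norm_of_nonneg (Real.sqrt_nonneg t)]
      have := Real.sq_sqrt ht.le
      calc _ = (Real.sqrt t) ^ 2 * (2 * Real.pi * ‖ξ‖) ^ 2 := by ring
        _ = _ := by rw [this]
    have h2 : heatSymbol (1 / 2) (Real.sqrt t • ξ) = heatSymbol (t / 2) ξ := by
      rw [heatSymbol, heatSymbol, h1]; ring_nf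
    have h3 : heatSymbol t ξ = heatSymbol (t / 2) ξ * heatSymbol (t / 2) ξ := by
      rw [← heatSymbol_add, add_halves]
    rw [h1, h2, h3, smul_eq_mul]
    push_cast
    ring
  have h1 := enorm_apply_heatSymbol_le hf ht2 (symbolMul (fun ξ => w (Real.sqrt t • ξ)) η)
  have h2 := lintegral_fourier_dilation_le w η (Real.sqrt_pos.2 ht)
  have h3 : ‖(t : ℂ) ^ k * heatPairing f η k t‖ₑ ≤ ENNReal.ofReal ((t / 2) ^ (-(β / 2))) * I := by
    rw [e]
    refine h1.trans ?_
    rw [hI, ← mul_assoc]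
    gcongr
  have h4 := ENNReal.toReal_mono (ENNReal.mul_ne_top ENNReal.ofReal_ne_top hIfin.ne) h3
  rw [toReal_enorm, ENNReal.toReal_mul, ENNReal.toReal_ofReal (by positivity), div_eq_mul_one_div,
    Real.mul_rpow ht.le (by norm_num)] at h4
  linarith

/-- The primitive of `t ↦ -t^N ⟨(-Δ)^{N+1} e^{tΔ} f, 𝓕 η⟩ / N!`. -/
def heatTaylor (f : 𝓢'(𝔼, ℂ)) (η : 𝓢(𝔼, ℂ)) (N : ℕ) (t : ℝ) : ℂ :=
  ∑ k ∈ Finset.range N, ((k.factorial : ℂ))⁻¹ * ((t : ℂ) ^ k * heatPairing f η k t)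

/-- Differentiating `t^k/k!` in one term cancels the derivative of the pairing in the preceding one;
only the last survives. -/
theorem hasDerivAt_heatTaylor (f : 𝓢'(𝔼, ℂ)) (η : 𝓢(𝔼, ℂ)) (N : ℕ) {t : ℝ} (ht : 0 < t) :
    HasDerivAt (heatTaylor f η (N + 1))
      (-((N.factorial : ℂ)⁻¹ * ((t : ℂ) ^ N * heatPairing f η (N + 1) t))) t := by
  induction N with
  | zero =>
    have := hasDerivAt_heatPairing f η 0 ht
    have e : heatTaylor f η (0 + 1) = heatPairing f η 0 := by
      ext t; simp [heatTaylor]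
    rw [e]
    simpa using this
  | succ N ih =>
    have e : heatTaylor f η (N + 1 + 1) = fun t => heatTaylor f η (N + 1) t
        + (((N + 1).factorial : ℂ))⁻¹ * ((t : ℂ) ^ (N + 1) * heatPairing f η (N + 1) t) := by
      ext t; rw [heatTaylor, Finset.sum_range_succ]; rfl
    rw [e]
    have h1 : HasDerivAt (fun t : ℝ => (t : ℂ) ^ (N + 1)) (((N + 1 : ℕ) : ℂ) * (t : ℂ) ^ N) t := by
      have := (hasDerivAt_pow (N + 1) (t : ℂ)).comp_ofReal
      simpa using this
    have h2 := ih.add ((h1.mul (hasDerivAt_heatPairing f η (N + 1) ht)).const_mul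
      (((N + 1).factorial : ℂ))⁻¹)
    refine h2.congr_deriv ?_
    have h3 : ((N.factorial : ℂ)) ≠ 0 := mod_cast N.factorial_ne_zero
    have h4 : ((N : ℂ) + 1) ≠ 0 := mod_cast N.succ_ne_zero
    rw [Nat.factorial_succ]
    push_cast
    field_simp
    ring

theorem continuousOn_heatTaylor (f : 𝓢'(𝔼, ℂ)) (η : 𝓢(𝔼, ℂ)) (N : ℕ) :
    ContinuousOn (heatTaylor f η N) (Set.Ici 0) := by
  refine continuousOn_finsetSum _ fun k _ => continuousOn_const.mul (ContinuousOn.mul ?_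
    (continuousOn_heatPairing f η k))
  fun_prop

theorem tendsto_heatTaylor {β : ℝ} (hβ : 0 < β) {f : 𝓢'(𝔼, ℂ)} (hf : besovNorm β f < ∞)
    (η : 𝓢(𝔼, ℂ)) (N : ℕ) : Tendsto (heatTaylor f η N) atTop (𝓝 0) := by
  rw [← Finset.sum_const_zero (s := Finset.range N)]
  refine tendsto_finsetSum _ fun k _ => ?_
  rw [← mul_zero ((k.factorial : ℂ))⁻¹]
  refine Tendsto.const_mul _ ?_
  obtain ⟨C, hC, h⟩ := exists_norm_heatPairing_le hf η k
  refine squeeze_zero_norm' ((eventually_gt_atTop 0).mono h) ?_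
  simpa using (tendsto_rpow_neg_atTop (show 0 < β / 2 by positivity)).const_mul C

/-- Continuity up to `0` handles `(0, 1]`; on `(1, ∞)` the integrand is `O(t^{-1-β/2})`. -/
theorem integrableOn_pow_mul_heatPairing {β : ℝ} (hβ : 0 < β) {f : 𝓢'(𝔼, ℂ)}
    (hf : besovNorm β f < ∞) (η : 𝓢(𝔼, ℂ)) (N : ℕ) :
    IntegrableOn (fun t : ℝ => (t : ℂ) ^ N * heatPairing f η (N + 1) t) (Set.Ioi 0) := by
  have hc : ContinuousOn (fun t : ℝ => (t : ℂ) ^ N * heatPairing f η (N + 1) t) (Set.Ici 0) :=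
    ContinuousOn.mul (by fun_prop) (continuousOn_heatPairing f η (N + 1))
  rw [← Set.Ioc_union_Ioi_eq_Ioi zero_le_one]
  refine IntegrableOn.union ?_ ?_
  · exact ((hc.mono Set.Icc_subset_Ici_self).integrableOn_compact isCompact_Icc).mono_set
      Set.Ioc_subset_Icc_self
  · obtain ⟨C, hC, h⟩ := exists_norm_heatPairing_le hf η (N + 1)
    have h1 : IntegrableOn (fun t : ℝ => C * t ^ (-1 - β / 2)) (Set.Ioi 1) :=
      (integrableOn_Ioi_rpow_of_lt (by linarith) one_pos).const_mul C
    refine Integrable.mono' h1 ?_ ?_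
    · exact (hc.mono fun t (ht : 1 < t) => (zero_le_one.trans ht.le :)).aestronglyMeasurable
        measurableSet_Ioi
    · filter_upwards [ae_restrict_mem measurableSet_Ioi] with t ht
      have ht0 : 0 < t := one_pos.trans ht
      have h2 := h t ht0
      rw [pow_succ', mul_assoc, norm_mul, Complex.norm_real, Real.norm_of_nonneg ht0.le] at h2
      rw [sub_eq_add_neg, Real.rpow_add ht0, Real.rpow_neg_one]
      rw [mul_left_comm, inv_mul_eq_div, le_div_iff₀' ht0]
      exact h2

theorem reproducing_formula {β : ℝ} (hβ : 0 < β) {N : ℕ} (hN : 0 < N) {f : 𝓢'(𝔼, ℂ)}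
    (hf : besovNorm β f < ∞) (φ : 𝓢(𝔼, ℂ)) :
    IntegrableOn
        (fun t : ℝ => (t : ℂ) ^ N * (Laplacian.laplacian^[N] (heat t f)) φ / (t : ℂ))
        (Set.Ioi 0) ∧
      f φ = ((-1) ^ N / ((Real.Gamma (N : ℝ) : ℝ) : ℂ)) *
        ∫ t in Set.Ioi (0 : ℝ),
          (t : ℂ) ^ N * (Laplacian.laplacian^[N] (heat t f)) φ / (t : ℂ) := by
  obtain ⟨η, rfl⟩ : ∃ η : 𝓢(𝔼, ℂ), φ = 𝓕 η :=
    ⟨𝓕⁻ φ, (FourierTransform.fourier_fourierInv_eq φ).symm⟩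
  -- From here on `N` denotes the old `N - 1`, so that `Γ` of the original exponent is `N!`.
  obtain ⟨N, rfl⟩ : ∃ m, N = m + 1 := ⟨N - 1, by omega⟩
  have hi := integrableOn_pow_mul_heatPairing hβ hf η N
  have e : Set.EqOn (fun t : ℝ => (-1 : ℂ) ^ (N + 1) * ((t : ℂ) ^ N * heatPairing f η (N + 1) t))
      (fun t : ℝ => (t : ℂ) ^ (N + 1) * (Laplacian.laplacian^[N + 1] (heat t f)) (𝓕 η) / (t : ℂ))
      (Set.Ioi 0) := fun t (ht : 0 < t) => by
    have ht' : (t : ℂ) ≠ 0 := mod_cast ht.ne'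
    simp only
    rw [laplacian_iterate_apply_fourier, heat_apply_fourier, heatPairing]
    field_simp
    ring
  refine ⟨IntegrableOn.congr_fun (hi.const_mul _) e measurableSet_Ioi, ?_⟩
  rw [← setIntegral_congr_fun measurableSet_Ioi e, integral_const_mul]
  have h0 : (N.factorial : ℂ) ≠ 0 := mod_cast N.factorial_ne_zero
  have h1 := integral_Ioi_of_hasDerivAt_of_tendsto
    ((continuousOn_heatTaylor f η (N + 1)) 0 Set.self_mem_Ici)
    (fun t ht => hasDerivAt_heatTaylor f η N ht) ((hi.const_mul (N.factorial : ℂ)⁻¹).neg)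
    (tendsto_heatTaylor hβ hf η (N + 1))
  have h2 : heatTaylor f η (N + 1) 0 = f (𝓕 η) := by
    rw [heatTaylor, Finset.sum_range_succ', Finset.sum_eq_zero fun k _ => by simp]
    simp [heatPairing_zero_zero]
  rw [integral_neg, integral_const_mul, h2, zero_sub, neg_inj] at h1
  rw [← h1]
  push_cast
  rw [Real.Gamma_nat_eq_factorial]
  have h3 : ((-1 : ℂ) ^ (N + 1)) * (-1) ^ (N + 1) = 1 := by
    rw [← mul_pow]; simp
  push_cast
  rw [div_mul_eq_mul_div, ← mul_assoc, h3, one_mul, div_eq_inv_mul]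

end ReproducingFormula

/-! ### Mixtures of heat kernels. -/

noncomputable section HeatMixtures

open scoped RealInnerProductSpace

variable {n : ℕ}

local notation "𝔼" => EuclideanSpace ℝ (Fin n)

/-- The mixture `∫₀^∞ k(σ) h_{Tσ + s} dσ` of heat kernels. -/
def heatMixture (k : ℝ → ℝ) (T s : ℝ) (x : 𝔼) : ℂ :=
  ∫ σ in Set.Ioi 0, ((k σ * heatKernel (T * σ + s) x : ℝ) : ℂ)

variable {k : ℝ → ℝ} {T s : ℝ}

theorem heatMixture_neg (x : 𝔼) : heatMixture k T s (-x) = heatMixture k T s x := by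
  simp only [heatMixture, heatKernel_neg]

theorem integrable_mul_heatKernel_prod (hk : IntegrableOn k (Set.Ioi 0)) (hT : 0 < T)
    (hs : 0 ≤ s) : Integrable (fun p : ℝ × 𝔼 => ((k p.1 * heatKernel (T * p.1 + s) p.2 : ℝ) : ℂ))
      ((volume.restrict (Set.Ioi 0)).prod volume) := by
  refine Integrable.ofReal ?_
  have hm : Measurable (fun p : ℝ × 𝔼 => heatKernel (T * p.1 + s) p.2) :=
    measurable_heatKernel.comp (f := fun p : ℝ × 𝔼 => (T * p.1 + s, p.2)) (by fun_prop)
  have hpos {σ : ℝ} (hσ : σ ∈ Set.Ioi (0 : ℝ)) : 0 < T * σ + s := by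
    have : 0 < T * σ := mul_pos hT hσ
    linarith
  have ha : AEStronglyMeasurable (fun p : ℝ × 𝔼 => k p.1 * heatKernel (T * p.1 + s) p.2)
      ((volume.restrict (Set.Ioi 0)).prod volume) := hk.1.comp_fst.mul hm.aestronglyMeasurable
  refine (integrable_prod_iff ha).2 ⟨?_, ?_⟩
  · filter_upwards [ae_restrict_mem measurableSet_Ioi] with σ hσ
    exact (integrable_heatKernel (hpos hσ)).const_mul _
  · refine hk.norm.congr ?_
    filter_upwards [ae_restrict_mem measurableSet_Ioi] with σ hσ
    simp only [norm_mul]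
    rw [integral_const_mul]
    simp only [Real.norm_of_nonneg (heatKernel_nonneg (hpos hσ).le _)]
    rw [integral_heatKernel (hpos hσ), mul_one]

theorem integrable_heatMixture (hk : IntegrableOn k (Set.Ioi 0)) (hT : 0 < T) (hs : 0 ≤ s) :
    Integrable (heatMixture k T s : 𝔼 → ℂ) :=
  (integrable_mul_heatKernel_prod hk hT hs).integral_prod_right

/-- Fubini: the transform of the mixture is the Laplace transform of `k` at `T q(ξ)`, with the shift
`s` contributing a separate heat factor. -/
theorem fourierInv_heatMixture (hk : IntegrableOn k (Set.Ioi 0)) (hT : 0 < T) (hs : 0 ≤ s)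
    (ξ : 𝔼) : 𝓕⁻ (heatMixture k T s) ξ
      = heatSymbol s ξ *
        ((∫ σ in Set.Ioi 0, k σ * Real.exp (-(T * laplaceSymbol ξ * σ)) : ℝ) : ℂ) := by
  have hint : Integrable (fun p : 𝔼 × ℝ => (Real.fourierChar ⟪p.1, ξ⟫ : ℂ) *
      ((k p.2 * heatKernel (T * p.2 + s) p.1 : ℝ) : ℂ))
      (volume.prod (volume.restrict (Set.Ioi 0))) := by
    refine (integrable_mul_heatKernel_prod (n := n) hk hT hs).swap.bdd_mul (c := 1) ?_ ?_
    · have c1 : Continuous fun p : 𝔼 × ℝ => (Real.fourierChar ⟪p.1, ξ⟫ : ℂ) :=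
        continuous_subtype_val.comp (Real.continuous_fourierChar.comp (by fun_prop))
      exact c1.aestronglyMeasurable
    · exact Eventually.of_forall fun p => (Circle.norm_coe _).le
  calc 𝓕⁻ (heatMixture k T s) ξ
      = ∫ x, ∫ σ in Set.Ioi 0, (Real.fourierChar ⟪x, ξ⟫ : ℂ) *
          ((k σ * heatKernel (T * σ + s) x : ℝ) : ℂ) := by
        rw [Real.fourierInv_eq]
        refine integral_congr_ae (Eventually.of_forall fun x => ?_)
        simp only [Circle.smul_def, smul_eq_mul, heatMixture]
        rw [integral_const_mul]
    _ = ∫ σ in Set.Ioi 0, ∫ x, (Real.fourierChar ⟪x, ξ⟫ : ℂ) *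
          ((k σ * heatKernel (T * σ + s) x : ℝ) : ℂ) := integral_integral_swap hint
    _ = ∫ σ in Set.Ioi 0, heatSymbol s ξ *
          ((k σ * Real.exp (-(T * laplaceSymbol ξ * σ)) : ℝ) : ℂ) := by
        refine setIntegral_congr_fun measurableSet_Ioi fun σ (hσ : 0 < σ) => ?_
        have hp : 0 < T * σ + s := by positivity
        have h1 := fourierInv_heatKernel hp ξ
        rw [Real.fourierInv_eq] at h1
        simp only [Circle.smul_def, smul_eq_mul] at h1
        have h2 (x : 𝔼) : (Real.fourierChar ⟪x, ξ⟫ : ℂ) *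
            ((k σ * heatKernel (T * σ + s) x : ℝ) : ℂ)
            = (k σ : ℂ) * ((Real.fourierChar ⟪x, ξ⟫ : ℂ) * (heatKernel (T * σ + s) x : ℂ)) := by
          push_cast; ring
        simp only [h2]
        rw [integral_const_mul, h1, add_comm, heatSymbol_add, heatSymbol, heatSymbol]
        push_cast
        ring_nf
    _ = _ := by rw [integral_const_mul, integral_complex_ofReal]

theorem fourierInv_heatMixture_eq_mul (hk : IntegrableOn k (Set.Ioi 0)) (hT : 0 < T) (hs : 0 ≤ s)
    (ξ : 𝔼) : 𝓕⁻ (heatMixture k T s) ξ = heatSymbol s ξ * 𝓕⁻ (heatMixture k T 0) ξ := by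
  rw [fourierInv_heatMixture hk hT hs, fourierInv_heatMixture hk hT le_rfl, heatSymbol_zero_time,
    one_mul]

/-- Since `∫ k = 0`, the kernel `h_s` may be subtracted inside the mixture, leaving the `L¹`
distance between `h_{Tσ+s}` and `h_s`. -/
theorem lintegral_heatMixture_le (hk : IntegrableOn k (Set.Ioi 0))
    (hk0 : ∫ σ in Set.Ioi 0, k σ = 0) (hT : 0 < T) (hs : 0 < s) :
    ∫⁻ x : 𝔼, ‖heatMixture k T s x‖ₑ
      ≤ ∫⁻ σ in Set.Ioi 0, ‖k σ‖ₑ * ENNReal.ofReal (2 * (1 - (s / (T * σ + s)) ^ ((n : ℝ) / 2))) := by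
  have h1 := integrable_mul_heatKernel_prod (n := n) hk hT hs.le
  have e : ∀ᵐ x : 𝔼, heatMixture k T s x
      = ∫ σ in Set.Ioi 0, ((k σ * (heatKernel (T * σ + s) x - heatKernel s x) : ℝ) : ℂ) := by
    filter_upwards [h1.prod_left_ae] with x hx
    have h2 : Integrable (fun σ => ((k σ * heatKernel s x : ℝ) : ℂ))
        (volume.restrict (Set.Ioi 0)) := (hk.mul_const _).ofReal
    simp only [mul_sub, Complex.ofReal_sub]
    rw [integral_sub hx h2]
    have h3 : ∫ σ in Set.Ioi 0, ((k σ * heatKernel s x : ℝ) : ℂ) = 0 := by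
      rw [integral_complex_ofReal, integral_mul_const, hk0]; simp
    rw [h3, sub_zero, heatMixture]
  have hm : Measurable (fun p : 𝔼 × ℝ => heatKernel (T * p.2 + s) p.1 - heatKernel s p.1) :=
    (measurable_heatKernel.comp (f := fun p : 𝔼 × ℝ => (T * p.2 + s, p.1)) (by fun_prop)).sub
      (measurable_heatKernel.comp (f := fun p : 𝔼 × ℝ => (s, p.1)) (by fun_prop))
  calc _ ≤ ∫⁻ x : 𝔼, ∫⁻ σ in Set.Ioi 0,
          ‖k σ‖ₑ * ‖heatKernel (T * σ + s) x - heatKernel s x‖ₑ := by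
        refine lintegral_mono_ae (e.mono fun x hx => ?_)
        rw [hx]
        refine (enorm_integral_le_lintegral_enorm _).trans (le_of_eq ?_)
        refine lintegral_congr fun σ => ?_
        rw [← enorm_mul, ← enorm_norm, Complex.norm_real, enorm_norm]
    _ = ∫⁻ σ in Set.Ioi 0, ∫⁻ x : 𝔼,
          ‖k σ‖ₑ * ‖heatKernel (T * σ + s) x - heatKernel s x‖ₑ :=
        lintegral_lintegral_swap (hk.1.comp_snd.enorm.mul hm.enorm.aemeasurable)
    _ ≤ _ := by
        refine setLIntegral_mono_ae' measurableSet_Ioi (Eventually.of_forall fun σ hσ => ?_)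
        have hσ' : 0 < T * σ := mul_pos hT hσ
        have hi : Integrable (fun x : 𝔼 => heatKernel (T * σ + s) x - heatKernel s x) :=
          (integrable_heatKernel (n := n) (show 0 < T * σ + s by positivity)).sub
          (integrable_heatKernel (n := n) hs)
        rw [lintegral_const_mul' _ _ enorm_ne_top]
        gcongr
        have h4 := integral_abs_heatKernel_sub_le (n := n) hs (show s ≤ T * σ + s by linarith)
        refine le_trans (le_of_eq ?_) (ENNReal.ofReal_le_ofReal h4)
        rw [ofReal_integral_eq_lintegral_ofReal hi.abs
          (Eventually.of_forall fun _ => abs_nonneg _)]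
        refine lintegral_congr fun x => ?_
        rw [Real.enorm_eq_ofReal_abs]

/-- Dominated convergence with majorant `2|k|`, as `s/(Tσ+s) → 1`. This cancellation removes low
frequencies on the `g` side. -/
theorem tendsto_lintegral_heatMixture (hk : IntegrableOn k (Set.Ioi 0))
    (hk0 : ∫ σ in Set.Ioi 0, k σ = 0) (hT : 0 < T) :
    Tendsto (fun s => ∫⁻ x : 𝔼, ‖heatMixture k T s x‖ₑ) atTop (𝓝 0) := by
  have h1 : Tendsto (fun s : ℝ => ∫⁻ σ in Set.Ioi 0,
      ‖k σ‖ₑ * ENNReal.ofReal (2 * (1 - (s / (T * σ + s)) ^ ((n : ℝ) / 2)))) atTop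
      (𝓝 (∫⁻ _ in Set.Ioi (0 : ℝ), 0)) := by
    refine tendsto_lintegral_filter_of_dominated_convergence' (fun σ => ‖k σ‖ₑ * ENNReal.ofReal 2)
      (Eventually.of_forall fun s => ?_) ?_ ?_ ?_
    · refine hk.1.enorm.mul (Measurable.aemeasurable ?_)
      fun_prop
    · filter_upwards [eventually_gt_atTop 0] with s hs
      filter_upwards [ae_restrict_mem measurableSet_Ioi] with σ (hσ : 0 < σ)
      gcongr
      have : 0 ≤ (s / (T * σ + s)) ^ ((n : ℝ) / 2) := by positivity
      linarith
    · rw [lintegral_mul_const'' _ hk.1.enorm]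
      exact ENNReal.mul_ne_top hk.2.ne ENNReal.ofReal_ne_top
    · filter_upwards with σ
      have h2 : Tendsto (fun s : ℝ => s / (T * σ + s)) atTop (𝓝 1) := by
        have h3 : Tendsto (fun s : ℝ => 1 - T * σ / (T * σ + s)) atTop (𝓝 (1 - 0)) :=
          tendsto_const_nhds.sub (tendsto_const_nhds.div_atTop
            (tendsto_atTop_add_const_left _ _ tendsto_id))
        rw [sub_zero] at h3
        refine h3.congr' ?_
        filter_upwards [eventually_gt_atTop (-(T * σ))] with s hs
        have : T * σ + s ≠ 0 := by linarith
        field_simp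
        ring
      have h4 := h2.rpow_const (p := (n : ℝ) / 2) (Or.inl one_ne_zero)
      rw [Real.one_rpow] at h4
      have h5 := ENNReal.tendsto_ofReal ((h4.const_sub 1).const_mul 2)
      have h6 := ENNReal.Tendsto.const_mul (a := ‖k σ‖ₑ) h5 (Or.inr enorm_ne_top)
      simpa using h6
  rw [lintegral_zero] at h1
  refine tendsto_of_tendsto_of_tendsto_of_le_of_le' tendsto_const_nhds h1
    (Eventually.of_forall fun _ => zero_le) ?_
  filter_upwards [eventually_gt_atTop 0] with s hs
  exact lintegral_heatMixture_le hk hk0 hT hs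

theorem lintegral_heatMixture_mul_le {g : 𝔼 → ℂ} (hg : AEStronglyMeasurable g)
    (hk : IntegrableOn k (Set.Ioi 0)) (hT : 0 < T) (x : 𝔼) :
    ∫⁻ y, ‖heatMixture k T 0 (x - y)‖ₑ * ‖g y‖ₑ
      ≤ (∫⁻ σ in Set.Ioi 0, ‖k σ‖ₑ) * maximalFunction g x := by
  have hm : Measurable (fun p : 𝔼 × ℝ => heatKernel (T * p.2) (x - p.1)) :=
    measurable_heatKernel.comp (f := fun p : 𝔼 × ℝ => (T * p.2, x - p.1)) (by fun_prop)
  calc _ ≤ ∫⁻ y, ∫⁻ σ in Set.Ioi 0, ‖k σ‖ₑ * (‖heatKernel (T * σ) (x - y)‖ₑ * ‖g y‖ₑ) := by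
        refine lintegral_mono fun y => ?_
        have h1 : ‖heatMixture k T 0 (x - y)‖ₑ
            ≤ ∫⁻ σ in Set.Ioi 0, ‖k σ‖ₑ * ‖heatKernel (T * σ) (x - y)‖ₑ := by
          refine (enorm_integral_le_lintegral_enorm _).trans (le_of_eq ?_)
          refine lintegral_congr fun σ => ?_
          rw [← enorm_mul, ← enorm_norm, Complex.norm_real, enorm_norm, add_zero]
        refine (mul_le_mul_left h1 _).trans (le_of_eq ?_)
        rw [← lintegral_mul_const' _ _ enorm_ne_top]
        simp only [mul_assoc]
    _ = ∫⁻ σ in Set.Ioi 0, ∫⁻ y, ‖k σ‖ₑ * (‖heatKernel (T * σ) (x - y)‖ₑ * ‖g y‖ₑ) :=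
        lintegral_lintegral_swap (hk.1.comp_snd.enorm.mul
          (hm.enorm.aemeasurable.mul hg.comp_fst.enorm))
    _ ≤ ∫⁻ σ in Set.Ioi 0, ‖k σ‖ₑ * maximalFunction g x := by
        refine setLIntegral_mono_ae' measurableSet_Ioi (Eventually.of_forall fun σ hσ => ?_)
        rw [lintegral_const_mul' _ _ enorm_ne_top]
        gcongr
        exact lintegral_heatKernel_mul_le hg (mul_pos hT hσ) x
    _ = _ := lintegral_mul_const'' _ hk.1.enorm

end HeatMixtures

/-! ### Smooth powers away from the origin, iterated heat differences, and convolution pairings. -/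

noncomputable section CoreIdentity

variable {n : ℕ}

local notation "𝔼" => EuclideanSpace ℝ (Fin n)

/-- A Schwartz function that equals `1` near the origin and has compact support. -/
theorem exists_schwartz_cutoff {ε : ℝ} (hε : 0 < ε) : ∃ χ : 𝓢(𝔼, ℝ), (∀ ξ, 0 ≤ χ ξ) ∧
    (∀ ξ, ‖ξ‖ ≤ ε / 2 → χ ξ = 1) ∧ (∀ ξ, ε ≤ ‖ξ‖ → χ ξ = 0) := by
  let b : ContDiffBump (0 : 𝔼) := ⟨ε / 2, ε, by positivity, by linarith⟩
  refine ⟨b.hasCompactSupport.toSchwartzMap b.contDiff, fun ξ => b.nonneg, fun ξ h => ?_,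
    fun ξ h => ?_⟩
  · exact b.one_of_mem_closedBall (by simpa using h)
  · exact b.zero_of_le_dist (by simpa using h)

/-- Take `c^r (q/c + χ)^r` with `c = (πε)²`. The base is at least `1` everywhere: `χ = 1` for `|ξ| ≤
ε/2`, and `q ≥ c` beyond. For `|ξ| ≥ ε` the cutoff vanishes and the power of `q` is recovered. -/
theorem exists_laplaceSymbol_rpow {ε : ℝ} (hε : 0 < ε) (r : ℝ) : ∃ w : 𝔼 → ℝ,
    w.HasTemperateGrowth ∧ ∀ ξ, ε ≤ ‖ξ‖ → w ξ = laplaceSymbol ξ ^ r := by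
  obtain ⟨χ, h0, h1, h2⟩ := exists_schwartz_cutoff (n := n) hε
  have hc : 0 < (Real.pi * ε) ^ 2 := by positivity
  set c := (Real.pi * ε) ^ 2 with hcdef
  have hχ : (χ : 𝔼 → ℝ).HasTemperateGrowth := χ.hasTemperateGrowth
  refine ⟨fun ξ => c ^ r * (c⁻¹ * laplaceSymbol ξ + χ ξ) ^ r, ?_, fun ξ hξ => ?_⟩
  · refine (Function.HasTemperateGrowth.const _).mul
      (Function.HasTemperateGrowth.rpow_const_of_one_le (by fun_prop) (fun ξ => ?_) r)
    rcases le_total ‖ξ‖ (ε / 2) with h | h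
    · rw [h1 ξ h]
      have := laplaceSymbol_nonneg ξ
      have : 0 ≤ c⁻¹ * laplaceSymbol ξ := by positivity
      linarith
    · have h3 : c ≤ laplaceSymbol ξ := by
        rw [hcdef, laplaceSymbol]
        refine pow_le_pow_left₀ (by positivity) ?_ 2
        nlinarith [Real.pi_pos]
      have h4 : 1 ≤ c⁻¹ * laplaceSymbol ξ := by
        rw [inv_mul_eq_div, le_div_iff₀ hc]; linarith
      linarith [h0 ξ]
  · simp only
    rw [h2 ξ hξ, add_zero, ← Real.mul_rpow hc.le
      (mul_nonneg (inv_nonneg.2 hc.le) (laplaceSymbol_nonneg ξ)), mul_inv_cancel_left₀ hc.ne']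

/-- The symbol of `(1 - e^{TΔ})^M`. -/
def heatDiffSymbol (T : ℝ) (M : ℕ) (ξ : 𝔼) : ℂ := (1 - heatSymbol T ξ) ^ M

theorem heatDiffSymbol_hasTemperateGrowth {T : ℝ} (hT : 0 ≤ T) (M : ℕ) :
    (heatDiffSymbol T M : 𝔼 → ℂ).HasTemperateGrowth := by
  have := heatSymbol_hasTemperateGrowth (E := 𝔼) hT
  show (fun ξ : 𝔼 => (1 - heatSymbol T ξ) ^ M).HasTemperateGrowth
  fun_prop

theorem heatSymbol_pow (T : ℝ) (j : ℕ) (ξ : 𝔼) : heatSymbol T ξ ^ j = heatSymbol (j * T) ξ := by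
  rw [heatSymbol, heatSymbol, ← Complex.ofReal_pow, ← Real.exp_nat_mul]
  ring_nf

theorem heatDiffSymbol_eq_sum (T : ℝ) (M : ℕ) (ξ : 𝔼) : heatDiffSymbol T M ξ
    = ∑ j ∈ Finset.range (M + 1), (-1 : ℂ) ^ j * (M.choose j) * heatSymbol (j * T) ξ := by
  rw [heatDiffSymbol, sub_eq_neg_add, add_pow]
  refine Finset.sum_congr rfl fun j _ => ?_
  rw [neg_pow, heatSymbol_pow]
  ring

theorem fourier_heatDiffSymbol_eq_sum {T : ℝ} (hT : 0 ≤ T) (M : ℕ) (f : 𝓢'(𝔼, ℂ)) (η : 𝓢(𝔼, ℂ)) :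
    f (𝓕 (symbolMul (heatDiffSymbol T M) η)) = ∑ j ∈ Finset.range (M + 1),
      (-1 : ℂ) ^ j * (M.choose j) * f (𝓕 (symbolMul (heatSymbol (j * T)) η)) := by
  have e : symbolMul (heatDiffSymbol T M) η = ∑ j ∈ Finset.range (M + 1),
      ((-1 : ℂ) ^ j * (M.choose j)) • symbolMul (heatSymbol (j * T)) η := by
    ext ξ
    rw [symbolMul_apply (heatDiffSymbol_hasTemperateGrowth hT M), heatDiffSymbol_eq_sum,
      Finset.sum_mul, _root_.sum_apply]
    refine Finset.sum_congr rfl fun j _ => ?_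
    rw [_root_.smul_apply, symbolMul_apply (heatSymbol_hasTemperateGrowth (by positivity)),
      smul_eq_mul]
    ring
  have h := map_sum (fourierFunctional f) (fun j : ℕ => ((-1 : ℂ) ^ j * (M.choose j)) •
    symbolMul (heatSymbol (j * T)) η) (Finset.range (M + 1))
  rw [← e] at h
  refine h.trans (Finset.sum_congr rfl fun j _ => ?_)
  rw [map_smul, smul_eq_mul]
  rfl

/-- Reproducing kernel data: the Laplace transform of `k` is `(1 - e⁻ᵘ) ^ M u⁻ᵃ`. -/
structure IsDiffLaplaceKernel (a : ℝ) (M : ℕ) (k : ℝ → ℝ) : Prop where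
  integrableOn : IntegrableOn k (Set.Ioi 0)
  laplace_eq : ∀ u, 0 < u → ∫ s in Set.Ioi 0, k s * Real.exp (-(u * s))
    = (1 - Real.exp (-u)) ^ M * u ^ (-a)
  integral_eq_zero : ∫ s in Set.Ioi 0, k s = 0

/-- The pairing `∫ g (K * φ)`. -/
def convPairing (g K φ : 𝔼 → ℂ) : ℂ := ∫ x, g x * ∫ y, K y * φ (x - y)

theorem enorm_convPairing_le {g K φ : 𝔼 → ℂ} (hg : AEStronglyMeasurable g)
    (hK : AEStronglyMeasurable K) (hφ : Continuous φ) :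
    ‖convPairing g K φ‖ₑ ≤ (∫⁻ y, ‖K y‖ₑ) * transSup g φ := by
  refine (enorm_integral_le_lintegral_enorm _).trans ?_
  refine le_trans (lintegral_mono fun x => ?_) (lintegral_mul_convolution_le hg hK hφ 0)
  rw [enorm_mul]
  gcongr
  refine (enorm_integral_le_lintegral_enorm _).trans (le_of_eq ?_)
  simp [enorm_mul]

theorem aestronglyMeasurable_convolution {K φ : 𝔼 → ℂ} (hK : AEStronglyMeasurable K)
    (hφ : Continuous φ) : AEStronglyMeasurable (fun x => ∫ y, K y * φ (x - y)) := by
  have hc : Continuous (fun p : 𝔼 × 𝔼 => φ (p.1 - p.2)) := by fun_prop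
  exact AEStronglyMeasurable.integral_prod_right' (hK.comp_snd.mul hc.aestronglyMeasurable)

theorem integrable_mul_convolution {g K φ : 𝔼 → ℂ} (hg : AEStronglyMeasurable g)
    (hK : Integrable K) (hφ : Continuous φ) (h : transSup g φ < ∞) :
    Integrable (fun x => g x * ∫ y, K y * φ (x - y)) := by
  refine ⟨hg.mul (aestronglyMeasurable_convolution hK.1 hφ), ?_⟩
  refine lt_of_le_of_lt ?_ (ENNReal.mul_lt_top hK.2 h)
  refine le_trans (lintegral_mono fun x => ?_) (lintegral_mul_convolution_le hg hK.1 hφ 0)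
  rw [enorm_mul]
  gcongr
  refine (enorm_integral_le_lintegral_enorm _).trans (le_of_eq ?_)
  simp [enorm_mul]

theorem convPairing_fourier_sub {p : ℝ≥0∞} (hp : 1 ≤ p) {g K : 𝔼 → ℂ} (hg : MemLp g p)
    (hK : Integrable K) (η₁ η₂ : 𝓢(𝔼, ℂ)) :
    convPairing g K (𝓕 (η₁ - η₂) : 𝓢(𝔼, ℂ))
      = convPairing g K (𝓕 η₁ : 𝓢(𝔼, ℂ)) - convPairing g K (𝓕 η₂ : 𝓢(𝔼, ℂ)) := by
  have hi (η : 𝓢(𝔼, ℂ)) : Integrable (fun x => g x * ∫ y, K y * (𝓕 η : 𝓢(𝔼, ℂ)) (x - y)) :=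
    integrable_mul_convolution hg.1 hK (𝓕 η).continuous (transSup_lt_top hp hg _)
  have hi' (η : 𝓢(𝔼, ℂ)) (x : 𝔼) : Integrable (fun y => K y * (𝓕 η : 𝓢(𝔼, ℂ)) (x - y)) := by
    obtain ⟨C, hC⟩ := (𝓕 η : 𝓢(𝔼, ℂ)).decay 0 0
    refine hK.mul_bdd (c := C) ?_ (Eventually.of_forall fun y => ?_)
    · exact ((𝓕 η).continuous.comp (by fun_prop)).aestronglyMeasurable
    · simpa using hC.2 (x - y)
  rw [convPairing, convPairing, convPairing, ← integral_sub (hi η₁) (hi η₂)]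
  refine integral_congr_ae (Eventually.of_forall fun x => ?_)
  simp only
  rw [← mul_sub, ← integral_sub (hi' _ x) (hi' _ x)]
  congr 1
  refine integral_congr_ae (Eventually.of_forall fun y => ?_)
  simp only
  have e : 𝓕 (η₁ - η₂) = 𝓕 η₁ - 𝓕 η₂ := map_sub (FourierTransform.fourierCLM ℂ 𝓢(𝔼, ℂ)) η₁ η₂
  rw [e, _root_.sub_apply, mul_sub]

end CoreIdentity

/-! ### The identity `(1 - e^{TΔ})^M f = T^{α/2} A_T * g`. -/

noncomputable section CoreIdentity

variable {n : ℕ}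

local notation "𝔼" => EuclideanSpace ℝ (Fin n)

theorem fourier_eq_convolution {K : 𝔼 → ℂ} (hK : Integrable K) {η ζ : 𝓢(𝔼, ℂ)}
    (h : ∀ ξ, ζ ξ = 𝓕⁻ K ξ * η ξ) (x : 𝔼) :
    𝓕 ζ x = ∫ y, K y * 𝓕 η (x - y) := by
  rw [SchwartzMap.fourier_coe, SchwartzMap.fourier_coe, ← fourier_fourierInv_mul hK η.integrable]
  exact congrFun (congrArg (𝓕 : (𝔼 → ℂ) → 𝔼 → ℂ) (funext h)) x

theorem fourier_fourier_apply (ζ : 𝓢(𝔼, ℂ)) (ξ : 𝔼) : 𝓕 (𝓕 ζ) ξ = ζ (-ξ) := by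
  have h : 𝓕⁻ (𝓕 ζ) (-ξ) = ζ (-ξ) := by rw [FourierTransform.fourierInv_fourier_eq]
  rw [← h, SchwartzMap.fourier_coe, SchwartzMap.fourierInv_coe,
    Real.fourierInv_eq_fourier_neg, neg_neg]

variable {α : ℝ} {M : ℕ} {k : ℝ → ℝ} {T : ℝ}

theorem fourierInv_heatMixture_of_ne_zero (hk : IsDiffLaplaceKernel (α / 2) M k) (hT : 0 < T)
    {ξ : 𝔼} (hξ : ξ ≠ 0) :
    𝓕⁻ (heatMixture k T 0) ξ
      = heatDiffSymbol T M ξ * ((T ^ (-(α / 2)) * laplaceSymbol ξ ^ (-(α / 2)) : ℝ) : ℂ) := by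
  have hq : 0 < laplaceSymbol ξ := by
    have := norm_pos_iff.2 hξ
    unfold laplaceSymbol; positivity
  rw [fourierInv_heatMixture hk.integrableOn hT le_rfl, hk.laplace_eq _ (mul_pos hT hq),
    heatSymbol_zero_time, one_mul, Real.mul_rpow hT.le hq.le, heatDiffSymbol, heatSymbol,
    Complex.ofReal_mul, neg_mul]
  push_cast
  ring

/-- The core identity for test functions supported away from the origin. -/
theorem apply_heatDiffSymbol_eq_of_eventually_eq_zero {f G : 𝓢'(𝔼, ℂ)} {g : 𝔼 → ℂ}
    (hfG : IsFracLaplacian α f G) (hG : RepresentedBy G g)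
    (hk : IsDiffLaplaceKernel (α / 2) M k) (hT : 0 < T) {η : 𝓢(𝔼, ℂ)} {ε : ℝ} (hε : 0 < ε)
    (hη : ∀ ξ, ‖ξ‖ < ε → η ξ = 0) :
    f (𝓕 (symbolMul (heatDiffSymbol T M) η))
      = ((T ^ (α / 2) : ℝ) : ℂ) * convPairing g (heatMixture k T 0) (𝓕 η : 𝓢(𝔼, ℂ)) := by
  obtain ⟨w, hw, hwe⟩ := exists_laplaceSymbol_rpow (n := n) hε (-(α / 2))
  have hD := heatDiffSymbol_hasTemperateGrowth (n := n) hT.le M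
  have hm : (fun ξ : 𝔼 => heatDiffSymbol T M ξ * ((T ^ (-(α / 2)) * w ξ : ℝ) : ℂ)).HasTemperateGrowth := by
    fun_prop
  -- `ζ` is the symbol of `A_T` times `η`. It is a Schwartz function because `w` replaces `q^{-α/2}`
  -- by a symbol smooth at the origin, where `η` vanishes anyway.
  set ζ : 𝓢(𝔼, ℂ) := symbolMul (fun ξ => heatDiffSymbol T M ξ * ((T ^ (-(α / 2)) * w ξ : ℝ) : ℂ)) η
    with hζ
  have hζ0 {ξ : 𝔼} (h : ‖ξ‖ < ε) : ζ ξ = 0 := by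
    rw [hζ, symbolMul_apply hm, hη ξ h, mul_zero]
  have hζK (ξ : 𝔼) : ζ ξ = 𝓕⁻ (heatMixture k T 0) ξ * η ξ := by
    rcases lt_or_ge ‖ξ‖ ε with h | h
    · rw [hζ0 h, hη ξ h, mul_zero]
    · rw [fourierInv_heatMixture_of_ne_zero hk hT (norm_pos_iff.1 (hε.trans_le h)), hζ,
        symbolMul_apply hm, hwe ξ h]
  have hζD (ξ : 𝔼) : (((2 * Real.pi * ‖ξ‖) ^ α : ℝ) : ℂ) * ζ ξ
      = ((T ^ (-(α / 2)) : ℝ) : ℂ) * symbolMul (heatDiffSymbol T M) η ξ := by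
    rw [symbolMul_apply hD]
    rcases lt_or_ge ‖ξ‖ ε with h | h
    · rw [hζ0 h, hη ξ h]; simp
    · have h0 : 0 < 2 * Real.pi * ‖ξ‖ := by
        have := hε.trans_le h
        positivity
      have h1 : (2 * Real.pi * ‖ξ‖) ^ α * w ξ = 1 := by
        rw [hwe ξ h, laplaceSymbol, ← Real.rpow_natCast, ← Real.rpow_mul h0.le,
          ← Real.rpow_add h0]
        have : α + ((2 : ℕ) : ℝ) * -(α / 2) = 0 := by push_cast; ring
        rw [this, Real.rpow_zero]
      rw [hζ, symbolMul_apply hm]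
      have h2 : (((2 * Real.pi * ‖ξ‖) ^ α : ℝ) : ℂ) * (w ξ : ℂ) = 1 := by
        rw [← Complex.ofReal_mul, h1, Complex.ofReal_one]
      rw [Complex.ofReal_mul]
      linear_combination (((T ^ (-(α / 2)) : ℝ) : ℂ) * (heatDiffSymbol T M ξ * η ξ)) * h2
  -- The test function for `g` is `𝓕 ζ`, whose Fourier transform `ζ(-ξ)` vanishes near `0`;
  -- multiplication by `(2π|ξ|)^α` cancels `w`.
  have h1 := hfG (𝓕 ζ) (𝓕 (((T ^ (-(α / 2)) : ℝ) : ℂ) • symbolMul (heatDiffSymbol T M) η)) ?_ ?_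
  · rw [(hG _).2, FourierTransform.fourier_smul, map_smul, smul_eq_mul] at h1
    have h2 : convPairing g (heatMixture k T 0) (𝓕 η : 𝓢(𝔼, ℂ)) = ∫ x, 𝓕 ζ x * g x := by
      rw [convPairing]
      refine integral_congr_ae (Eventually.of_forall fun x => ?_)
      simp only
      rw [← fourier_eq_convolution (integrable_heatMixture hk.integrableOn hT le_rfl) hζK, mul_comm]
    rw [h2, h1, ← mul_assoc, ← Complex.ofReal_mul, ← Real.rpow_add hT]
    simp
  · have : ∀ᶠ ξ : 𝔼 in 𝓝 0, ‖-ξ‖ < ε := by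
      filter_upwards [Metric.ball_mem_nhds (0 : 𝔼) hε] with ξ hξ
      simpa using hξ
    filter_upwards [this] with ξ hξ
    rw [fourier_fourier_apply, hζ0 hξ]
  · intro ξ
    rw [fourier_fourier_apply, fourier_fourier_apply, _root_.smul_apply, smul_eq_mul, ← hζD,
      norm_neg]

/-- A cutoff and its quotient by the Gaussian symbol. -/
theorem exists_cutoff_eq_heatSymbol_mul : ∃ χ κ : 𝓢(𝔼, ℂ),
    (∀ ξ, ‖ξ‖ ≤ 1 / 2 → χ ξ = 1) ∧ ∀ ξ, χ ξ = heatSymbol 1 ξ * κ ξ := by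
  let b : ContDiffBump (0 : 𝔼) := ⟨1 / 2, 1, by positivity, by norm_num⟩
  have hq := laplaceSymbol_hasTemperateGrowth (E := 𝔼)
  have hc : HasCompactSupport (fun x => ((b x : ℝ) : ℂ)) :=
    b.hasCompactSupport.comp_left (g := fun r : ℝ => (r : ℂ)) (by simp)
  have hd : ContDiff ℝ (⊤ : ℕ∞) (fun x => ((b x : ℝ) : ℂ)) :=
    Complex.ofRealCLM.contDiff.comp b.contDiff
  have hc' : HasCompactSupport (fun x => ((Real.exp (laplaceSymbol x) : ℝ) : ℂ) * ((b x : ℝ) : ℂ)) :=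
    hc.mul_left
  have hd' : ContDiff ℝ (⊤ : ℕ∞)
      (fun x => ((Real.exp (laplaceSymbol x) : ℝ) : ℂ) * ((b x : ℝ) : ℂ)) :=
    (Complex.ofRealCLM.contDiff.comp (Real.contDiff_exp.comp hq.1)).mul hd
  refine ⟨hc.toSchwartzMap hd, hc'.toSchwartzMap hd', fun ξ h => ?_, fun ξ => ?_⟩
  · show ((b ξ : ℝ) : ℂ) = 1
    rw [b.one_of_mem_closedBall (mem_closedBall_zero_iff.2 h), Complex.ofReal_one]
  · show ((b ξ : ℝ) : ℂ) = heatSymbol 1 ξ *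
      (((Real.exp (laplaceSymbol ξ) : ℝ) : ℂ) * ((b ξ : ℝ) : ℂ))
    rw [heatSymbol, ← mul_assoc, ← Complex.ofReal_mul, ← Real.exp_add]
    simp

theorem heatSymbol_one_smul (r : ℝ) (ξ : 𝔼) : heatSymbol 1 (r • ξ) = heatSymbol (r ^ 2) ξ := by
  rw [heatSymbol, heatSymbol, laplaceSymbol, laplaceSymbol, norm_smul, Real.norm_eq_abs]
  congr 2
  calc _ = -(|r| ^ 2 * (2 * Real.pi * ‖ξ‖) ^ 2) := by ring
    _ = _ := by rw [sq_abs]; ring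

/-- Low frequencies of `f`: after binomial expansion each term contains `e^{(jT + r²)Δ}`, so the
Besov norm gives decay `r^{-β}`, the remaining dilated symbol being uniformly bounded on `L¹`. -/
theorem tendsto_apply_heatDiffSymbol_dilation {β : ℝ} (hβ : 0 < β) {f : 𝓢'(𝔼, ℂ)}
    (hf : besovNorm β f < ∞) (hT : 0 ≤ T) (M : ℕ) (κ η : 𝓢(𝔼, ℂ)) :
    Tendsto (fun r : ℝ => f (𝓕 (symbolMul (heatDiffSymbol T M)
      (symbolMul (heatSymbol (r ^ 2)) (symbolMul (fun ξ => κ (r • ξ)) η))))) atTop (𝓝 0) := by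
  have key (j : ℕ) : Tendsto (fun r : ℝ => f (𝓕 (symbolMul (heatSymbol (j * T))
      (symbolMul (heatSymbol (r ^ 2)) (symbolMul (fun ξ => κ (r • ξ)) η))))) atTop (𝓝 0) := by
    rw [tendsto_zero_iff_enorm_tendsto_zero]
    have h1 : Tendsto (fun r : ℝ => ENNReal.ofReal ((r ^ 2) ^ (-(β / 2))) *
        (besovNorm β f * ((∫⁻ y, ‖𝓕 κ y‖ₑ) * ∫⁻ x, ‖𝓕 η x‖ₑ))) atTop (𝓝 0) := by
      have h2 : Tendsto (fun r : ℝ => (r ^ 2) ^ (-(β / 2))) atTop (𝓝 0) :=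
        (tendsto_rpow_neg_atTop (by positivity)).comp (tendsto_pow_atTop two_ne_zero)
      have h3 := ENNReal.tendsto_ofReal h2
      rw [ENNReal.ofReal_zero] at h3
      have h4 := ENNReal.Tendsto.mul_const h3 (b := besovNorm β f *
        ((∫⁻ y, ‖𝓕 κ y‖ₑ) * ∫⁻ x, ‖𝓕 η x‖ₑ)) (Or.inr (ENNReal.mul_ne_top hf.ne
          (ENNReal.mul_lt_top (𝓕 κ).integrable.2 (𝓕 η).integrable.2).ne))
      rwa [zero_mul] at h4
    refine tendsto_of_tendsto_of_tendsto_of_le_of_le' tendsto_const_nhds h1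
      (Eventually.of_forall fun _ => zero_le) ?_
    filter_upwards [eventually_gt_atTop 0] with r hr
    have hr2 : 0 < r ^ 2 := by positivity
    have hjT : 0 ≤ j * T := by positivity
    have e : symbolMul (heatSymbol (j * T))
        (symbolMul (heatSymbol (r ^ 2)) (symbolMul (fun ξ => κ (r • ξ)) η))
        = symbolMul (heatSymbol (j * T + r ^ 2)) (symbolMul (fun ξ => κ (r • ξ)) η) := by
      ext ξ
      rw [symbolMul_apply (heatSymbol_hasTemperateGrowth hjT),
        symbolMul_apply (heatSymbol_hasTemperateGrowth hr2.le),
        symbolMul_apply (heatSymbol_hasTemperateGrowth (by positivity)), heatSymbol_add, mul_assoc]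
    rw [e]
    refine (enorm_apply_heatSymbol_le hf (show 0 < j * T + r ^ 2 by positivity) _).trans ?_
    rw [mul_assoc]
    gcongr ?_ * (_ * ?_)
    · refine ENNReal.ofReal_le_ofReal
        (Real.rpow_le_rpow_of_nonpos hr2 (by linarith) (by linarith))
    · exact lintegral_fourier_dilation_le κ η hr
  have h := tendsto_finsetSum (Finset.range (M + 1)) fun j _ =>
    (key j).const_mul ((-1 : ℂ) ^ j * (M.choose j))
  simp only [mul_zero, Finset.sum_const_zero] at h
  refine h.congr fun r => ?_
  rw [fourier_heatDiffSymbol_eq_sum hT]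

/-- Low frequencies of `g`: the factor `e^{-r²q}` is moved onto the mixture, where it becomes the
shift `s = r²`, and the `L¹` norm of the shifted mixture tends to `0`. -/
theorem tendsto_convPairing_dilation {p : ℝ≥0∞} (hp : 1 ≤ p) {g : 𝔼 → ℂ} (hg : MemLp g p)
    (hk : IsDiffLaplaceKernel (α / 2) M k) (hT : 0 < T) (κ η : 𝓢(𝔼, ℂ)) :
    Tendsto (fun r : ℝ => convPairing g (heatMixture k T 0)
      (𝓕 (symbolMul (heatSymbol (r ^ 2)) (symbolMul (fun ξ => κ (r • ξ)) η)) : 𝓢(𝔼, ℂ)))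
      atTop (𝓝 0) := by
  rw [tendsto_zero_iff_enorm_tendsto_zero]
  have h1 : Tendsto (fun r : ℝ => (∫⁻ x : 𝔼, ‖heatMixture k T (r ^ 2) x‖ₑ) *
      ((∫⁻ y, ‖𝓕 κ y‖ₑ) * transSup g (𝓕 η : 𝓢(𝔼, ℂ)))) atTop (𝓝 0) := by
    have h2 := (tendsto_lintegral_heatMixture (n := n) hk.integrableOn hk.integral_eq_zero hT).comp
      (tendsto_pow_atTop (α := ℝ) two_ne_zero)
    have h4 := ENNReal.Tendsto.mul_const h2 (b := (∫⁻ y, ‖𝓕 κ y‖ₑ) * transSup g (𝓕 η : 𝓢(𝔼, ℂ)))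
      (Or.inr (ENNReal.mul_lt_top (𝓕 κ).integrable.2 (transSup_lt_top hp hg _)).ne)
    rwa [zero_mul] at h4
  refine tendsto_of_tendsto_of_tendsto_of_le_of_le' tendsto_const_nhds h1
    (Eventually.of_forall fun _ => zero_le) ?_
  filter_upwards [eventually_gt_atTop 0] with r hr
  have hr2 : 0 < r ^ 2 := by positivity
  set η' : 𝓢(𝔼, ℂ) := symbolMul (fun ξ => κ (r • ξ)) η
  have hA := integrable_heatMixture (n := n) hk.integrableOn hT le_rfl
  have hA' := integrable_heatMixture (n := n) hk.integrableOn hT hr2.le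
  have e : convPairing g (heatMixture k T 0) (𝓕 (symbolMul (heatSymbol (r ^ 2)) η') : 𝓢(𝔼, ℂ))
      = convPairing g (heatMixture k T (r ^ 2)) (𝓕 η' : 𝓢(𝔼, ℂ)) := by
    refine integral_congr_ae (Eventually.of_forall fun x => ?_)
    simp only
    congr 1
    simp only [SchwartzMap.fourier_coe]
    rw [← fourier_fourierInv_mul hA (SchwartzMap.integrable _),
      ← fourier_fourierInv_mul hA' (SchwartzMap.integrable _)]
    refine congrFun (congrArg (𝓕 : (𝔼 → ℂ) → 𝔼 → ℂ) (funext fun ξ => ?_)) x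
    rw [fourierInv_heatMixture_eq_mul hk.integrableOn hT hr2.le,
      symbolMul_apply (heatSymbol_hasTemperateGrowth hr2.le)]
    ring
  rw [e]
  refine (enorm_convPairing_le hg.1 hA'.1 (𝓕 η').continuous).trans ?_
  gcongr
  exact transSup_fourier_dilation_le hg.1 κ η hr

/-- `(1 - e^{TΔ})^M f = T^{α/2} A_T * g`, where `A_T` is a mixture of heat kernels. -/
theorem apply_heatDiffSymbol_eq {β : ℝ} (hβ : 0 < β) {p : ℝ≥0∞} (hp : 1 ≤ p)
    {f G : 𝓢'(𝔼, ℂ)} {g : 𝔼 → ℂ} (hf : besovNorm β f < ∞)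
    (hfG : IsFracLaplacian α f G) (hG : RepresentedBy G g) (hg : MemLp g p)
    (hk : IsDiffLaplaceKernel (α / 2) M k) (hT : 0 < T) (η : 𝓢(𝔼, ℂ)) :
    f (𝓕 (symbolMul (heatDiffSymbol T M) η))
      = ((T ^ (α / 2) : ℝ) : ℂ) * convPairing g (heatMixture k T 0) (𝓕 η : 𝓢(𝔼, ℂ)) := by
  obtain ⟨χ, κ, hχ, hχκ⟩ := exists_cutoff_eq_heatSymbol_mul (n := n)
  have hA := integrable_heatMixture (n := n) hk.integrableOn hT le_rfl
  have h1 := (tendsto_apply_heatDiffSymbol_dilation hβ hf hT.le M κ η).sub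
    ((tendsto_convPairing_dilation hp hg hk hT κ η).const_mul ((T ^ (α / 2) : ℝ) : ℂ))
  rw [mul_zero, sub_zero] at h1
  rw [← sub_eq_zero]
  refine tendsto_nhds_unique_of_eventuallyEq tendsto_const_nhds h1 ?_
  filter_upwards [eventually_gt_atTop 0] with r hr
  have hr2 : 0 < r ^ 2 := by positivity
  -- Since `χ = e^{-q} κ`, the function `η'` is `χ(rξ) η`, so `η - η'` vanishes for `|ξ| < 1/(2r)`
  -- and the identity is already known for it.
  set η' : 𝓢(𝔼, ℂ) := symbolMul (heatSymbol (r ^ 2)) (symbolMul (fun ξ => κ (r • ξ)) η) with hη'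
  have h2 := apply_heatDiffSymbol_eq_of_eventually_eq_zero hfG hG hk hT (η := η - η')
    (ε := 1 / (2 * r)) (by positivity) fun ξ hξ => ?_
  · rw [convPairing_fourier_sub hp hg hA] at h2
    have h3 : f (𝓕 (symbolMul (heatDiffSymbol T M) (η - η')))
        = f (𝓕 (symbolMul (heatDiffSymbol T M) η)) - f (𝓕 (symbolMul (heatDiffSymbol T M) η')) :=
      map_sub (fourierFunctional f ∘L SchwartzMap.smulLeftCLM ℂ (heatDiffSymbol T M)) η η'
    rw [h3] at h2
    linear_combination h2
  · have h4 : ‖r • ξ‖ ≤ 1 / 2 := by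
      rw [norm_smul, Real.norm_of_nonneg hr.le]
      rw [lt_div_iff₀ (by positivity)] at hξ
      linarith
    have h5 := hχκ (r • ξ)
    rw [hχ _ h4, heatSymbol_one_smul] at h5
    rw [_root_.sub_apply, hη', symbolMul_apply (heatSymbol_hasTemperateGrowth hr2.le),
      symbolMul_apply (hasTemperateGrowth_dilation κ r), ← mul_assoc, ← h5, one_mul, sub_self]

end CoreIdentity

/-! ### The pointwise inequality and the norm inequality. -/

noncomputable section Hedberg

variable {n : ℕ}

local notation "𝔼" => EuclideanSpace ℝ (Fin n)

/-- Fubini and the evenness of `K` move the convolution from `φ` to `g`, so that `K * g` appears as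
a function. -/
theorem convPairing_eq_integral {g K φ : 𝔼 → ℂ} (hg : AEStronglyMeasurable g) (hK : Integrable K)
    (hKn : ∀ x, K (-x) = K x) (hφ : Continuous φ) (h : transSup g φ < ∞) :
    Integrable (fun z => φ z * ∫ x, K (z - x) * g x) ∧
      convPairing g K φ = ∫ z, φ z * ∫ x, K (z - x) * g x := by
  have hK' : AEStronglyMeasurable (fun p : 𝔼 × 𝔼 => K (p.1 - p.2)) (volume.prod volume) :=
    hK.1.comp_quasiMeasurePreserving
      (quasiMeasurePreserving_sub_of_right_invariant volume volume)
  have hc : Continuous (fun p : 𝔼 × 𝔼 => φ p.2) := by fun_prop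
  have hm : AEStronglyMeasurable (fun p : 𝔼 × 𝔼 => g p.1 * (K (p.1 - p.2) * φ p.2))
      (volume.prod volume) := hg.comp_fst.mul (hK'.mul hc.aestronglyMeasurable)
  have hi : Integrable (fun p : 𝔼 × 𝔼 => g p.1 * (K (p.1 - p.2) * φ p.2))
      (volume.prod volume) := by
    refine ⟨hm, lt_of_le_of_lt ?_ (ENNReal.mul_lt_top hK.2 h)⟩
    rw [lintegral_prod _ hm.enorm]
    refine le_trans (le_of_eq (lintegral_congr fun x => ?_))
      (lintegral_mul_convolution_le hg hK.1 hφ 0)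
    simp only [enorm_mul, sub_zero]
    rw [lintegral_const_mul' _ _ enorm_ne_top,
      ← lintegral_sub_left_eq_self (fun y => ‖K y‖ₑ * ‖φ (x - y)‖ₑ) x]
    simp only [sub_sub_cancel]
  have e (z : 𝔼) : φ z * ∫ x, K (z - x) * g x = ∫ x, g x * (K (x - z) * φ z) := by
    rw [← integral_const_mul]
    refine integral_congr_ae (Eventually.of_forall fun x => ?_)
    simp only
    rw [← hKn (x - z), neg_sub]
    ring
  simp only [e]
  refine ⟨hi.integral_prod_right, ?_⟩
  rw [← integral_integral_swap hi, convPairing]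
  refine integral_congr_ae (Eventually.of_forall fun x => ?_)
  simp only
  rw [integral_const_mul, ← integral_sub_left_eq_self (fun y => K y * φ (x - y)) volume x]
  simp only [sub_sub_cancel]

variable {α : ℝ} {M : ℕ} {k : ℝ → ℝ} {T : ℝ}

/-- The split at scale `T`: solve the binomial expansion of `(1 - e^{TΔ})^M f` for its `j = 0` term,
which is `f`. The terms `e^{jTΔ} f` with `j ≥ 1` are bounded functions, and the left side is
`T^{α/2} A_T * g`. -/
theorem exists_representedBy_enorm_le {β : ℝ} (hβ : 0 < β) {p : ℝ≥0∞} (hp : 1 ≤ p)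
    {f G : 𝓢'(𝔼, ℂ)} {g : 𝔼 → ℂ} (hf : besovNorm β f < ∞)
    (hfG : IsFracLaplacian α f G) (hG : RepresentedBy G g) (hg : MemLp g p)
    (hk : IsDiffLaplaceKernel (α / 2) M k) (hT : 0 < T) :
    ∃ F : 𝔼 → ℂ, RepresentedBy f F ∧ ∀ᵐ x, ‖F x‖ₑ ≤
      2 ^ M * (ENNReal.ofReal (T ^ (-(β / 2))) * besovNorm β f)
      + ENNReal.ofReal (T ^ (α / 2)) * ((∫⁻ σ in Set.Ioi 0, ‖k σ‖ₑ) * maximalFunction g x) := by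
  have hjT (j : ℕ) : 0 < ((j + 1 : ℕ) : ℝ) * T := by positivity
  choose F hF hFb using fun j : ℕ => exists_representedBy_heat hf (hjT j)
  set H : 𝔼 → ℂ := fun z => ∫ x, heatMixture k T 0 (z - x) * g x with hH
  -- The index is shifted: `j` stands for the term `e^{(j+1)TΔ}` of the expansion.
  set c : ℕ → ℂ := fun j => (-1 : ℂ) ^ (j + 1) * (M.choose (j + 1)) with hc
  refine ⟨fun x => ((T ^ (α / 2) : ℝ) : ℂ) * H x - ∑ j ∈ Finset.range M, c j * F j x, fun φ => ?_, ?_⟩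
  · obtain ⟨η, rfl⟩ : ∃ η : 𝓢(𝔼, ℂ), φ = 𝓕 η :=
      ⟨𝓕⁻ φ, (FourierTransform.fourier_fourierInv_eq φ).symm⟩
    have hA := integrable_heatMixture (n := n) hk.integrableOn hT le_rfl
    obtain ⟨h1, h2⟩ := convPairing_eq_integral hg.1 hA (fun x => heatMixture_neg x)
      (𝓕 η).continuous (transSup_lt_top hp hg _)
    have h3 := apply_heatDiffSymbol_eq hβ hp hf hfG hG hg hk hT η
    rw [fourier_heatDiffSymbol_eq_sum hT.le, Finset.sum_range_succ'] at h3
    have e0 : symbolMul (heatSymbol (((0 : ℕ) : ℝ) * T)) η = η := by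
      ext ξ
      rw [symbolMul_apply (heatSymbol_hasTemperateGrowth (by simp))]
      simp [heatSymbol_zero_time]
    have e (x : 𝔼) : 𝓕 η x * (((T ^ (α / 2) : ℝ) : ℂ) * H x - ∑ j ∈ Finset.range M, c j * F j x)
        = ((T ^ (α / 2) : ℝ) : ℂ) * (𝓕 η x * H x)
          - ∑ j ∈ Finset.range M, c j * (𝓕 η x * F j x) := by
      rw [mul_sub, Finset.mul_sum, mul_left_comm]
      congr 1
      exact Finset.sum_congr rfl fun j _ => mul_left_comm _ _ _
    have i1 : Integrable (fun x => ((T ^ (α / 2) : ℝ) : ℂ) * (𝓕 η x * H x)) := h1.const_mul _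
    have i2 (j : ℕ) : Integrable (fun x => c j * (𝓕 η x * F j x)) :=
      ((hF j (𝓕 η)).1).const_mul _
    have i3 : Integrable (fun x => ∑ j ∈ Finset.range M, c j * (𝓕 η x * F j x)) :=
      integrable_finsetSum _ fun j _ => i2 j
    simp only [e]
    refine ⟨i1.sub i3, ?_⟩
    rw [integral_sub i1 i3, integral_const_mul, ← h2, ← h3, integral_finsetSum _ fun j _ => i2 j,
      e0]
    have e1 : ∑ j ∈ Finset.range M, ∫ x, c j * (𝓕 η x * F j x) = ∑ j ∈ Finset.range M,
        (-1 : ℂ) ^ (j + 1) * (M.choose (j + 1))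
          * f (𝓕 (symbolMul (heatSymbol (((j + 1 : ℕ) : ℝ) * T)) η)) := by
      refine Finset.sum_congr rfl fun j _ => ?_
      rw [integral_const_mul, ← (hF j (𝓕 η)).2, heat_apply_fourier]
    rw [e1]
    simp
  · have hb : ∀ᵐ x, ∀ j, ‖F j x‖ₑ ≤ ENNReal.ofReal (T ^ (-(β / 2))) * besovNorm β f := by
      refine ae_all_iff.2 fun j => ?_
      filter_upwards [ae_le_eLpNormEssSup (f := F j) (μ := volume)] with x hx
      rw [← eLpNorm_exponent_top] at hx
      refine (hx.trans (hFb j)).trans ?_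
      gcongr ENNReal.ofReal ?_ * _
      refine Real.rpow_le_rpow_of_nonpos hT ?_ (by linarith)
      refine le_mul_of_one_le_left hT.le ?_
      push_cast
      linarith [(Nat.cast_nonneg j : (0 : ℝ) ≤ j)]
    filter_upwards [hb] with x hx
    refine (enorm_sub_le).trans ?_
    rw [add_comm]
    gcongr
    · have h1 (j : ℕ) : ‖c j * F j x‖ₑ
          ≤ (M.choose (j + 1)) * (ENNReal.ofReal (T ^ (-(β / 2))) * besovNorm β f) := by
        have : ‖c j‖ₑ = (M.choose (j + 1) : ℝ≥0∞) := by
          rw [← ofReal_norm, hc]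
          simp
        rw [enorm_mul, this]
        gcongr
        exact hx j
      refine (enorm_sum_le _ _).trans ((Finset.sum_le_sum fun j _ => h1 j).trans ?_)
      rw [← Finset.sum_mul]
      gcongr
      have h2 := Nat.sum_range_choose M
      rw [Finset.sum_range_succ'] at h2
      -- Dropping the `j = 0` term of the binomial sum leaves `2^M - 1`.
      have h3 : ∑ j ∈ Finset.range M, M.choose (j + 1) ≤ 2 ^ M := by omega
      exact_mod_cast h3
    · rw [enorm_mul]
      gcongr
      · rw [← enorm_norm, Complex.norm_real, enorm_norm, Real.enorm_of_nonneg (by positivity)]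
      · refine (enorm_integral_le_lintegral_enorm _).trans ?_
        simp only [enorm_mul]
        exact lintegral_heatMixture_mul_le hg.1 hk.integrableOn hT x

theorem maximalFunction_le_eLpNorm_top {g : 𝔼 → ℂ} (x : 𝔼) :
    maximalFunction g x ≤ eLpNorm g ∞ volume := by
  refine iSup₂_le fun r hr => ?_
  have h : ∫⁻ y in Metric.ball x r, ‖g y‖ₑ ≤ eLpNorm g ∞ volume * volume (Metric.ball x r) := by
    rw [← setLIntegral_const, eLpNorm_exponent_top]
    exact lintegral_mono_ae (ae_restrict_of_ae ae_le_eLpNormEssSup)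
  calc _ ≤ (volume (Metric.ball x r))⁻¹ * (eLpNorm g ∞ volume * volume (Metric.ball x r)) := by
        gcongr
    _ = eLpNorm g ∞ volume * ((volume (Metric.ball x r))⁻¹ * volume (Metric.ball x r)) := by ring
    _ ≤ eLpNorm g ∞ volume * 1 := by
        gcongr
        exact ENNReal.inv_mul_le_one _
    _ = _ := mul_one _

theorem lintegral_enorm_rpow_toReal {p : ℝ≥0∞} (hp0 : p ≠ 0) (hp : p ≠ ∞) (g : 𝔼 → ℂ) :
    ∫⁻ x, ‖g x‖ₑ ^ p.toReal = eLpNorm g p volume ^ p.toReal := by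
  rw [eLpNorm_eq_lintegral_rpow_enorm_toReal hp0 hp, ← ENNReal.rpow_mul, one_div,
    inv_mul_cancel₀ (ENNReal.toReal_ne_zero.2 ⟨hp0, hp⟩), ENNReal.rpow_one]

/-- The optimisation in `T` requires a finite value of `M_g(x)`. This is where `p > 1` enters the
pointwise inequality. -/
theorem ae_maximalFunction_lt_top {p : ℝ≥0∞} (hp : 1 < p) {g : 𝔼 → ℂ} (hg : MemLp g p) :
    ∀ᵐ x, maximalFunction g x < ∞ := by
  rcases eq_or_ne p ∞ with rfl | hpt
  · exact Eventually.of_forall fun x => (maximalFunction_le_eLpNorm_top x).trans_lt hg.2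
  · have hp1 : 1 < p.toReal := by
      rw [← ENNReal.toReal_one]
      exact (ENNReal.toReal_lt_toReal ENNReal.one_ne_top hpt).2 hp
    obtain ⟨C, hC⟩ := lintegral_maximalFunction_rpow_le (n := n) hp1
    have h0 := lintegral_enorm_rpow_toReal (one_pos.trans hp).ne' hpt g
    have h1 : ∫⁻ x, ‖g x‖ₑ ^ p.toReal < ∞ := by
      rw [h0]; exact ENNReal.rpow_lt_top_of_nonneg (by positivity) hg.2.ne
    have h2 := (hC g hg.1 h1).trans_lt (ENNReal.mul_lt_top ENNReal.coe_lt_top h1)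
    have h3 := ae_lt_top ((lowerSemicontinuous_maximalFunction g).measurable.pow_const _) h2.ne
    filter_upwards [h3] with x hx
    by_contra h
    rw [not_lt, top_le_iff] at h
    rw [h, ENNReal.top_rpow_of_pos (by linarith)] at hx
    exact lt_irrefl _ hx

/-- Optimization of a two-parameter bound over dyadic scales. -/
theorem le_rpow_mul_rpow_of_forall_zpow_le {α β : ℝ} (hα : 0 < α) (hβ : 0 < β)
    {y B m : ℝ≥0∞} {A K : ℝ≥0} (hB : B < ∞) (hm : m < ∞)
    (h : ∀ j : ℤ, y ≤ A * (ENNReal.ofReal (((2 : ℝ) ^ j) ^ (-(β / 2))) * B)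
      + ENNReal.ofReal (((2 : ℝ) ^ j) ^ (α / 2)) * (K * m)) :
    y ≤ ((A * Real.toNNReal (2 ^ (β / 2)) + K : ℝ≥0) : ℝ≥0∞)
      * m ^ (β / (α + β)) * B ^ (α / (α + β)) := by
  lift B to ℝ≥0 using hB.ne
  lift m to ℝ≥0 using hm.ne
  have hy : y < ∞ := (h 0).trans_lt (by finiteness)
  lift y to ℝ≥0 using hy.ne
  have hαβ : 0 < α + β := by positivity
  have h' (j : ℤ) : (y : ℝ) ≤ A * (((2 : ℝ) ^ j) ^ (-(β / 2)) * B)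
      + ((2 : ℝ) ^ j) ^ (α / 2) * (K * m) := by
    have h1 := ENNReal.toReal_mono (by finiteness) (h j)
    rw [ENNReal.toReal_add (by finiteness) (by finiteness)] at h1
    simp only [ENNReal.toReal_mul, ENNReal.coe_toReal] at h1
    rwa [ENNReal.toReal_ofReal (by positivity), ENNReal.toReal_ofReal (by positivity)] at h1
  -- Pass from dyadic to arbitrary `T` through `2^j ≤ T < 2^{j+1}`, losing only the factor `2^{β/2}`
  -- in the first term.
  have hscale {T : ℝ} (hT : 0 < T) : (y : ℝ) ≤ A * 2 ^ (β / 2) * (T ^ (-(β / 2)) * B)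
      + K * (T ^ (α / 2) * m) := by
    obtain ⟨j, hj1, hj2⟩ := exists_mem_Ico_zpow hT (one_lt_two (α := ℝ))
    have h2 : (0 : ℝ) < 2 ^ j := by positivity
    have h3 : ((2 : ℝ) ^ j) ^ (-(β / 2)) ≤ 2 ^ (β / 2) * T ^ (-(β / 2)) := by
      calc ((2 : ℝ) ^ j) ^ (-(β / 2)) ≤ (T / 2) ^ (-(β / 2)) := by
            refine Real.rpow_le_rpow_of_nonpos (by positivity) ?_ (by linarith)
            rw [zpow_add_one₀ two_ne_zero] at hj2
            linarith
        _ = _ := by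
            rw [Real.div_rpow hT.le two_pos.le, Real.rpow_neg two_pos.le, div_inv_eq_mul, mul_comm]
    have h4 : ((2 : ℝ) ^ j) ^ (α / 2) ≤ T ^ (α / 2) :=
      Real.rpow_le_rpow h2.le hj1 (by positivity)
    calc (y : ℝ) ≤ _ := h' j
      _ ≤ A * (2 ^ (β / 2) * T ^ (-(β / 2)) * B) + T ^ (α / 2) * (K * m) := by gcongr
      _ = _ := by ring
  have key : (y : ℝ) ≤ (A * 2 ^ (β / 2) + K) * (m : ℝ) ^ (β / (α + β)) * (B : ℝ) ^ (α / (α + β)) := by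
    -- The balancing scale degenerates when `B` or `m` is zero: let `T → 0` if `B = 0`, and `T → ∞`
    -- if `m = 0`.
    rcases eq_or_lt_of_le (NNReal.coe_nonneg B) with hB0 | hB0
    · have h1 : Tendsto (fun T : ℝ => K * (T ^ (α / 2) * (m : ℝ))) (𝓝[>] 0) (𝓝 0) := by
        have h2 : ContinuousAt (fun T : ℝ => K * (T ^ (α / 2) * (m : ℝ))) 0 :=
          continuousAt_const.mul ((Real.continuousAt_rpow_const _ _
            (Or.inr (by positivity))).mul continuousAt_const)
        have h3 := h2.tendsto.mono_left (nhdsWithin_le_nhds (s := Set.Ioi 0))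
        rwa [Real.zero_rpow (by positivity), zero_mul, mul_zero] at h3
      have h2 : (y : ℝ) ≤ 0 := by
        refine ge_of_tendsto h1 ?_
        filter_upwards [self_mem_nhdsWithin] with T hT
        have := hscale hT
        rwa [← hB0, mul_zero, mul_zero, zero_add] at this
      exact h2.trans (by positivity)
    rcases eq_or_lt_of_le (NNReal.coe_nonneg m) with hm0 | hm0
    · have h1 : Tendsto (fun T : ℝ => A * 2 ^ (β / 2) * (T ^ (-(β / 2)) * (B : ℝ))) atTop (𝓝 0) := by
        have h3 := ((tendsto_rpow_neg_atTop (show 0 < β / 2 by positivity)).mul_const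
          (B : ℝ)).const_mul (A * 2 ^ (β / 2) : ℝ)
        rwa [zero_mul, mul_zero] at h3
      have h2 : (y : ℝ) ≤ 0 := by
        refine ge_of_tendsto h1 ?_
        filter_upwards [eventually_gt_atTop 0] with T hT
        have := hscale hT
        rwa [← hm0, mul_zero, mul_zero, add_zero] at this
      exact h2.trans (by positivity)
    -- This scale makes `T^{-β/2} B` and `T^{α/2} m` equal.
    have h1 := hscale (T := ((B : ℝ) / m) ^ (2 / (α + β))) (by positivity)
    have e (r : ℝ) : (((B : ℝ) / m) ^ (2 / (α + β))) ^ r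
        = (B : ℝ) ^ (2 / (α + β) * r) * (m : ℝ) ^ (-(2 / (α + β) * r)) := by
      rw [← Real.rpow_mul (by positivity), Real.div_rpow hB0.le hm0.le, Real.rpow_neg hm0.le,
        div_eq_mul_inv]
    have e1 : (B : ℝ) ^ (2 / (α + β) * -(β / 2)) * (m : ℝ) ^ (-(2 / (α + β) * -(β / 2))) * B
        = (m : ℝ) ^ (β / (α + β)) * (B : ℝ) ^ (α / (α + β)) := by
      have : (B : ℝ) ^ (α / (α + β)) = (B : ℝ) ^ (2 / (α + β) * -(β / 2)) * B := by
        nth_rewrite 3 [← Real.rpow_one (B : ℝ)]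
        rw [← Real.rpow_add hB0]
        congr 1
        field_simp
        ring
      rw [this]
      have : -(2 / (α + β) * -(β / 2)) = β / (α + β) := by field_simp
      rw [this]
      ring
    have e2 : (B : ℝ) ^ (2 / (α + β) * (α / 2)) * (m : ℝ) ^ (-(2 / (α + β) * (α / 2))) * m
        = (m : ℝ) ^ (β / (α + β)) * (B : ℝ) ^ (α / (α + β)) := by
      have : (m : ℝ) ^ (β / (α + β)) = (m : ℝ) ^ (-(2 / (α + β) * (α / 2))) * m := by
        nth_rewrite 3 [← Real.rpow_one (m : ℝ)]
        rw [← Real.rpow_add hm0]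
        congr 1
        field_simp
        ring
      rw [this]
      have : 2 / (α + β) * (α / 2) = α / (α + β) := by field_simp
      rw [this]
      ring
    rw [e, e, e1, e2] at h1
    linarith
  have hθ : 0 ≤ β / (α + β) := by positivity
  have hθ' : 0 ≤ α / (α + β) := by positivity
  rw [← ENNReal.coe_rpow_of_nonneg _ hθ, ← ENNReal.coe_rpow_of_nonneg _ hθ', ← ENNReal.coe_mul,
    ← ENNReal.coe_mul, ENNReal.coe_le_coe, ← NNReal.coe_le_coe]
  push_cast
  rw [Real.coe_toNNReal _ (by positivity)]
  exact key

/-- The Hedberg-type inequality. -/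
theorem exists_forall_enorm_le_maximalFunction {α β : ℝ} (hα : 0 < α) (hβ : 0 < β) :
    ∃ C : ℝ≥0, ∀ p : ℝ≥0∞, 1 < p →
      ∀ (f G : 𝓢'(𝔼, ℂ)) (g : 𝔼 → ℂ),
        besovNorm β f < ∞ → IsFracLaplacian α f G → RepresentedBy G g → MemLp g p volume →
        ∃ F : 𝔼 → ℂ, RepresentedBy f F ∧
          ∀ᵐ x, ‖F x‖ₑ ≤
            C * maximalFunction g x ^ (β / (α + β)) * besovNorm β f ^ (α / (α + β)) := by
  obtain ⟨M, hM⟩ := exists_nat_gt (α / 2)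
  obtain ⟨k, hk1, hk2, hk3⟩ := exists_laplace_eq (half_pos hα) hM
  have hk : IsDiffLaplaceKernel (α / 2) M k := ⟨hk1, hk2, hk3⟩
  refine ⟨2 ^ M * Real.toNNReal (2 ^ (β / 2)) + (∫⁻ σ in Set.Ioi 0, ‖k σ‖ₑ).toNNReal,
    fun p hp f G g hf hfG hG hg => ?_⟩
  choose F hF hFb using fun j : ℤ => exists_representedBy_enorm_le hβ hp.le hf hfG hG hg hk
    (T := (2 : ℝ) ^ j) (by positivity)
  refine ⟨F 0, hF 0, ?_⟩
  -- The representing function may depend on the scale, but all of them agree almost everywhere.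
  -- Dyadic scales keep the exceptional null sets countable in number.
  have h1 : ∀ᵐ x, ∀ j, F 0 x = F j x := ae_all_iff.2 fun j => (hF 0).ae_eq (hF j)
  filter_upwards [h1, ae_all_iff.2 hFb, ae_maximalFunction_lt_top hp hg] with x hx1 hx2 hx3
  refine le_rpow_mul_rpow_of_forall_zpow_le hα hβ hf hx3 fun j => ?_
  rw [hx1 j, ENNReal.coe_toNNReal hk1.2.ne]
  exact_mod_cast hx2 j

/-- With `θ = β/(α+β)` the relation between the exponents reads `θ q = p`, so the `q`-th power of
the pointwise bound involves `M_g ^ p` and the strong maximal inequality applies. For `p = ∞` also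
`q = ∞`, and `M_g ≤ ‖g‖_∞` suffices. -/
theorem exists_forall_eLpNorm_le {α β : ℝ} (hα : 0 < α) (hβ : 0 < β) {p q : ℝ≥0∞} (hp : 1 < p)
    (hq : q⁻¹ = ENNReal.ofReal (β / (α + β)) * p⁻¹) :
    ∃ C : ℝ≥0, ∀ (f G : 𝓢'(𝔼, ℂ)) (g : 𝔼 → ℂ),
        besovNorm β f < ∞ → IsFracLaplacian α f G → RepresentedBy G g → MemLp g p volume →
        ∃ F : 𝔼 → ℂ, RepresentedBy f F ∧ MemLp F q volume ∧
          eLpNorm F q volume ≤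
            C * eLpNorm g p volume ^ (β / (α + β)) * besovNorm β f ^ (α / (α + β)) := by
  have hθ : 0 < β / (α + β) := by positivity
  have hθ' : 0 < α / (α + β) := by positivity
  suffices h : ∃ C : ℝ≥0, ∀ (f G : 𝓢'(𝔼, ℂ)) (g : 𝔼 → ℂ),
        besovNorm β f < ∞ → IsFracLaplacian α f G → RepresentedBy G g → MemLp g p volume →
        ∃ F : 𝔼 → ℂ, RepresentedBy f F ∧ eLpNorm F q volume ≤
            C * eLpNorm g p volume ^ (β / (α + β)) * besovNorm β f ^ (α / (α + β)) by
    obtain ⟨C, h⟩ := h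
    refine ⟨C, fun f G g hf hfG hG hg => ?_⟩
    obtain ⟨F, hF, hFb⟩ := h f G g hf hfG hG hg
    refine ⟨F, hF, ⟨hF.locallyIntegrable.aestronglyMeasurable, hFb.trans_lt ?_⟩, hFb⟩
    exact ENNReal.mul_lt_top (ENNReal.mul_lt_top ENNReal.coe_lt_top
      (ENNReal.rpow_lt_top_of_nonneg hθ.le hg.2.ne)) (ENNReal.rpow_lt_top_of_nonneg hθ'.le hf.ne)
  obtain ⟨C, hC⟩ := exists_forall_enorm_le_maximalFunction (n := n) hα hβ
  rcases eq_or_ne p ∞ with rfl | hpt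
  · have hqt : q = ∞ := by simpa using hq
    subst hqt
    refine ⟨C, fun f G g hf hfG hG hg => ?_⟩
    obtain ⟨F, hF, hFb⟩ := hC ∞ hp f G g hf hfG hG hg
    refine ⟨F, hF, ?_⟩
    rw [eLpNorm_exponent_top]
    refine essSup_le_of_ae_le _ (hFb.mono fun x hx => hx.trans ?_)
    beta_reduce
    gcongr _ * ?_ ^ _ * _
    exact maximalFunction_le_eLpNorm_top x
  · have hp0 : p ≠ 0 := (one_pos.trans hp).ne'
    have hp1 : 1 < p.toReal := by
      rw [← ENNReal.toReal_one]
      exact (ENNReal.toReal_lt_toReal ENNReal.one_ne_top hpt).2 hp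
    have hqi : q.toReal⁻¹ = β / (α + β) * p.toReal⁻¹ := by
      rw [← ENNReal.toReal_inv, hq, ENNReal.toReal_mul, ENNReal.toReal_ofReal hθ.le,
        ENNReal.toReal_inv]
    have hqr : 0 < q.toReal := by
      rw [← inv_pos, hqi]; positivity
    obtain ⟨hq0, hqt⟩ := ENNReal.toReal_ne_zero.1 hqr.ne'
    have hpq : β / (α + β) * q.toReal = p.toReal := by
      have : p.toReal ≠ 0 := by positivity
      have h1 : β / (α + β) = q.toReal⁻¹ * p.toReal := by rw [hqi]; field_simp
      rw [h1]
      field_simp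
    obtain ⟨D, hD⟩ := lintegral_maximalFunction_rpow_le (n := n) hp1
    refine ⟨C * D ^ (q.toReal⁻¹), fun f G g hf hfG hG hg => ?_⟩
    obtain ⟨F, hF, hFb⟩ := hC p hp f G g hf hfG hG hg
    refine ⟨F, hF, ?_⟩
    set B := besovNorm β f ^ (α / (α + β)) with hB
    have h0 := lintegral_enorm_rpow_toReal hp0 hpt g
    have h1 : ∫⁻ x, ‖g x‖ₑ ^ p.toReal < ∞ := by
      rw [h0]; exact ENNReal.rpow_lt_top_of_nonneg (by positivity) hg.2.ne
    have h2 := hD g hg.1 h1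
    rw [h0] at h2
    have h3 : ∫⁻ x, ‖F x‖ₑ ^ q.toReal
        ≤ (C * B) ^ q.toReal * (D * eLpNorm g p volume ^ p.toReal) := by
      calc _ ≤ ∫⁻ x, (C * B) ^ q.toReal * maximalFunction g x ^ p.toReal := by
            refine lintegral_mono_ae (hFb.mono fun x hx => ?_)
            calc _ ≤ (C * maximalFunction g x ^ (β / (α + β)) * B) ^ q.toReal := by gcongr
              _ = _ := by
                rw [mul_right_comm, ENNReal.mul_rpow_of_nonneg _ _ hqr.le, ← ENNReal.rpow_mul, hpq]
        _ = (C * B) ^ q.toReal * ∫⁻ x, maximalFunction g x ^ p.toReal :=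
            lintegral_const_mul _ ((lowerSemicontinuous_maximalFunction g).measurable.pow_const _)
        _ ≤ _ := by gcongr
    rw [eLpNorm_eq_lintegral_rpow_enorm_toReal hq0 hqt, one_div]
    calc _ ≤ ((C * B) ^ q.toReal * (D * eLpNorm g p volume ^ p.toReal)) ^ q.toReal⁻¹ := by gcongr
      _ = (C * B) * (D ^ q.toReal⁻¹ * eLpNorm g p volume ^ (β / (α + β))) := by
          have hi : 0 ≤ q.toReal⁻¹ := by positivity
          have h4 : p.toReal * q.toReal⁻¹ = β / (α + β) := by
            rw [← hpq]; field_simp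
          rw [ENNReal.mul_rpow_of_nonneg _ _ hi, ENNReal.mul_rpow_of_nonneg _ _ hi,
            ← ENNReal.rpow_mul, ← ENNReal.rpow_mul, mul_inv_cancel₀ hqr.ne', ENNReal.rpow_one, h4]
      _ = _ := by
          rw [ENNReal.coe_mul, ENNReal.coe_rpow_of_nonneg _ (by positivity)]
          ring

end Hedberg

theorem mainTheorem2 (n : ℕ) (hn : 1 ≤ n) (α β : ℝ) (hα : 0 < α) (hβ : 0 < β) :
    -- the reproducing formula, in the sense of tempered distributions
    (∀ N : ℕ, α / 2 < (N : ℝ) →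
      ∀ f : 𝓢'(EuclideanSpace ℝ (Fin n), ℂ), besovNorm β f < ∞ →
      ∀ φ : 𝓢(EuclideanSpace ℝ (Fin n), ℂ),
        IntegrableOn
          (fun t : ℝ => (t : ℂ) ^ N * (Laplacian.laplacian^[N] (heat t f)) φ / (t : ℂ))
          (Set.Ioi 0) ∧
        f φ = ((-1) ^ N / ((Real.Gamma (N : ℝ) : ℝ) : ℂ)) *
          ∫ t in Set.Ioi (0 : ℝ),
            (t : ℂ) ^ N * (Laplacian.laplacian^[N] (heat t f)) φ / (t : ℂ)) ∧
    -- the pointwise inequality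
    (∃ C : ℝ≥0, ∀ p : ℝ≥0∞, 1 < p →
      ∀ (f G : 𝓢'(EuclideanSpace ℝ (Fin n), ℂ)) (g : EuclideanSpace ℝ (Fin n) → ℂ),
        besovNorm β f < ∞ → IsFracLaplacian α f G → RepresentedBy G g → MemLp g p volume →
        ∃ F : EuclideanSpace ℝ (Fin n) → ℂ, RepresentedBy f F ∧
          ∀ᵐ x, ‖F x‖ₑ ≤
            C * maximalFunction g x ^ (β / (α + β)) * besovNorm β f ^ (α / (α + β))) ∧
    -- the norm inequality
    (∀ p q : ℝ≥0∞, 1 < p → q⁻¹ = ENNReal.ofReal (β / (α + β)) * p⁻¹ →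
      ∃ C : ℝ≥0,
      ∀ (f G : 𝓢'(EuclideanSpace ℝ (Fin n), ℂ)) (g : EuclideanSpace ℝ (Fin n) → ℂ),
        besovNorm β f < ∞ → IsFracLaplacian α f G → RepresentedBy G g → MemLp g p volume →
        ∃ F : EuclideanSpace ℝ (Fin n) → ℂ, RepresentedBy f F ∧ MemLp F q volume ∧
          eLpNorm F q volume ≤
            C * eLpNorm g p volume ^ (β / (α + β)) * besovNorm β f ^ (α / (α + β))) := by
  refine ⟨fun N hN f hf φ => ?_, exists_forall_enorm_le_maximalFunction hα hβ,
    fun p q hp hq => exists_forall_eLpNorm_le hα hβ hp hq⟩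
  exact reproducing_formula hβ (Nat.cast_pos.1 ((half_pos hα).trans hN)) hf φ
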